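/- All graphs are finite and simple; $n$ and $m$ denote the numbers of vertices and edges. An orientation of a graph replaces each edge $uv$ by exactly one of $(u,v)$, $(v,u)$. It is transitive if $(u,v),(v,w)\in F$ implies $(u,w)\in F$, and alternating if on every chordless cycle of length at least $4$ the directions of the edges alternate (no vertex of the cycle has both an incoming and an outgoing arc of the cycle). A cocomparability graph is a graph whose complement has a transitive orientation; a graph is alternately orientable if it has an alternating orientation. (1) Alternately orientable cocomparability graphs can be recognized in $O(nm)$ time, and an alternating orientation of a cocomparability graph can be computed (if one exists) in the same time bound. Precisely: there are a program for a unit-cost random access machine and constants $k, C$ such that for every graph $G$ on the vertex set $\{0,\dots,n-1\}$, given by $n$, $m$ and a list of its edges, the program uses only numbers of size at most $(n+2)^k$ (words of $O(\log n)$ bits), halts after at most $C(nm+1)$ steps, accepts if $G$ is an alternately orientable cocomparability graph and rejects otherwise, and, when it accepts, outputs the list of arcs of an alternating orientation of $G$. (2) For a graph $G$ let $G^+$ be the graph whose vertices are the ordered pairs $(u,v)$ with $uv\in E(G)$, in which $(u,v)$ is adjacent to $(v,u)$ and to every $(v,w)$ such that $u,v,w$ are consecutive vertices of a chordless cycle of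 length $4$ in $G$. If $G$ is a cocomparability graph, then $G^+$ is bipartite if and only if $G$ is alternately orientable; moreover, for every proper $2$-colouring of $G^+$, each colour class is the arc set of an alternating orientation of $G$. -/

import Mathlib

/-! ### Orientations, comparability graphs, alternating orientations -/

/-- `F` is (the arc relation of) an orientation of `G`: every edge of `G` is directed in exactly
one of its two directions, and there are no other arcs. -/
def IsOrientation {V : Type*} (G : SimpleGraph V) (F : V → V → Prop) : Prop :=
  (∀ u v, F u v → G.Adj u v) ∧ ∀ u v, G.Adj u v → (F u v ↔ ¬ F v u)

def IsTransitiveOrientation {V : Type*} (G : SimpleGraph V) (F : V → V → Prop) : Prop :=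
  IsOrientation G F ∧ ∀ u v w, F u v → F v w → F u w

def IsComparabilityGraph {V : Type*} (G : SimpleGraph V) : Prop :=
  ∃ F, IsTransitiveOrientation G F

def IsCocomparabilityGraph {V : Type*} (G : SimpleGraph V) : Prop :=
  IsComparabilityGraph Gᶜ

/-- An orientation is alternating if on every chordless cycle of length at least `4` the directions
of the edges alternate, i.e. no vertex of the cycle has both an incoming and an outgoing arc on
the cycle. The chordless cycles of length `k` are the induced copies of `cycleGraph k`. -/
def IsAlternatingOrientation {V : Type*} (G : SimpleGraph V) (F : V → V → Prop) : Prop :=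
  IsOrientation G F ∧
    ∀ k : ℕ, 4 ≤ k → ∀ c : SimpleGraph.cycleGraph k ↪g G, ∀ x y z : Fin k,
      F (c x) (c y) → ¬ F (c y) (c z)

def IsAlternatelyOrientable {V : Type*} (G : SimpleGraph V) : Prop :=
  ∃ F, IsAlternatingOrientation G F

/-- The auxiliary graph `G⁺`. Its vertices are the ordered pairs `(u, v)` with `uv` an edge of `G`;
`(u, v)` is adjacent to `(v, u)`, and to each `(v, w)` such that `u, v, w` are consecutive vertices
of a chordless cycle of length `4` of `G`. -/
def auxGraph {V : Type*} (G : SimpleGraph V) : SimpleGraph G.Dart :=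
  SimpleGraph.fromRel fun a b =>
    b = a.symm ∨
      (a.snd = b.fst ∧
        ∃ c : SimpleGraph.cycleGraph 4 ↪g G, c 0 = a.fst ∧ c 1 = a.snd ∧ c 2 = b.snd)

/-! ### A random access machine with unit-cost operations on bounded words -/

namespace RAM

/-- A memory state: registers and arrays, named by natural numbers (a program mentions only
finitely many names). All cells hold natural numbers. -/
structure State where
  reg : ℕ → ℕ
  arr : ℕ → ℕ → ℕ

/-- Expressions: constants, registers, array cells, sum, truncated difference, product. -/
inductive Expr
  | lit (c : ℕ)
  | reg (x : ℕ)
  | arr (a : ℕ) (i : Expr)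
  | add (e f : Expr)
  | sub (e f : Expr)
  | mul (e f : Expr)

def Expr.eval (s : State) : Expr → ℕ
  | .lit c => c
  | .reg x => s.reg x
  | .arr a i => s.arr a (i.eval s)
  | .add e f => e.eval s + f.eval s
  | .sub e f => e.eval s - f.eval s
  | .mul e f => e.eval s * f.eval s

/-- The number of elementary operations in the evaluation of an expression. -/
def Expr.cost : Expr → ℕ
  | .lit _ => 1
  | .reg _ => 1
  | .arr _ i => i.cost + 1
  | .add e f => e.cost + f.cost + 1
  | .sub e f => e.cost + f.cost + 1
  | .mul e f => e.cost + f.cost + 1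

/-- Every value (in particular every address) that occurs in the evaluation of the expression is
at most `B`, i.e. fits into a machine word. -/
def Expr.Fits (B : ℕ) (s : State) : Expr → Prop
  | .lit c => c ≤ B
  | .reg x => s.reg x ≤ B
  | .arr a i => i.Fits B s ∧ s.arr a (i.eval s) ≤ B
  | .add e f => e.Fits B s ∧ f.Fits B s ∧ e.eval s + f.eval s ≤ B
  | .sub e f => e.Fits B s ∧ f.Fits B s
  | .mul e f => e.Fits B s ∧ f.Fits B s ∧ e.eval s * f.eval s ≤ B

/-- Programs. A test succeeds if the value of the expression is not `0`. -/
inductive Cmd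
  | skip
  | assign (x : ℕ) (e : Expr)
  | store (a : ℕ) (i e : Expr)
  | seq (p q : Cmd)
  | ite (e : Expr) (p q : Cmd)
  | while (e : Expr) (p : Cmd)

def State.setReg (s : State) (x v : ℕ) : State :=
  { s with reg := Function.update s.reg x v }

def State.setArr (s : State) (a i v : ℕ) : State :=
  { s with arr := Function.update s.arr a (Function.update (s.arr a) i v) }

/-- `Runs B p s t s'`: started in the state `s`, the program `p` halts after exactly `t` steps in
the state `s'`, and no value exceeding the word bound `B` ever occurs. (A program that produces such
a value is stuck: no rule applies.) -/
inductive Runs (B : ℕ) : Cmd → State → ℕ → State → Prop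
  | skip (s : State) : Runs B .skip s 1 s
  | assign (s : State) (x : ℕ) (e : Expr) (he : e.Fits B s) :
      Runs B (.assign x e) s (e.cost + 1) (s.setReg x (e.eval s))
  | store (s : State) (a : ℕ) (i e : Expr) (hi : i.Fits B s) (he : e.Fits B s) :
      Runs B (.store a i e) s (i.cost + e.cost + 1) (s.setArr a (i.eval s) (e.eval s))
  | seq {p q : Cmd} {s s' s'' : State} {t t' : ℕ} (hp : Runs B p s t s')
      (hq : Runs B q s' t' s'') : Runs B (.seq p q) s (t + t') s''
  | ite_true {e : Expr} {p q : Cmd} {s s' : State} {t : ℕ} (hf : e.Fits B s)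
      (he : e.eval s ≠ 0) (hp : Runs B p s t s') : Runs B (.ite e p q) s (e.cost + 1 + t) s'
  | ite_false {e : Expr} {p q : Cmd} {s s' : State} {t : ℕ} (hf : e.Fits B s)
      (he : e.eval s = 0) (hq : Runs B q s t s') : Runs B (.ite e p q) s (e.cost + 1 + t) s'
  | while_true {e : Expr} {p : Cmd} {s s' s'' : State} {t t' : ℕ} (hf : e.Fits B s)
      (he : e.eval s ≠ 0) (hp : Runs B p s t s') (hw : Runs B (.while e p) s' t' s'') :
      Runs B (.while e p) s (e.cost + 1 + t + t') s''
  | while_false {e : Expr} {p : Cmd} {s : State} (hf : e.Fits B s) (he : e.eval s = 0) :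
      Runs B (.while e p) s (e.cost + 1) s

end RAM

/-! ### Graphs as inputs, orientations as outputs -/

/-- `es` lists every edge of `G` exactly once, in any order and with its endpoints in any order.
In particular `m` is the number of edges of `G`. -/
def IsEdgeList {n m : ℕ} (G : SimpleGraph (Fin n)) (es : Fin m → Fin n × Fin n) : Prop :=
  Function.Injective (fun i => s((es i).1, (es i).2)) ∧
    Set.range (fun i => s((es i).1, (es i).2)) = G.edgeSet

/-- The input state: register `0` holds the number `n` of vertices, register `1` the number `m` of
edges, and arrays `0` and `1` hold the endpoints of the edges; everything else is `0`. -/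
def inputState {n m : ℕ} (es : Fin m → Fin n × Fin n) : RAM.State where
  reg x := if x = 0 then n else if x = 1 then m else 0
  arr a i :=
    if h : i < m then
      if a = 0 then ((es ⟨i, h⟩).1 : ℕ) else if a = 1 then ((es ⟨i, h⟩).2 : ℕ) else 0
    else 0

/-- The first `m` cells of arrays `2` (tails) and `3` (heads) list the arcs of `F`. -/
def OutputsArcs {n : ℕ} (m : ℕ) (s : RAM.State) (F : Fin n → Fin n → Prop) : Prop :=
  (∀ i < m, ∃ u v : Fin n, F u v ∧ s.arr 2 i = u ∧ s.arr 3 i = v) ∧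
    ∀ u v : Fin n, F u v → ∃ i < m, s.arr 2 i = u ∧ s.arr 3 i = v

/-! Both properties in question come down to one test: does some class of a symmetric relation on
ordered pairs contain a pair together with its reverse?

For the complement this is Ghouila-Houri's theorem: a finite graph with an orientation that respects
the forcing relation has a transitive orientation. Conversely, a transitive orientation respects
forcing, so it contains a forcing class entirely or not at all, and no class can contain a pair and
its reverse. To pass from quasi-transitive to transitive, the classes are reoriented by their
lexicographically first members. A cyclic triangle would then propagate along a whole class
(`IsQuasiTransitiveOrientation.cyclic_triangle`) until it meets such a first member and contradicts
its minimality.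

A cocomparability graph has no chordless cycle of length five or more
(`not_cycleGraph_embedding_of_five_le`). So an orientation is alternating as soon as, on every
chordless 4-cycle `u, v, w, x`, the arc `u → v` entails `w → v`. This is what a proper 2-colouring
of `auxGraph` expresses, which gives the second claim.

The running time depends on finding generators of both relations in O(nm) time. In the complement,
`(a, b)` forces `(a, c)` with `b ≠ c` exactly if `bc` is an edge of `G` and `a` is a nonneighbour of
both ends, so (dart, vertex) pairs enumerate everything. For the alternating condition it must be
decided in constant time whether a path `u, v, w` lies on a chordless 4-cycle. A quasi-transitive
orientation `O` of the complement makes this possible: if `O u w`, then a nonneighbour `x` of `v`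
that is adjacent to `w` and has `O x v` is automatically adjacent to `u`
(`exists_isFourCycle_of_hasBelow`). Two bits per dart, computed in O(nm) time, therefore answer all
queries (`exists_isFourCycle_iff`). The machine never needs a transitive orientation of the
complement; a quasi-transitive one suffices.

The classes are found by breadth-first search in time linear in the number of generators,
independently of the number of pairs, since memory starts out as zero. Comparing the label of a pair
with that of its reverse gives both the test and the orientation (`RepresentsRel.labelLT`,
`RepresentsRel.ne_of_invariant`). -/

/-! ### Quasi-transitive orientations -/

/-- The forcing relation between the ordered pairs of adjacent vertices of `H`: two pairs with a
common tail (or head) whose other ends are not adjacent. -/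
inductive Forces {V : Type*} (H : SimpleGraph V) : V × V → V × V → Prop
  | right {a b c : V} (hb : H.Adj a b) (hc : H.Adj a c) (h : ¬ H.Adj b c) :
      Forces H (a, b) (a, c)
  | left {a b c : V} (hb : H.Adj b a) (hc : H.Adj c a) (h : ¬ H.Adj b c) :
      Forces H (b, a) (c, a)

/-- An orientation is quasi-transitive if it respects the forcing relation. -/
def IsQuasiTransitiveOrientation {V : Type*} (H : SimpleGraph V) (F : V → V → Prop) : Prop :=
  IsOrientation H F ∧ ∀ a b c, H.Adj a b → H.Adj a c → ¬ H.Adj b c → F a b → F a c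

section Forcing

variable {V : Type*} {H : SimpleGraph V}

theorem Forces.symm {p q : V × V} (h : Forces H p q) : Forces H q p := by
  cases h with
  | right hb hc h => exact .right hc hb fun h' => h h'.symm
  | left hb hc h => exact .left hc hb fun h' => h h'.symm

theorem Forces.swap {p q : V × V} (h : Forces H p q) : Forces H p.swap q.swap := by
  cases h with
  | right hb hc h => exact .left hb.symm hc.symm h
  | left hb hc h => exact .right hb.symm hc.symm h

theorem Forces.adj {p q : V × V} (h : Forces H p q) : H.Adj q.1 q.2 := by
  cases h with
  | right hb hc h => exact hc
  | left hb hc h => exact hc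

/-- Two ordered pairs are in the same implication class. -/
abbrev ForcesStar (H : SimpleGraph V) : V × V → V × V → Prop :=
  Relation.ReflTransGen (Forces H)

theorem ForcesStar.symm {p q : V × V} (h : ForcesStar H p q) : ForcesStar H q p :=
  have : Std.Symm (Forces H) := ⟨fun _ _ => Forces.symm⟩
  Relation.ReflTransGen.stdSymm.symm _ _ h

theorem ForcesStar.swap {p q : V × V} (h : ForcesStar H p q) : ForcesStar H p.swap q.swap :=
  h.lift Prod.swap fun _ _ => Forces.swap

theorem IsOrientation.asymm {F : V → V → Prop} (hF : IsOrientation H F) {u v : V} (h : F u v) :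
    ¬ F v u :=
  (hF.2 u v (hF.1 u v h)).1 h

theorem IsOrientation.of_not {F : V → V → Prop} (hF : IsOrientation H F) {u v : V}
    (huv : H.Adj u v) (h : ¬ F v u) : F u v :=
  (hF.2 u v huv).2 h

/-- If `a → b` but `c → a`, transitivity yields `c → b`, against the nonadjacency of `b` and `c`. -/
theorem IsTransitiveOrientation.isQuasiTransitiveOrientation {F : V → V → Prop}
    (hF : IsTransitiveOrientation H F) : IsQuasiTransitiveOrientation H F := by
  refine ⟨hF.1, fun a b c _ hc hn hab => ?_⟩
  by_contra h
  exact hn (hF.1.1 _ _ (hF.2 _ _ _ (hF.1.of_not hc.symm h) hab)).symm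

/-- The definition only treats a common tail. A common head follows by contraposition, applied to
the reversed arcs. -/
theorem IsQuasiTransitiveOrientation.forces {F : V → V → Prop}
    (hF : IsQuasiTransitiveOrientation H F) {p q : V × V} (h : Forces H p q) (hp : F p.1 p.2) :
    F q.1 q.2 := by
  cases h with
  | right hb hc h => exact hF.2 _ _ _ hb hc h hp
  | left hb hc h =>
    refine hF.1.of_not hc fun h' => hF.1.asymm hp ?_
    exact hF.2 _ _ _ hc.symm hb.symm (fun h' => h h'.symm) h'

theorem IsQuasiTransitiveOrientation.forcesStar {F : V → V → Prop}
    (hF : IsQuasiTransitiveOrientation H F) {p q : V × V} (h : ForcesStar H p q)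
    (hp : F p.1 p.2) : F q.1 q.2 := by
  induction h with
  | refl => exact hp
  | tail _ h ih => exact hF.forces h ih

/-- A vertex that spans a cyclic triangle with one arc of an implication class spans a cyclic
triangle with every arc of that class. -/
theorem IsQuasiTransitiveOrientation.cyclic_triangle {F : V → V → Prop}
    (hF : IsQuasiTransitiveOrientation H F) {a b c : V} {q : V × V} (hab : F a b) (hbc : F b c)
    (hca : F c a) (h : ForcesStar H (b, c) q) :
    F a q.1 ∧ F q.1 q.2 ∧ F q.2 a ∧ ForcesStar H (a, b) (a, q.1) := by
  induction h with
  | refl => exact ⟨hab, hbc, hca, .refl⟩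
  | tail hs h ih =>
    obtain ⟨h1, h2, h3, h4⟩ := ih
    have h5 := hF.forces h h2
    cases h with
    | @right x y z hb hc hn =>
      -- If `z` and `a` were not adjacent, `x → z` would force `x → a`, against `a → x`. Once they
      -- are adjacent, `(y, a)` forces `(z, a)`. The case of a common head is dual.
      have hza : H.Adj z a := by
        by_contra h'
        exact hF.1.asymm h1 (hF.2 x z a hc (hF.1.1 _ _ h1).symm h' h5)
      exact ⟨h1, h5, hF.forces (.left (hF.1.1 _ _ h3) hza hn) h3, h4⟩
    | @left x y z hb hc hn =>
      have hza : H.Adj a z := by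
        by_contra h'
        exact hF.1.asymm h5 (hF.2 x a z (hF.1.1 _ _ h3) hc.symm h' h3)
      have h6 : Forces H (a, y) (a, z) := .right (hF.1.1 _ _ h1) hza hn
      exact ⟨hF.forces h6 h1, h5, h3, h4.tail h6⟩

/-! ### From quasi-transitive to transitive orientations -/

variable [LinearOrder V]

/-- The triangle moves along the class of `(b, c)` to `a → p.1 → p.2 → a`, and `(p.1, a)` lies in
the class of `(b, a)`. Minimality gives `q ≤ (p.1, a)`, which together with `p ≤ q` makes the first
entries of `p` and `q` equal. Moving the new triangle, with apex `p.2`, along the class of `(a,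
p.1)` to `q` gives `p.2 → q.1 = p.1`, against `p.1 → p.2`. -/
theorem IsQuasiTransitiveOrientation.not_cyclic_triangle_of_le {F : V → V → Prop}
    (hF : IsQuasiTransitiveOrientation H F) {a b c : V} (hab : F a b) (hbc : F b c)
    (hca : F c a) {p q : V × V} (hp : ForcesStar H (b, c) p) (hq : ForcesStar H (a, b) q)
    (hmin : ∀ r, ForcesStar H (b, a) r → toLex q ≤ toLex r) (hpq : toLex p ≤ toLex q) :
    False := by
  obtain ⟨h1, h2, h3, h4⟩ := hF.cyclic_triangle hab hbc hca hp
  have h5 : toLex q ≤ toLex (p.1, a) := hmin _ h4.swap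
  have h6 : q.1 = p.1 := by
    rw [Prod.Lex.toLex_le_toLex] at h5 hpq
    apply le_antisymm
    · rcases h5 with h | h
      exacts [h.le, h.1.le]
    · rcases hpq with h | h
      exacts [h.le, h.1.le]
  have h7 := (hF.cyclic_triangle h3 h1 h2 (h4.symm.trans hq)).1
  rw [h6] at h7
  exact hF.1.asymm h2 h7

/-- The orientation that directs the lexicographically first pair of each implication class from
its smaller to its larger end. -/
def lexOrientation (H : SimpleGraph V) (u v : V) : Prop :=
  H.Adj u v ∧ ∃ p, ForcesStar H (u, v) p ∧ ∀ q, ForcesStar H (v, u) q → toLex p < toLex q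

theorem lexOrientation.exists_min {u v : V} (h : lexOrientation H u v) :
    ∃ p, ForcesStar H (u, v) p ∧ ∀ q, ForcesStar H (v, u) q → toLex p ≤ toLex q := by
  obtain ⟨-, p, hp, hp'⟩ := h
  exact ⟨p, hp, fun q hq => (hp' q hq).le⟩

variable [Finite V]

theorem exists_lex_min (p : V × V) :
    ∃ q, ForcesStar H p q ∧ ∀ r, ForcesStar H p r → toLex q ≤ toLex r := by
  obtain ⟨q, hq, h⟩ := Set.exists_min_image {q | ForcesStar H p q} toLex (Set.toFinite _)
    ⟨p, .refl⟩
  exact ⟨q, hq, h⟩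

/-- The given orientation serves only to show that the classes of a pair and of its reverse are
disjoint. Their minima are then distinct, so exactly one direction wins; respect for forcing holds
because the choice depends only on the class. -/
theorem IsQuasiTransitiveOrientation.lexOrientation {F : V → V → Prop}
    (hF : IsQuasiTransitiveOrientation H F) :
    IsQuasiTransitiveOrientation H (lexOrientation H) := by
  have hdisj : ∀ u v p, F u v → ForcesStar H (u, v) p → ¬ ForcesStar H (v, u) p := by
    intro u v p h h1 h2
    exact hF.1.asymm h (hF.forcesStar (h1.trans h2.symm) h)
  refine ⟨⟨fun u v h => h.1, fun u v huv => ⟨?_, fun h => ?_⟩⟩, fun a b c hb hc hn h => ?_⟩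
  · rintro ⟨-, p, hp, hp'⟩ ⟨-, q, hq, hq'⟩
    exact lt_asymm (hp' q hq) (hq' p hp)
  · obtain ⟨p, hp, hp'⟩ := exists_lex_min (H := H) (u, v)
    obtain ⟨q, hq, hq'⟩ := exists_lex_min (H := H) (v, u)
    have hne : p ≠ q := by
      rintro rfl
      by_cases h1 : F u v
      · exact hdisj u v p h1 hp hq
      · exact hdisj v u p (hF.1.of_not huv.symm h1) hq hp
    rcases lt_or_gt_of_ne (toLex.injective.ne hne) with h2 | h2
    · exact ⟨huv, p, hp, fun r hr => h2.trans_le (hq' r hr)⟩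
    · exact absurd ⟨huv.symm, q, hq, fun r hr => h2.trans_le (hp' r hr)⟩ h
  · obtain ⟨-, p, hp, hp'⟩ := h
    have h1 : Forces H (a, b) (a, c) := .right hb hc hn
    exact ⟨hc, p, .head h1.symm hp, fun q hq => hp' q (.head h1.swap hq)⟩

theorem IsQuasiTransitiveOrientation.isTransitiveOrientation_lexOrientation {F : V → V → Prop}
    (hF : IsQuasiTransitiveOrientation H F) :
    IsTransitiveOrientation H (_root_.lexOrientation H) := by
  have hD := hF.lexOrientation
  refine ⟨hD.1, fun a b c hab hbc => ?_⟩
  have hac : H.Adj a c := by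
    by_contra h
    exact hD.1.asymm hab (hD.2 b c a hbc.1 hab.1.symm (fun h' => h h'.symm) hbc)
  refine hD.1.of_not hac fun hca => ?_
  obtain ⟨p, hp, hp'⟩ := hab.exists_min
  obtain ⟨q, hq, hq'⟩ := hbc.exists_min
  obtain ⟨r, hr, hr'⟩ := hca.exists_min
  -- The smallest of the three witnesses takes the role of `p` in the previous lemma, and the
  -- witness of the preceding arc of the triangle takes the role of `q`.
  rcases le_total (toLex p) (toLex q) with h1 | h1
  · rcases le_total (toLex p) (toLex r) with h2 | h2
    · exact hD.not_cyclic_triangle_of_le hca hab hbc hp hr hr' h2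
    · exact hD.not_cyclic_triangle_of_le hbc hca hab hr hq hq' (h2.trans h1)
  · rcases le_total (toLex q) (toLex r) with h2 | h2
    · exact hD.not_cyclic_triangle_of_le hab hbc hca hq hp hp' h1
    · exact hD.not_cyclic_triangle_of_le hbc hca hab hr hq hq' h2

/-- A finite graph with a quasi-transitive orientation is a comparability graph. -/
theorem IsQuasiTransitiveOrientation.isComparabilityGraph {F : V → V → Prop}
    (hF : IsQuasiTransitiveOrientation H F) : IsComparabilityGraph H :=
  ⟨_, hF.isTransitiveOrientation_lexOrientation⟩

end Forcing

/-! ### Chordless cycles of cocomparability graphs -/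

section Cycles

variable {V : Type*} {G : SimpleGraph V}

/-- `u, v, w, x` are the consecutive vertices of a chordless cycle of length `4`. -/
structure IsFourCycle (G : SimpleGraph V) (u v w x : V) : Prop where
  uv : G.Adj u v
  vw : G.Adj v w
  wx : G.Adj w x
  xu : G.Adj x u
  uw : ¬ G.Adj u w
  vx : ¬ G.Adj v x
  uw_ne : u ≠ w
  vx_ne : v ≠ x

theorem IsFourCycle.reverse {u v w x : V} (h : IsFourCycle G u v w x) : IsFourCycle G w v u x :=
  ⟨h.vw.symm, h.uv.symm, h.xu.symm, h.wx.symm, fun h' => h.uw h'.symm, h.vx, h.uw_ne.symm,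
    h.vx_ne⟩

theorem isFourCycle_iff_exists_embedding {u v w x : V} :
    IsFourCycle G u v w x ↔
      ∃ c : SimpleGraph.cycleGraph 4 ↪g G, c 0 = u ∧ c 1 = v ∧ c 2 = w ∧ c 3 = x := by
  constructor
  · intro h
    refine ⟨⟨⟨![u, v, w, x], ?_⟩, ?_⟩, rfl, rfl, rfl, rfl⟩
    · intro i j
      fin_cases i <;> fin_cases j <;>
        simp [h.uv.ne, h.uv.ne', h.vw.ne, h.vw.ne', h.wx.ne, h.wx.ne', h.xu.ne, h.xu.ne', h.uw_ne,
          h.uw_ne.symm, h.vx_ne, h.vx_ne.symm]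
    · intro i j
      have h1 : ∀ i j : Fin 4, (SimpleGraph.cycleGraph 4).Adj i j ↔ i - j = 1 ∨ j - i = 1 :=
        fun i j => SimpleGraph.cycleGraph_adj
      have h2 := mt G.adj_symm h.uw
      have h3 := mt G.adj_symm h.vx
      rw [h1]
      fin_cases i <;> fin_cases j <;> first
        | exact iff_of_false (G.loopless.irrefl _) (by decide)
        | exact iff_of_true h.uv (by decide)
        | exact iff_of_true h.uv.symm (by decide)
        | exact iff_of_true h.vw (by decide)
        | exact iff_of_true h.vw.symm (by decide)
        | exact iff_of_true h.wx (by decide)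
        | exact iff_of_true h.wx.symm (by decide)
        | exact iff_of_true h.xu (by decide)
        | exact iff_of_true h.xu.symm (by decide)
        | exact iff_of_false h.uw (by decide)
        | exact iff_of_false h.vx (by decide)
        | exact iff_of_false h2 (by decide)
        | exact iff_of_false h3 (by decide)
  · rintro ⟨c, rfl, rfl, rfl, rfl⟩
    have h1 : ∀ i j : Fin 4, G.Adj (c i) (c j) ↔ i - j = 1 ∨ j - i = 1 :=
      fun i j => c.map_adj_iff.trans SimpleGraph.cycleGraph_adj
    constructor
    all_goals first
      | exact c.injective.ne (by decide)
      | (rw [h1]; decide)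

/-- In the complement, `(c i, c (i + 2))` forces `(c i, c (i + 3))`, which forces `(c (i + 1), c (i
+ 3))`; length at least five is what makes the middle pair nonadjacent in `G`. Hence all chords from
`c i` to `c (i + 2)` point the same way round, and transitivity along steps of two leads from `c 0`
back to itself. -/
theorem not_cycleGraph_embedding_of_five_le (hG : IsCocomparabilityGraph G) {k : ℕ} (hk : 5 ≤ k)
    (c : SimpleGraph.cycleGraph k ↪g G) : False := by
  obtain ⟨n, rfl⟩ := Nat.exists_eq_add_of_le' hk
  -- `Fin (n + 5)` is `ZMod (n + 5)` by definition; the latter provides the ring structure for index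
  -- computations.
  obtain ⟨c, hinj, hadj⟩ : ∃ f : ZMod (n + 5) → V, Function.Injective f ∧
      ∀ i j, G.Adj (f i) (f j) ↔ i - j = 1 ∨ j - i = 1 :=
    ⟨c, c.injective, fun i j => c.map_adj_iff.trans SimpleGraph.cycleGraph_adj⟩
  have hone : ∀ i, G.Adj (c i) (c (i + 1)) := fun i => by simp [hadj]
  have hval : ∀ j : ℕ, j + 1 < n + 5 → ((j + 1 : ℕ) : ZMod (n + 5)) ≠ 0 := by
    intro j hj h
    rw [ZMod.natCast_eq_zero_iff] at h
    exact absurd (Nat.le_of_dvd (by omega) h) (by omega)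
  have h10 : (1 : ZMod (n + 5)) ≠ 0 := by exact_mod_cast hval 0 (by omega)
  have h20 : (2 : ZMod (n + 5)) ≠ 0 := by exact_mod_cast hval 1 (by omega)
  have h30 : (3 : ZMod (n + 5)) ≠ 0 := by exact_mod_cast hval 2 (by omega)
  have h40 : (4 : ZMod (n + 5)) ≠ 0 := by exact_mod_cast hval 3 (by omega)
  have htwo : ∀ i, Gᶜ.Adj (c i) (c (i + 2)) := by
    intro i
    rw [SimpleGraph.compl_adj, hadj]
    refine ⟨hinj.ne ?_, ?_⟩
    · simpa using h20
    · rintro (h | h)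
      · exact h30 (by linear_combination -h)
      · exact h10 (by linear_combination h)
  have hthree : ∀ i, Gᶜ.Adj (c i) (c (i + 3)) := by
    intro i
    rw [SimpleGraph.compl_adj, hadj]
    refine ⟨hinj.ne ?_, ?_⟩
    · simpa using h30
    · rintro (h | h)
      · exact h40 (by linear_combination -h)
      · exact h20 (by linear_combination h)
  have hnone : ∀ i, ¬ Gᶜ.Adj (c i) (c (i + 1)) := fun i h =>
    ((SimpleGraph.compl_adj _ _ _).1 h).2 (hone i)
  obtain ⟨F, hF⟩ := hG
  have hQ := hF.isQuasiTransitiveOrientation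
  have hforce : ∀ i, ForcesStar Gᶜ (c i, c (i + 2)) (c (i + 1), c (i + 1 + 2)) := by
    intro i
    have h3 := hthree i
    have h2 := htwo (i + 1)
    have e : i + 1 + 2 = i + 3 := by ring
    have e' : i + 3 = i + 2 + 1 := by ring
    rw [e] at h2 ⊢
    exact .head (.right (htwo i) h3 (e' ▸ hnone (i + 2))) (.single (.left h3 h2 (hnone i)))
  have hall : ∀ j : ℕ, ForcesStar Gᶜ (c 0, c (0 + 2)) (c (j : ZMod (n + 5)), c (j + 2)) := by
    intro j
    induction j with
    | zero => simpa using Relation.ReflTransGen.refl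
    | succ j ih => push_cast; exact ih.trans (hforce _)
  by_cases h0 : F (c 0) (c (0 + 2))
  · have : ∀ j : ℕ, F (c 0) (c ((2 * (j + 1) : ℕ) : ZMod (n + 5))) := by
      intro j
      induction j with
      | zero => simpa using h0
      | succ j ih =>
        refine hF.2 _ _ _ ih ?_
        have := hQ.forcesStar (hall (2 * (j + 1))) h0
        have e : ((2 * (j + 1 + 1) : ℕ) : ZMod (n + 5)) = ((2 * (j + 1) : ℕ) : ZMod (n + 5)) + 2 := by
          push_cast; ring
        rwa [e]
    -- After `n + 5` steps of two the index is `2 * (n + 5)`, which vanishes whatever the parity of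
    -- the length.
    have h := this (n + 4)
    have e : ((2 * (n + 4 + 1) : ℕ) : ZMod (n + 5)) = 0 := by
      rw [ZMod.natCast_eq_zero_iff]; exact ⟨2, by ring⟩
    rw [e] at h
    exact Gᶜ.loopless.irrefl _ (hF.1.1 _ _ h)
  · have h0 : F (c (0 + 2)) (c 0) := hF.1.of_not (htwo 0).symm h0
    have : ∀ j : ℕ, F (c ((2 * (j + 1) : ℕ) : ZMod (n + 5))) (c 0) := by
      intro j
      induction j with
      | zero => simpa using h0
      | succ j ih =>
        refine hF.2 _ _ _ ?_ ih
        have := hQ.forcesStar (hall (2 * (j + 1))).swap h0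
        have e : ((2 * (j + 1 + 1) : ℕ) : ZMod (n + 5)) = ((2 * (j + 1) : ℕ) : ZMod (n + 5)) + 2 := by
          push_cast; ring
        rwa [e]
    have h := this (n + 4)
    have e : ((2 * (n + 4 + 1) : ℕ) : ZMod (n + 5)) = 0 := by
      rw [ZMod.natCast_eq_zero_iff]; exact ⟨2, by ring⟩
    rw [e] at h
    exact Gᶜ.loopless.irrefl _ (hF.1.1 _ _ h)

theorem IsAlternatingOrientation.of_isFourCycle {F : V → V → Prop} (hF : IsAlternatingOrientation G F)
    {u v w x : V} (h : IsFourCycle G u v w x) (huv : F u v) : F w v := by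
  obtain ⟨c, rfl, rfl, rfl, rfl⟩ := isFourCycle_iff_exists_embedding.1 h
  exact hF.1.of_not h.vw.symm (hF.2 4 le_rfl c 0 1 2 huv)

/-- Longer chordless cycles do not exist, and on a chordless 4-cycle the hypothesis turns `x → y`
into `z → y`, which excludes `y → z`. -/
theorem isAlternatingOrientation_of_isFourCycle (hG : IsCocomparabilityGraph G) {F : V → V → Prop}
    (hF : IsOrientation G F) (h : ∀ u v w x, IsFourCycle G u v w x → F u v → F w v) :
    IsAlternatingOrientation G F := by
  refine ⟨hF, fun k hk c x y z hxy hyz => ?_⟩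
  rcases hk.lt_or_eq with hk | rfl
  · exact not_cycleGraph_embedding_of_five_le hG hk c
  have h1 : ∀ i j : Fin 4, G.Adj (c i) (c j) ↔ i - j = 1 ∨ j - i = 1 :=
    fun i j => c.map_adj_iff.trans SimpleGraph.cycleGraph_adj
  have hxz : x ≠ z := by
    rintro rfl
    exact hF.asymm hxy hyz
  have h2 := (h1 _ _).1 (hF.1 _ _ hxy)
  have h3 := (h1 _ _).1 (hF.1 _ _ hyz)
  -- Two consecutive arcs `x → y → z` with `x ≠ z` determine the fourth vertex of the cycle; this is
  -- checked over `Fin 4`.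
  have hw : ∃ w : Fin 4, (w - z = 1 ∨ z - w = 1) ∧ (w - x = 1 ∨ x - w = 1) ∧ w ≠ y ∧
      ¬ (y - w = 1 ∨ w - y = 1) ∧ ¬ (x - z = 1 ∨ z - x = 1) := by
    clear hxy hyz
    revert x y z
    decide
  obtain ⟨w, h4, h5, h6, h7, h8⟩ := hw
  refine hF.asymm hyz (h (c x) (c y) (c z) (c w) ⟨(h1 _ _).2 h2, (h1 _ _).2 h3, (h1 _ _).2 h4.symm,
    (h1 _ _).2 h5, fun h => h8 ((h1 _ _).1 h), fun h => h7 ((h1 _ _).1 h), c.injective.ne hxz,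
    c.injective.ne h6.symm⟩ hxy)

end Cycles

/-! ### The auxiliary graph -/

section AuxGraph

variable {V : Type*} {G : SimpleGraph V}

theorem auxGraph_adj_symm (a : G.Dart) : (auxGraph G).Adj a a.symm := by
  rw [auxGraph, SimpleGraph.fromRel_adj]
  exact ⟨a.symm_ne.symm, Or.inl (Or.inl rfl)⟩

theorem auxGraph_adj_of_isFourCycle {u v w x : V} (h : IsFourCycle G u v w x) :
    (auxGraph G).Adj ⟨(u, v), h.uv⟩ ⟨(v, w), h.vw⟩ := by
  rw [auxGraph, SimpleGraph.fromRel_adj]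
  obtain ⟨c, h0, h1, h2, -⟩ := isFourCycle_iff_exists_embedding.1 h
  refine ⟨fun h' => h.uv.ne ?_, Or.inl (Or.inr ⟨rfl, c, h0, h1, h2⟩)⟩
  exact congrArg (fun d : G.Dart => d.fst) h'

/-- A pair is coloured by whether it is an arc. Along a chordless 4-cycle, `u → v` holds exactly if
`w → v`, that is, exactly if `(v, w)` is not an arc, so the colouring is proper. -/
theorem IsAlternatelyOrientable.isBipartite_auxGraph (h : IsAlternatelyOrientable G) :
    (auxGraph G).IsBipartite := by
  classical
  obtain ⟨F, hF⟩ := h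
  have key : ∀ a b : G.Dart, (b = a.symm ∨ (a.snd = b.fst ∧
      ∃ c : SimpleGraph.cycleGraph 4 ↪g G, c 0 = a.fst ∧ c 1 = a.snd ∧ c 2 = b.snd)) →
      (F a.fst a.snd ↔ ¬ F b.fst b.snd) := by
    rintro a b (rfl | ⟨hab, c, h0, h1, h2⟩)
    · exact hF.1.2 _ _ a.adj
    · have hs : IsFourCycle G a.fst a.snd b.snd (c 3) :=
        isFourCycle_iff_exists_embedding.2 ⟨c, h0, h1, h2, rfl⟩
      rw [← hab]
      constructor
      · exact fun h => hF.1.asymm (hF.of_isFourCycle hs h)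
      · exact fun h => hF.of_isFourCycle hs.reverse (hF.1.of_not hs.vw.symm h)
  refine ⟨SimpleGraph.Coloring.mk (fun d => if F d.fst d.snd then 0 else 1) ?_⟩
  intro a b hab
  rw [auxGraph, SimpleGraph.fromRel_adj] at hab
  have : F a.fst a.snd ↔ ¬ F b.fst b.snd := by
    rcases hab.2 with h | h
    · exact key a b h
    · have := key b a h
      tauto
  by_cases h1 : F b.fst b.snd <;> simp [this, h1]

/-- The edges between a pair and its reverse make a colour class an orientation. The remaining edges
give `(u, v)` and `(v, w)` different colours, hence `(u, v)` and `(w, v)` the same one. -/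
theorem isAlternatingOrientation_of_coloring (hG : IsCocomparabilityGraph G)
    (c : (auxGraph G).Coloring (Fin 2)) (b : Fin 2) :
    IsAlternatingOrientation G (fun u v => ∃ h : G.Adj u v, c ⟨(u, v), h⟩ = b) := by
  have key : ∀ x y : Fin 2, x ≠ y → (x = b ↔ ¬ y = b) := by
    revert b
    decide
  have hor : IsOrientation G (fun u v => ∃ h : G.Adj u v, c ⟨(u, v), h⟩ = b) := by
    refine ⟨fun u v h => h.1, fun u v huv => ?_⟩
    have := key _ _ (c.valid (auxGraph_adj_symm ⟨(u, v), huv⟩))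
    constructor
    · rintro ⟨h, h1⟩ ⟨h', h2⟩
      exact this.1 h1 h2
    · intro h
      exact ⟨huv, this.2 fun h2 => h ⟨huv.symm, h2⟩⟩
  refine isAlternatingOrientation_of_isFourCycle hG hor ?_
  rintro u v w x h ⟨h1, h2⟩
  have := key _ _ (c.valid (auxGraph_adj_of_isFourCycle h))
  exact hor.of_not h.vw.symm fun ⟨h3, h4⟩ => this.1 h2 h4

theorem isBipartite_auxGraph_iff (hG : IsCocomparabilityGraph G) :
    (auxGraph G).IsBipartite ↔ IsAlternatelyOrientable G :=
  ⟨fun ⟨c⟩ => ⟨_, isAlternatingOrientation_of_coloring hG c 0⟩,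
    fun h => h.isBipartite_auxGraph⟩

end AuxGraph

/-! ### Squares and quasi-transitive orientations of the complement -/

section Squares

variable {V : Type*} {G : SimpleGraph V}

/-- Some non-neighbour `x` of `v` is a neighbour of `w` and has `O x v`. -/
def HasBelow (G : SimpleGraph V) (O : V → V → Prop) (v w : V) : Prop :=
  ∃ x, x ≠ v ∧ ¬ G.Adj x v ∧ G.Adj x w ∧ O x v

/-- Some non-neighbour `x` of `v` is a neighbour of `w` and does not have `O x v`. -/
def HasAbove (G : SimpleGraph V) (O : V → V → Prop) (v w : V) : Prop :=
  ∃ x, x ≠ v ∧ ¬ G.Adj x v ∧ G.Adj x w ∧ ¬ O x v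

/-- If `x` were not adjacent to `u`, the edge `uv` would make `O x v` force `O x u`, while the edge
`wx` would make `O u w` force `O u x`. So any witness for the dart `(v, w)` closes the cycle,
whichever `u` is given; this replaces a search over the fourth vertex by a single bit. -/
theorem exists_isFourCycle_of_hasBelow {O : V → V → Prop} (hO : IsQuasiTransitiveOrientation Gᶜ O)
    {u v w : V} (huv : G.Adj u v) (hvw : G.Adj v w) (huw : O u w) (h : HasBelow G O v w) :
    ∃ x, IsFourCycle G u v w x := by
  obtain ⟨x, hxv, hnxv, hxw, hx⟩ := h
  obtain ⟨huw_ne, hnuw⟩ := (SimpleGraph.compl_adj _ _ _).1 (hO.1.1 _ _ huw)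
  refine ⟨x, huv, hvw, hxw.symm, ?_, hnuw, fun h' => hnxv h'.symm, huw_ne, hxv.symm⟩
  by_contra hxu
  have hxu_ne : x ≠ u := by
    rintro rfl
    exact hnxv huv
  have hc : Gᶜ.Adj x u := (SimpleGraph.compl_adj _ _ _).2 ⟨hxu_ne, hxu⟩
  have h1 : O x u := hO.2 x v u ((SimpleGraph.compl_adj _ _ _).2 ⟨hxv, hnxv⟩) hc
    (fun h' => ((SimpleGraph.compl_adj _ _ _).1 h').2 huv.symm) hx
  exact hO.1.asymm h1 (hO.2 u w x (hO.1.1 _ _ huw) hc.symm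
    (fun h' => ((SimpleGraph.compl_adj _ _ _).1 h').2 hxw.symm) huw)

theorem IsQuasiTransitiveOrientation.flip {H : SimpleGraph V} {O : V → V → Prop}
    (hO : IsQuasiTransitiveOrientation H O) : IsQuasiTransitiveOrientation H (flip O) :=
  ⟨⟨fun _ _ h => (hO.1.1 _ _ h).symm, fun u v h => hO.1.2 v u h.symm⟩,
    fun _ _ _ hb hc hn h => hO.forces (.left hb.symm hc.symm hn) h⟩

/-- `HasAbove` is phrased by a negation to match the other branch of the machine's test. For an
orientation this is the same as reversing the order, which lets one lemma serve both directions. -/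
theorem hasBelow_flip_iff {O : V → V → Prop} (hO : IsOrientation Gᶜ O) {v w : V} :
    HasBelow G (flip O) v w ↔ HasAbove G O v w := by
  refine exists_congr fun x => and_congr_right fun h1 => and_congr_right fun h2 =>
    and_congr_right fun h3 => ?_
  exact hO.2 v x ((SimpleGraph.compl_adj _ _ _).2 ⟨h1.symm, fun h => h2 h.symm⟩)

/-- The fourth vertex is either below or above `v`. The second case is the first one for the
reversed orientation and the reversed path. -/
theorem exists_isFourCycle_iff {O : V → V → Prop} (hO : IsQuasiTransitiveOrientation Gᶜ O)
    {u v w : V} (huv : G.Adj u v) (hvw : G.Adj v w) (huw : O u w) :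
    (∃ x, IsFourCycle G u v w x) ↔ HasBelow G O v w ∨ HasAbove G O v u := by
  constructor
  · rintro ⟨x, h⟩
    by_cases hx : O x v
    · exact Or.inl ⟨x, h.vx_ne.symm, fun h' => h.vx h'.symm, h.wx.symm, hx⟩
    · exact Or.inr ⟨x, h.vx_ne.symm, fun h' => h.vx h'.symm, h.xu, hx⟩
  · rintro (h | h)
    · exact exists_isFourCycle_of_hasBelow hO huv hvw huw h
    · obtain ⟨x, h⟩ := exists_isFourCycle_of_hasBelow hO.flip hvw.symm huv.symm huw
        ((hasBelow_flip_iff hO.1).2 h)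
      exact ⟨x, h.reverse⟩

end Squares

/-! ### Verification of programs for the random access machine -/

namespace RAM

/-- All cells hold values of at most `B`. -/
def State.Bdd (B : ℕ) (s : State) : Prop :=
  (∀ x, s.reg x ≤ B) ∧ ∀ a i, s.arr a i ≤ B

/-- The results of the additions and multiplications in the evaluation of the expression are at
most `B`, as are the constants. -/
def Expr.Mild (B : ℕ) (s : State) : Expr → Prop
  | .lit c => c ≤ B
  | .reg _ => True
  | .arr _ i => i.Mild B s
  | .add e f => e.Mild B s ∧ f.Mild B s ∧ e.eval s + f.eval s ≤ B
  | .sub e f => e.Mild B s ∧ f.Mild B s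
  | .mul e f => e.Mild B s ∧ f.Mild B s ∧ e.eval s * f.eval s ≤ B

theorem Expr.Mild.fits {B : ℕ} {s : State} (hs : s.Bdd B) {e : Expr} (h : e.Mild B s) :
    e.Fits B s := by
  induction e with
  | lit c => exact h
  | reg x => exact hs.1 x
  | arr a i ih => exact ⟨ih h, hs.2 _ _⟩
  | add e f ihe ihf => exact ⟨ihe h.1, ihf h.2.1, h.2.2⟩
  | sub e f ihe ihf => exact ⟨ihe h.1, ihf h.2⟩
  | mul e f ihe ihf => exact ⟨ihe h.1, ihf h.2.1, h.2.2⟩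

theorem Expr.Fits.eval_le {B : ℕ} {s : State} {e : Expr} (h : e.Fits B s) : e.eval s ≤ B := by
  induction e with
  | lit c => exact h
  | reg x => exact h
  | arr a i ih => exact h.2
  | add e f ihe ihf => exact h.2.2
  | sub e f ihe ihf => exact (Nat.sub_le _ _).trans (ihe h.1)
  | mul e f ihe ihf => exact h.2.2

theorem State.setReg_reg (s : State) (x v y : ℕ) :
    (s.setReg x v).reg y = if y = x then v else s.reg y := by
  simp [State.setReg, Function.update_apply]

theorem State.setReg_arr (s : State) (x v : ℕ) : (s.setReg x v).arr = s.arr := rfl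

theorem State.setArr_reg (s : State) (a i v : ℕ) : (s.setArr a i v).reg = s.reg := rfl

theorem State.setArr_arr (s : State) (a i v b : ℕ) :
    (s.setArr a i v).arr b = if b = a then Function.update (s.arr a) i v else s.arr b := by
  simp [State.setArr, Function.update_apply]

theorem State.Bdd.setReg {B : ℕ} {s : State} (hs : s.Bdd B) {x v : ℕ} (hv : v ≤ B) :
    (s.setReg x v).Bdd B := by
  refine ⟨fun y => ?_, hs.2⟩
  rw [State.setReg_reg]
  split_ifs
  exacts [hv, hs.1 y]

theorem State.Bdd.setArr {B : ℕ} {s : State} (hs : s.Bdd B) {a i v : ℕ} (hv : v ≤ B) :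
    (s.setArr a i v).Bdd B := by
  refine ⟨hs.1, fun b j => ?_⟩
  rw [State.setArr_arr]
  split_ifs
  · rw [Function.update_apply]
    split_ifs
    exacts [hv, hs.2 _ _]
  · exact hs.2 _ _

theorem Runs.bdd {B : ℕ} {c : Cmd} {s s' : State} {t : ℕ} (h : Runs B c s t s') (hs : s.Bdd B) :
    s'.Bdd B := by
  induction h with
  | skip s => exact hs
  | assign s x e he => exact hs.setReg he.eval_le
  | store s a i e hi he => exact hs.setArr he.eval_le
  | seq _ _ ihp ihq => exact ihq (ihp hs)
  | ite_true _ _ _ ih => exact ih hs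
  | ite_false _ _ _ ih => exact ih hs
  | while_true _ _ _ _ ihp ihw => exact ihw (ihp hs)
  | while_false _ _ => exact hs

/-! ### Memory that a program leaves unchanged -/

/-- The program contains an assignment to register `x`. -/
def Cmd.SetsReg (x : ℕ) : Cmd → Prop
  | .skip => False
  | .assign y _ => x = y
  | .store _ _ _ => False
  | .seq p q => p.SetsReg x ∨ q.SetsReg x
  | .ite _ p q => p.SetsReg x ∨ q.SetsReg x
  | .while _ p => p.SetsReg x

/-- The program contains a store to array `a`. -/
def Cmd.SetsArr (a : ℕ) : Cmd → Prop
  | .skip => False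
  | .assign _ _ => False
  | .store b _ _ => a = b
  | .seq p q => p.SetsArr a ∨ q.SetsArr a
  | .ite _ p q => p.SetsArr a ∨ q.SetsArr a
  | .while _ p => p.SetsArr a

theorem Runs.reg_eq {B : ℕ} {c : Cmd} {s s' : State} {t : ℕ} (h : Runs B c s t s') {x : ℕ}
    (hx : ¬ c.SetsReg x) : s'.reg x = s.reg x := by
  induction h with
  | skip s => rfl
  | assign s y e he => exact (State.setReg_reg _ _ _ _).trans (if_neg hx)
  | store s a i e hi he => rfl
  | seq _ _ ihp ihq => rw [ihq fun h => hx (Or.inr h), ihp fun h => hx (Or.inl h)]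
  | ite_true _ _ _ ih => exact ih fun h => hx (Or.inl h)
  | ite_false _ _ _ ih => exact ih fun h => hx (Or.inr h)
  | while_true _ _ _ _ ihp ihw => rw [ihw hx, ihp hx]
  | while_false _ _ => rfl

theorem Runs.arr_eq {B : ℕ} {c : Cmd} {s s' : State} {t : ℕ} (h : Runs B c s t s') {a : ℕ}
    (ha : ¬ c.SetsArr a) : s'.arr a = s.arr a := by
  induction h with
  | skip s => rfl
  | assign s y e he => rfl
  | store s b i e hi he => exact (State.setArr_arr _ _ _ _ _).trans (if_neg ha)
  | seq _ _ ihp ihq => rw [ihq fun h => ha (Or.inr h), ihp fun h => ha (Or.inl h)]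
  | ite_true _ _ _ ih => exact ih fun h => ha (Or.inl h)
  | ite_false _ _ _ ih => exact ih fun h => ha (Or.inr h)
  | while_true _ _ _ _ ihp ihw => rw [ihw ha, ihp ha]
  | while_false _ _ => rfl

/-! ### Total correctness with time bounds -/

/-- The program halts within `K` steps in a state that satisfies `Q`. -/
def Ends (B : ℕ) (c : Cmd) (s : State) (K : ℕ) (Q : State → Prop) : Prop :=
  ∃ t s', Runs B c s t s' ∧ t ≤ K ∧ s'.Bdd B ∧ Q s'

theorem Ends.mono {B : ℕ} {c : Cmd} {s : State} {K K' : ℕ} {Q Q' : State → Prop}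
    (h : Ends B c s K Q) (hK : K ≤ K') (hQ : ∀ s', s'.Bdd B → Q s' → Q' s') :
    Ends B c s K' Q' := by
  obtain ⟨t, s', h1, h2, h3, h4⟩ := h
  exact ⟨t, s', h1, h2.trans hK, h3, hQ s' h3 h4⟩

/-- What the program does not write keeps its value. -/
theorem Ends.frame {B : ℕ} {c : Cmd} {s : State} {K : ℕ} {Q : State → Prop}
    (h : Ends B c s K Q) :
    Ends B c s K fun s' => Q s' ∧ (∀ x, ¬ c.SetsReg x → s'.reg x = s.reg x) ∧
      ∀ a, ¬ c.SetsArr a → s'.arr a = s.arr a := by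
  obtain ⟨t, s', h1, h2, h3, h4⟩ := h
  exact ⟨t, s', h1, h2, h3, h4, fun _ => h1.reg_eq, fun _ => h1.arr_eq⟩

theorem Ends.seq {B : ℕ} {p q : Cmd} {s : State} {K K' : ℕ} {R Q : State → Prop}
    (hp : Ends B p s K R) (hq : ∀ s', s'.Bdd B → R s' → Ends B q s' K' Q) :
    Ends B (.seq p q) s (K + K') Q := by
  obtain ⟨t, s', h1, h2, h3, h4⟩ := hp
  obtain ⟨t', s'', h1', h2', h3', h4'⟩ := hq s' h3 h4
  exact ⟨t + t', s'', .seq h1 h1', by omega, h3', h4'⟩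

/-! Loop-free programs. -/

/-- The final state of a loop-free program. -/
def Cmd.run : Cmd → State → State
  | .skip, s => s
  | .assign x e, s => s.setReg x (e.eval s)
  | .store a i e, s => s.setArr a (i.eval s) (e.eval s)
  | .seq p q, s => q.run (p.run s)
  | .ite e p q, s => if e.eval s = 0 then q.run s else p.run s
  | .while _ _, s => s

/-- The program is loop-free and its run from the state `s` respects the word bound. -/
def Cmd.Safe (B : ℕ) : Cmd → State → Prop
  | .skip, _ => True
  | .assign _ e, s => e.Mild B s
  | .store _ i e, s => i.Mild B s ∧ e.Mild B s
  | .seq p q, s => p.Safe B s ∧ q.Safe B (p.run s)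
  | .ite e p q, s => e.Mild B s ∧ (e.eval s ≠ 0 → p.Safe B s) ∧ (e.eval s = 0 → q.Safe B s)
  | .while _ _, _ => False

/-- A bound for the number of steps of a loop-free program. -/
def Cmd.maxCost : Cmd → ℕ
  | .skip => 1
  | .assign _ e => e.cost + 1
  | .store _ i e => i.cost + e.cost + 1
  | .seq p q => p.maxCost + q.maxCost
  | .ite e p q => e.cost + 1 + (p.maxCost + q.maxCost)
  | .while _ _ => 0

theorem Cmd.Safe.exists_runs {B : ℕ} {c : Cmd} {s : State} (h : c.Safe B s) (hs : s.Bdd B) :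
    ∃ t, Runs B c s t (c.run s) ∧ t ≤ c.maxCost := by
  induction c generalizing s with
  | skip => exact ⟨_, .skip s, le_rfl⟩
  | assign x e => exact ⟨_, .assign s x e (Expr.Mild.fits hs h), le_rfl⟩
  | store a i e =>
    exact ⟨_, .store s a i e (Expr.Mild.fits hs h.1) (Expr.Mild.fits hs h.2), le_rfl⟩
  | seq p q ihp ihq =>
    obtain ⟨t, h1, h2⟩ := ihp h.1 hs
    obtain ⟨t', h1', h2'⟩ := ihq h.2 (h1.bdd hs)
    exact ⟨_, .seq h1 h1', Nat.add_le_add h2 h2'⟩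
  | ite e p q ihp ihq =>
    by_cases he : e.eval s = 0
    · obtain ⟨t, h1, h2⟩ := ihq (h.2.2 he) hs
      refine ⟨e.cost + 1 + t, ?_, by simp only [Cmd.maxCost]; omega⟩
      rw [Cmd.run, if_pos he]
      exact .ite_false (h.1.fits hs) he h1
    · obtain ⟨t, h1, h2⟩ := ihp (h.2.1 he) hs
      refine ⟨e.cost + 1 + t, ?_, by simp only [Cmd.maxCost]; omega⟩
      rw [Cmd.run, if_neg he]
      exact .ite_true (h.1.fits hs) he h1
  | _ => exact h.elim

theorem Cmd.Safe.ends {B : ℕ} {c : Cmd} {s : State} (h : c.Safe B s) (hs : s.Bdd B)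
    {Q : State → Prop} (hQ : Q (c.run s)) : Ends B c s c.maxCost Q := by
  obtain ⟨t, h1, h2⟩ := h.exists_runs hs
  exact ⟨t, _, h1, h2, h1.bdd hs, hQ⟩

/-! Loops. -/

/-- The potential drops in each pass, so there are at most `μ s` passes. Each pays for the body and
one test, and there is one final test. -/
theorem Ends.while {B : ℕ} {e : Expr} {p : Cmd} {K : ℕ} (I : State → Prop) (μ : State → ℕ)
    (he : ∀ s, s.Bdd B → I s → e.Mild B s)
    (hp : ∀ s, s.Bdd B → I s → e.eval s ≠ 0 → Ends B p s K fun s' => I s' ∧ μ s' < μ s)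
    {s : State} (hs : s.Bdd B) (hI : I s) :
    Ends B (.while e p) s (μ s * (K + e.cost + 1) + (e.cost + 1))
      fun s' => I s' ∧ e.eval s' = 0 := by
  induction hμ : μ s using Nat.strong_induction_on generalizing s with
  | _ k ih =>
    by_cases h0 : e.eval s = 0
    · exact ⟨_, s, .while_false ((he s hs hI).fits hs) h0, by omega, hs, hI, h0⟩
    · obtain ⟨t, s', h1, h2, h3, h4, h5⟩ := hp s hs hI h0
      obtain ⟨t', s'', h1', h2', h3', h4'⟩ := ih _ (hμ ▸ h5) h3 h4 rfl
      refine ⟨_, s'', .while_true ((he s hs hI).fits hs) h0 h1 h1', ?_, h3', h4'⟩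
      have : (μ s' + 1) * (K + e.cost + 1) ≤ k * (K + e.cost + 1) :=
        Nat.mul_le_mul_right _ (by omega)
      rw [add_mul] at this
      omega

/-- `for x < r do p` with registers `x` and `r`. -/
def Cmd.for (x r : ℕ) (p : Cmd) : Cmd :=
  .seq (.assign x (.lit 0))
    (.while (.sub (.reg r) (.reg x)) (.seq p (.assign x (.add (.reg x) (.lit 1)))))

/-- Each pass adds 4 steps for the test and 4 for the increment; the constant 6 covers the initial
assignment (2) and the last test (4). The invariant must not depend on the counter register, since
the loop overwrites it. -/
theorem Ends.for {B : ℕ} {x r : ℕ} {p : Cmd} {K N : ℕ} (I : ℕ → State → Prop) (hxr : x ≠ r)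
    (hx : ¬ p.SetsReg x) (hr : ¬ p.SetsReg r) (hB : 1 ≤ B)
    (hI : ∀ k s v, I k s → I k (s.setReg x v)) {s : State} (hs : s.Bdd B) (hN : s.reg r = N)
    (h0 : I 0 s)
    (hp : ∀ k s, s.Bdd B → k < N → s.reg x = k → s.reg r = N → I k s → Ends B p s K (I (k + 1))) :
    Ends B (.for x r p) s (N * (K + 8) + 6) (I N) := by
  have h1 : Ends B (.assign x (.lit 0)) s 2 fun s' => s'.reg x = 0 ∧ s'.reg r = N ∧ I 0 s' := by
    refine (Cmd.Safe.ends (c := .assign x (.lit 0)) (Nat.zero_le B) hs ⟨?_, ?_, ?_⟩).mono le_rfl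
      fun _ _ h => h
    · simp [Cmd.run, State.setReg_reg, Expr.eval]
    · simp [Cmd.run, State.setReg_reg, hxr.symm, hN]
    · exact hI _ _ _ h0
  refine (h1.seq (K' := N * (K + 8) + 4) fun s1 hs1 h => ?_).mono (by omega) fun _ _ h => h
  have h2 := Ends.while (B := B) (e := .sub (.reg r) (.reg x))
    (p := .seq p (.assign x (.add (.reg x) (.lit 1)))) (K := K + 4)
    (fun s => s.reg r = N ∧ s.reg x ≤ N ∧ I (s.reg x) s) (fun s => N - s.reg x)
    (fun s _ _ => ⟨trivial, trivial⟩) ?_ hs1 ⟨h.2.1, by omega, by rw [h.1]; exact h.2.2⟩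
  · refine h2.mono ?_ ?_
    · simp only [Expr.cost, h.1, Nat.sub_zero]
      rw [show K + 4 + (1 + 1 + 1) + 1 = K + 8 by omega]
    · rintro s' - ⟨⟨h3, h4, h5⟩, h6⟩
      simp only [Expr.eval] at h6
      have : s'.reg x = N := by omega
      rwa [this] at h5
  · rintro s2 hs2 ⟨h3, h4, h5⟩ h6
    simp only [Expr.eval] at h6
    refine (((hp (s2.reg x) s2 hs2 (by omega) rfl h3 h5).frame).seq (K' := 4) ?_)
    rintro s3 hs3 ⟨h7, h8, -⟩
    have h9 := h8 x hx
    have h10 := h8 r hr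
    -- The incremented counter is at most the loop bound, which is itself the content of a register.
    have hb : s3.reg x + 1 ≤ B := by
      have := hs3.1 r
      omega
    refine (Cmd.Safe.ends (c := .assign x (.add (.reg x) (.lit 1))) ⟨trivial, hB, hb⟩ hs3
      ⟨⟨?_, ?_, ?_⟩, ?_⟩).mono le_rfl fun _ _ h => h
    all_goals simp only [Cmd.run, State.setReg_reg, Expr.eval, hxr.symm, if_true, if_false]
    · omega
    · omega
    · rw [h9]
      exact hI _ _ _ h7
    · omega

/-- Two nested loops whose body treats each pair of indices once; the invariant speaks about the
list of the pairs that have been treated. -/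
theorem Ends.for₂ {B : ℕ} {x r y r' : ℕ} {p : Cmd} {K N N' : ℕ} (I : List (ℕ × ℕ) → State → Prop)
    (hne : x ≠ r ∧ y ≠ r' ∧ y ≠ x ∧ y ≠ r ∧ x ≠ r')
    (hset : ¬ p.SetsReg x ∧ ¬ p.SetsReg r ∧ ¬ p.SetsReg y ∧ ¬ p.SetsReg r') (hB : 1 ≤ B)
    (hIx : ∀ l s v, I l s → I l (s.setReg x v)) (hIy : ∀ l s v, I l s → I l (s.setReg y v))
    {s : State} (hs : s.Bdd B) (hN : s.reg r = N) (hN' : s.reg r' = N') (h0 : I [] s)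
    (hp : ∀ l s, s.Bdd B → l.length < N * N' → s.reg x < N → s.reg y < N' → s.reg r = N →
      s.reg r' = N' → I l s → Ends B p s K (I ((s.reg x, s.reg y) :: l))) :
    Ends B (.for x r (.for y r' p)) s (N * (N' * (K + 8) + 14) + 6)
      fun s' => ∃ l : List (ℕ × ℕ), l.length = N * N' ∧ (∀ i j, (i, j) ∈ l ↔ i < N ∧ j < N') ∧
        I l s' := by
  obtain ⟨hxr, hyr', hyx, hyr, hxr'⟩ := hne
  obtain ⟨hpx, hpr, hpy, hpr'⟩ := hset
  -- The constant 14 combines the 6 steps of overhead of the inner loop with the 8 of each pass of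
  -- the outer one.
  refine (Ends.for (K := N' * (K + 8) + 6) (fun k s => s.reg r' = N' ∧ ∃ l : List (ℕ × ℕ),
    l.length = k * N' ∧ (∀ i j, (i, j) ∈ l ↔ i < k ∧ j < N') ∧ I l s) hxr ?_ ?_ hB ?_ hs hN ?_
    ?_).mono (by ring_nf; omega) fun _ _ h => h.2
  · simp [Cmd.for, Cmd.SetsReg, hyx.symm, hpx]
  · simp [Cmd.for, Cmd.SetsReg, hyr.symm, hpr]
  · rintro k s v ⟨h1, l, h2, h3, h4⟩
    refine ⟨?_, l, h2, h3, hIx _ _ _ h4⟩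
    rw [State.setReg_reg, if_neg hxr'.symm, h1]
  · exact ⟨hN', [], by simp, by simp, h0⟩
  · rintro k s1 hs1 hk hx hr ⟨hr', l, hl, hmem, hI⟩
    have hmain := Ends.for (K := K) (B := B) (x := y) (r := r') (p := p) (N := N')
      (fun k' s => (s.reg x = k ∧ s.reg r = N ∧ s.reg r' = N') ∧ ∃ l : List (ℕ × ℕ),
        l.length = k * N' + k' ∧
        (∀ i j, (i, j) ∈ l ↔ (i < k ∧ j < N') ∨ (i = k ∧ j < k')) ∧ I l s) hyr' hpy hpr' hB ?_ hs1
        hr' ?_ ?_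
    · refine hmain.mono le_rfl ?_
      rintro s' - ⟨⟨h1, h2, h3⟩, l', h4, h5, h6⟩
      refine ⟨h3, l', by rw [h4]; ring, fun i j => ?_, h6⟩
      rw [h5]
      omega
    · rintro k' s v ⟨⟨h1, h2, h3⟩, l, h4, h5, h6⟩
      refine ⟨⟨?_, ?_, ?_⟩, l, h4, h5, hIy _ _ _ h6⟩
      · rw [State.setReg_reg, if_neg hyx.symm, h1]
      · rw [State.setReg_reg, if_neg hyr.symm, h2]
      · rw [State.setReg_reg, if_neg hyr'.symm, h3]
    · exact ⟨⟨hx, hr, hr'⟩, l, by simpa using hl, fun i j => by simp [hmem], hI⟩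
    · rintro k' s2 hs2 hk' hy - ⟨⟨h1, h2, h3⟩, l', h4, h5, h6⟩
      have hlen : l'.length < N * N' := by
        have := Nat.mul_le_mul_right N' (Nat.succ_le_of_lt hk)
        rw [Nat.succ_mul] at this
        omega
      refine ((hp l' s2 hs2 hlen (by omega) (by omega) h2 h3 h6).frame).mono le_rfl ?_
      rintro s3 - ⟨h7, h8, -⟩
      refine ⟨⟨by rw [h8 x hpx, h1], by rw [h8 r hpr, h2], by rw [h8 r' hpr', h3]⟩,
        _, ?_, fun i j => ?_, h7⟩
      · simp only [List.length_cons]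
        omega
      · rw [List.mem_cons, h5, h1, hy, Prod.mk.injEq]
        omega

/-! ### Connected components by breadth-first search -/

/-- `j + 1` for the last `j < k` with `X j = x`, and `0` if there is none. -/
def lastIndex (X : ℕ → ℕ) (x : ℕ) : ℕ → ℕ
  | 0 => 0
  | k + 1 => if X k = x then k + 1 else lastIndex X x k

theorem lastIndex_le (X : ℕ → ℕ) (x k : ℕ) : lastIndex X x k ≤ k := by
  induction k with
  | zero => exact le_rfl
  | succ k ih => rw [lastIndex]; split_ifs <;> omega

theorem apply_lastIndex_sub_one {X : ℕ → ℕ} {x k : ℕ} (h : lastIndex X x k ≠ 0) :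
    X (lastIndex X x k - 1) = x := by
  induction k with
  | zero => exact absurd rfl h
  | succ k ih =>
    rw [lastIndex] at h ⊢
    split_ifs at h ⊢ with h1
    · exact h1
    · exact ih h

/-- With `0` as the null pointer, the list reached from position `e` consists of the arcs with that
tail and index below `e`. This lemma ensures that no arc is missed when the list is entered or
advanced. -/
theorem lt_lastIndex {X : ℕ → ℕ} {x j k : ℕ} (hj : j < k) (hx : X j = x) :
    j < lastIndex X x k := by
  induction k with
  | zero => omega
  | succ k ih =>
    rw [lastIndex]
    split_ifs with h1
    · exact hj
    · exact ih (by rcases Nat.lt_succ_iff_lt_or_eq.1 hj with h | rfl; exacts [h, absurd hx h1])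

/-- The graph with the arcs `(X j, Y j)` for `j < N`. -/
def ArcRel (N : ℕ) (X Y : ℕ → ℕ) (p q : ℕ) : Prop :=
  ∃ j < N, X j = p ∧ Y j = q

/-- The invariant of the search. `L` holds the labels (`0` for a node that has not been reached),
`Q` the queue, `p` the next arc whose tail may start a new component, `qh` and `qt` the head and
the tail of the queue, `x` the node that is being scanned, `e` the position in its list of arcs, and
`cur` the current label. -/
structure SearchInv (N : ℕ) (X Y L Q : ℕ → ℕ) (p qh qt e x cur : ℕ) : Prop where
  p_le : p ≤ N
  qh_le : qh ≤ qt
  e_le : e ≤ N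
  scan : e ≠ 0 → X (e - 1) = x ∧ (∃ i < qh, Q i = x) ∧ L x = cur
  label_iff : ∀ y, L y ≠ 0 ↔ ∃ i < qt, Q i = y
  inj : ∀ i < qt, ∀ j < qt, Q i = Q j → i = j
  source : ∀ y, L y ≠ 0 → ∃ j < N, X j = y
  sound : ∀ y, L y ≠ 0 → Relation.EqvGen (ArcRel N X Y) (L y - 1) y
  pending : ∀ i, qh ≤ i → i < qt → L (Q i) = cur
  closed : ∀ j < N, (∃ i < qh, Q i = X j) → ¬ (X j = x ∧ j < e) → L (Y j) = L (X j)
  started : ∀ j < p, L (X j) ≠ 0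
  qt_le : qt ≤ N

/-- The arcs that have not been scanned. -/
def openArcs (N : ℕ) (X Q : ℕ → ℕ) (qh e x : ℕ) : Finset ℕ :=
  open Classical in
  (Finset.range N).filter fun j => (∀ i < qh, Q i ≠ X j) ∨ (X j = x ∧ j < e)

/-- The potential of the search. -/
def searchMeasure (N : ℕ) (X Q : ℕ → ℕ) (p qh e x : ℕ) : ℕ :=
  (N - p) + (N - qh) + (openArcs N X Q qh e x).card

theorem mem_openArcs {N : ℕ} {X Q : ℕ → ℕ} {qh e x j : ℕ} :
    j ∈ openArcs N X Q qh e x ↔ j < N ∧ ((∀ i < qh, Q i ≠ X j) ∨ (X j = x ∧ j < e)) := by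
  simp [openArcs]

section Search

variable {N : ℕ} {X Y L Q : ℕ → ℕ} {p qh qt e x cur : ℕ}

/-- The queue has no repetitions and contains only tails of arcs. This bounds it by the number of
arcs, independently of how many codes of pairs exist. -/
theorem le_of_injOn (hinj : ∀ i < qt, ∀ j < qt, Q i = Q j → i = j)
    (hsrc : ∀ i < qt, ∃ j < N, X j = Q i) : qt ≤ N := by
  have h1 : ((Finset.range qt).image Q).card = qt := by
    rw [Finset.card_image_of_injOn, Finset.card_range]
    intro i hi j hj h
    exact hinj i (by simpa using hi) j (by simpa using hj) h
  have h2 : (Finset.range qt).image Q ⊆ (Finset.range N).image X := by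
    intro y hy
    obtain ⟨i, hi, rfl⟩ := Finset.mem_image.1 hy
    obtain ⟨j, hj, h⟩ := hsrc i (by simpa using hi)
    exact Finset.mem_image.2 ⟨j, by simpa using hj, h⟩
  calc qt = _ := h1.symm
    _ ≤ _ := Finset.card_le_card h2
    _ ≤ _ := Finset.card_image_le
    _ = N := Finset.card_range N

/-- The arcs leaving the dequeued node pass from one clause of `openArcs` to the other: its tail is
no longer undequeued, but the arc now lies on the current list. So the set of open arcs does not
grow, while `qh` increases. -/
theorem SearchInv.dequeue (h : SearchInv N X Y L Q p qh qt 0 x cur) (hq : qh < qt) :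
    SearchInv N X Y L Q p (qh + 1) qt (lastIndex X (Q qh) N) (Q qh) cur ∧
      searchMeasure N X Q p (qh + 1) (lastIndex X (Q qh) N) (Q qh) <
        searchMeasure N X Q p qh 0 x := by
  refine ⟨{ h with
    qh_le := hq
    e_le := lastIndex_le _ _ _
    scan := fun he => ⟨apply_lastIndex_sub_one he, ⟨qh, by omega, rfl⟩, h.pending qh le_rfl hq⟩
    pending := fun i hi => h.pending i (by omega)
    closed := ?_ }, ?_⟩
  · rintro j hj ⟨i, hi, hij⟩ hne
    refine h.closed j hj ⟨i, ?_, hij⟩ (by omega)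
    rcases Nat.lt_succ_iff_lt_or_eq.1 hi with h1 | rfl
    · exact h1
    · exact absurd ⟨hij.symm, lt_lastIndex hj hij.symm⟩ hne
  · have hsub : openArcs N X Q (qh + 1) (lastIndex X (Q qh) N) (Q qh) ⊆ openArcs N X Q qh 0 x := by
      intro j hj
      rw [mem_openArcs] at hj ⊢
      refine ⟨hj.1, Or.inl fun i hi hij => ?_⟩
      rcases hj.2 with h1 | h1
      · exact h1 i (by omega) hij
      · have := h.inj i (by omega) qh hq (hij.trans h1.1)
        omega
    have := Finset.card_le_card hsub
    have := h.qt_le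
    unfold searchMeasure
    omega

/-- The invariant is kept when an unlabelled node `y` receives the current label and is appended to
the queue. -/
theorem SearchInv.visit (h : SearchInv N X Y L Q p qh qt e x cur) {y : ℕ} (hy : L y = 0)
    (hcur : cur ≠ 0) (hsrc : ∃ j < N, X j = y)
    (hsound : Relation.EqvGen (ArcRel N X Y) (cur - 1) y) :
    SearchInv N X Y (Function.update L y cur) (Function.update Q qt y) p qh (qt + 1) e x cur := by
  have hQ : ∀ i < qt, Q i ≠ y := fun i hi hiy => (h.label_iff y).2 ⟨i, hi, hiy⟩ hy
  have hL : ∀ z, L z ≠ 0 → Function.update L y cur z = L z := fun z hz =>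
    Function.update_of_ne (by rintro rfl; exact hz hy) _ _
  have hQ' : ∀ i < qt, Function.update Q qt y i = Q i := fun i hi =>
    Function.update_of_ne (by omega) _ _
  have hinj : ∀ i < qt + 1, ∀ j < qt + 1,
      Function.update Q qt y i = Function.update Q qt y j → i = j := by
    intro i hi j hj hij
    rw [Function.update_apply, Function.update_apply] at hij
    split_ifs at hij with h1 h2 h2
    · omega
    · exact absurd hij.symm (hQ j (by omega))
    · exact absurd hij (hQ i (by omega))
    · exact h.inj i (by omega) j (by omega) hij
  have hsource : ∀ z, Function.update L y cur z ≠ 0 → ∃ j < N, X j = z := by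
    intro z hz
    rw [Function.update_apply] at hz
    split_ifs at hz with h1
    · exact h1 ▸ hsrc
    · exact h.source z hz
  have hiff : ∀ z, Function.update L y cur z ≠ 0 ↔
      ∃ i < qt + 1, Function.update Q qt y i = z := by
    intro z
    by_cases hz : z = y
    · subst hz
      simp only [Function.update_self]
      exact iff_of_true hcur ⟨qt, by omega, Function.update_self _ _ _⟩
    · rw [Function.update_of_ne hz, h.label_iff]
      constructor
      · rintro ⟨i, hi, hiz⟩
        exact ⟨i, by omega, by rw [hQ' i hi, hiz]⟩
      · rintro ⟨i, hi, hiz⟩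
        rw [Function.update_apply] at hiz
        split_ifs at hiz with h1
        · exact absurd hiz.symm hz
        · exact ⟨i, by omega, hiz⟩
  have hmem : ∀ z, (∃ i < qh, Function.update Q qt y i = z) ↔ ∃ i < qh, Q i = z := by
    intro z
    refine exists_congr fun i => and_congr_right fun hi => ?_
    rw [hQ' i (by have := h.qh_le; omega)]
  have hdeq : ∀ z, (∃ i < qh, Q i = z) → L z ≠ 0 := by
    rintro z ⟨i, hi, hiz⟩
    exact (h.label_iff z).2 ⟨i, by have := h.qh_le; omega, hiz⟩
  exact
    { p_le := h.p_le
      qh_le := by have := h.qh_le; omega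
      e_le := h.e_le
      scan := by
        intro he
        obtain ⟨h1, h2, h3⟩ := h.scan he
        exact ⟨h1, (hmem _).2 h2, by rw [hL _ (hdeq _ h2), h3]⟩
      label_iff := hiff
      inj := hinj
      source := hsource
      sound := by
        intro z hz
        rw [Function.update_apply] at hz ⊢
        split_ifs at hz ⊢ with h1
        · exact h1 ▸ hsound
        · exact h.sound z hz
      pending := by
        intro i hi hi'
        by_cases h1 : i = qt
        · subst h1
          rw [Function.update_self, Function.update_self]
        · have h2 := h.pending i hi (by omega)
          rw [hQ' i (by omega), hL _ ?_, h2]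
          rw [h2]
          exact hcur
      closed := by
        intro j hj hi hne
        rw [hmem] at hi
        have h1 := h.closed j hj hi hne
        have h2 := hdeq _ hi
        rw [hL _ h2, hL _ (h1 ▸ h2), h1]
      started := by
        intro j hj
        have := h.started j hj
        rwa [hL _ this]
      qt_le := by
        refine le_of_injOn hinj (X := X) fun i hi => hsource _ ?_
        exact (hiff _).2 ⟨i, hi, rfl⟩ }

/-- Appending writes to the queue only at `qt ≥ qh`, whereas the potential sees only the entries
before `qh`. -/
theorem searchMeasure_update (hq : qh ≤ qt) {y : ℕ} :
    searchMeasure N X (Function.update Q qt y) p qh e x = searchMeasure N X Q p qh e x := by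
  have : openArcs N X (Function.update Q qt y) qh e x = openArcs N X Q qh e x := by
    ext j
    rw [mem_openArcs, mem_openArcs]
    refine and_congr_right fun _ => or_congr_left (forall₂_congr fun i hi => ?_)
    rw [Function.update_of_ne (by omega)]
  rw [searchMeasure, searchMeasure, this]

/-- The scanned arc leaves the set of open arcs. For it to count as closed, its head must carry the
label of its tail; this is where the symmetry of the relation is needed. -/
theorem SearchInv.advance_arc (hsymm : ∀ j < N, ∃ i < N, X i = Y j ∧ Y i = X j)
    (h : SearchInv N X Y L Q p qh qt e x cur) (he : e ≠ 0) (hy : L (Y (e - 1)) ≠ 0) :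
    SearchInv N X Y L Q p qh qt (lastIndex X (X (e - 1)) (e - 1)) x cur ∧
      searchMeasure N X Q p qh (lastIndex X (X (e - 1)) (e - 1)) x <
        searchMeasure N X Q p qh e x := by
  obtain ⟨hx, hdeq, hcur⟩ := h.scan he
  have heN := h.e_le
  rw [hx]
  have hle := lastIndex_le X x (e - 1)
  -- A head that is still in the queue has the current label. One that was dequeued earlier, and is
  -- not `x` itself, has already had its arc back to `x` scanned, so the two labels agree.
  have hnew : L (Y (e - 1)) = L x := by
    obtain ⟨i, hi, hiy⟩ := (h.label_iff _).1 hy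
    by_cases hiq : qh ≤ i
    · rw [← hiy, h.pending i hiq hi, hcur]
    · obtain ⟨j, hj, hj1, hj2⟩ := hsymm (e - 1) (by omega)
      by_cases hyx : Y (e - 1) = x
      · rw [hyx]
      · have := h.closed j hj ⟨i, by omega, by rw [hiy, hj1]⟩ (by rw [hj1]; tauto)
        rw [hj1, hj2, hx] at this
        exact this.symm
  refine ⟨{ h with
    e_le := by omega
    scan := fun he' => ⟨apply_lastIndex_sub_one he', hdeq, hcur⟩
    closed := ?_ }, ?_⟩
  · intro j hj hi hne
    by_cases h1 : X j = x ∧ j < e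
    · obtain ⟨h1, h2⟩ := h1
      by_cases h3 : j = e - 1
      · rw [h3, hnew, hx]
      · exact absurd ⟨h1, lt_lastIndex (by omega) h1⟩ hne
    · exact h.closed j hj hi h1
  · have hlt : openArcs N X Q qh (lastIndex X x (e - 1)) x ⊂ openArcs N X Q qh e x := by
      rw [Finset.ssubset_iff_of_subset]
      · refine ⟨e - 1, mem_openArcs.2 ⟨by omega, Or.inr ⟨hx, by omega⟩⟩, fun h' => ?_⟩
        rcases (mem_openArcs.1 h').2 with h1 | h1
        · obtain ⟨i, hi, hi'⟩ := hdeq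
          exact h1 i hi (hi'.trans hx.symm)
        · omega
      · intro j hj
        rw [mem_openArcs] at hj ⊢
        exact ⟨hj.1, hj.2.imp_right fun h1 => ⟨h1.1, by omega⟩⟩
    have := Finset.card_lt_card hlt
    unfold searchMeasure
    omega

theorem SearchInv.advance_start (h : SearchInv N X Y L Q p qh qt e x cur) (hp : p < N)
    (hy : L (X p) ≠ 0) :
    SearchInv N X Y L Q (p + 1) qh qt e x cur ∧
      searchMeasure N X Q (p + 1) qh e x < searchMeasure N X Q p qh e x := by
  refine ⟨{ h with p_le := hp, started := fun j hj => ?_ }, ?_⟩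
  · rcases Nat.lt_succ_iff_lt_or_eq.1 hj with h1 | rfl
    exacts [h.started j h1, hy]
  · unfold searchMeasure
    omega

/-- With an empty queue and no list being scanned, no clause of the invariant depends on the current
label. -/
theorem SearchInv.set_cur (h : SearchInv N X Y L Q p qh qt 0 x cur) (hq : qt ≤ qh) {cur' : ℕ} :
    SearchInv N X Y L Q p qh qt 0 x cur' :=
  { h with
    scan := fun he => absurd rfl he
    pending := fun i hi hi' => by omega }

theorem searchInv_init : SearchInv N X Y (fun _ => 0) Q 0 0 0 0 x cur where
  p_le := Nat.zero_le _
  qh_le := le_rfl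
  e_le := Nat.zero_le _
  scan := fun h => absurd rfl h
  label_iff := fun y => by simp
  inj := fun i hi => by omega
  source := fun y hy => absurd rfl hy
  sound := fun y hy => absurd rfl hy
  pending := fun i _ hi => by omega
  closed := fun j _ ⟨i, hi, _⟩ => by omega
  started := fun j hj => by omega
  qt_le := Nat.zero_le _

theorem searchMeasure_le : searchMeasure N X Q p qh e x ≤ 3 * N := by
  have : (openArcs N X Q qh e x).card ≤ N := by
    unfold openArcs
    exact (Finset.card_filter_le _ _).trans (by simp)
  unfold searchMeasure
  omega

/-- The labelling `L` describes the components: it is constant on arcs, nonzero on their ends, and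
only nodes of the same component have the same nonzero label. -/
structure IsComponentLabelling (N : ℕ) (X Y L : ℕ → ℕ) : Prop where
  ne_zero : ∀ j < N, L (X j) ≠ 0
  eq : ∀ j < N, L (Y j) = L (X j)
  sound : ∀ p q, L p ≠ 0 → L p = L q → Relation.EqvGen (ArcRel N X Y) p q

/-- At the end every tail is labelled, every labelled node is dequeued and no list is open, so every
arc is closed. Nodes with equal labels are joined through their common root, whose code is the label
minus one. -/
theorem SearchInv.isComponentLabelling (h : SearchInv N X Y L Q N qh qt 0 x cur) (hq : qt ≤ qh) :
    IsComponentLabelling N X Y L where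
  ne_zero := h.started
  eq := fun j hj => by
    obtain ⟨i, hi, hi'⟩ := (h.label_iff _).1 (h.started j hj)
    exact h.closed j hj ⟨i, by omega, hi'⟩ (by omega)
  sound := fun p q hp hpq =>
    .trans _ _ _ (.symm _ _ (h.sound p hp)) (hpq ▸ h.sound q (hpq ▸ hp))

end Search

/-! The program. Arrays `b` and `b + 1` hold the tails and heads of the arcs, register `c` their
number. Array `b + 3` points to the lists of arcs with a common tail, which are linked by array
`b + 4`; array `b + 5` receives the labels, and array `b + 6` is the queue. -/

/-- Link the arcs with a common tail. -/
def linkBody (b : ℕ) : Cmd :=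
  .seq (.store (b + 4) (.reg 3) (.arr (b + 3) (.arr b (.reg 3))))
    (.store (b + 3) (.arr b (.reg 3)) (.add (.reg 3) (.lit 1)))

/-- Label the node in register `19` and append it to the queue, unless it has a label. -/
def visit (b : ℕ) : Cmd :=
  .ite (.arr (b + 5) (.reg 19)) .skip
    (.seq (.store (b + 5) (.reg 19) (.reg 18))
      (.seq (.store (b + 6) (.reg 15) (.reg 19)) (.assign 15 (.add (.reg 15) (.lit 1)))))

/-- One step of the search: scan an arc, or dequeue a node, or start a component. -/
def searchBody (b : ℕ) : Cmd :=
  .ite (.reg 16)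
    (.seq (.assign 19 (.arr (b + 1) (.sub (.reg 16) (.lit 1))))
      (.seq (visit b) (.assign 16 (.arr (b + 4) (.sub (.reg 16) (.lit 1))))))
    (.ite (.sub (.reg 15) (.reg 14))
      (.seq (.assign 17 (.arr (b + 6) (.reg 14)))
        (.seq (.assign 14 (.add (.reg 14) (.lit 1))) (.assign 16 (.arr (b + 3) (.reg 17)))))
      (.seq (.assign 19 (.arr b (.reg 13)))
        (.seq (.assign 18 (.add (.reg 19) (.lit 1)))
          (.seq (visit b) (.assign 13 (.add (.reg 13) (.lit 1)))))))

/-- The sum vanishes exactly if no arc of the current list, no queued node and no candidate for a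
new component is left. One loop thus does the work of three nested ones, and one potential bounds
its length. -/
def searchTest (c : ℕ) : Expr :=
  .add (.reg 16) (.add (.sub (.reg 15) (.reg 14)) (.sub (.reg c) (.reg 13)))

def searchInit : Cmd :=
  .seq (.assign 13 (.lit 0)) (.seq (.assign 14 (.lit 0)) (.seq (.assign 15 (.lit 0))
    (.assign 16 (.lit 0))))

/-- Compute the components of the graph. -/
def components (b c : ℕ) : Cmd :=
  .seq (.for 3 c (linkBody b)) (.seq searchInit (.while (searchTest c) (searchBody b)))

/-! ### The search in memory -/

theorem ends_link {B b c N : ℕ} {X : ℕ → ℕ} (hc : c ≠ 3) {s : State} (hs : s.Bdd B)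
    (hN : s.reg c = N) (hB : N + 1 ≤ B) (hX : s.arr b = X) (h3 : s.arr (b + 3) = fun _ => 0) :
    Ends B (.for 3 c (linkBody b)) s (N * ((linkBody b).maxCost + 8) + 6) fun s' =>
      s'.arr (b + 3) = (fun x => lastIndex X x N) ∧
      ∀ j < N, s'.arr (b + 4) j = lastIndex X (X j) j := by
  refine (Ends.for (fun k s => s.arr b = X ∧ s.arr (b + 3) = (fun x => lastIndex X x k) ∧
    ∀ j < k, s.arr (b + 4) j = lastIndex X (X j) j) hc.symm ?_ ?_ (by omega) ?_ hs hN ?_ ?_).mono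
    le_rfl fun _ _ h => h.2
  · simp [linkBody, Cmd.SetsReg]
  · simp [linkBody, Cmd.SetsReg]
  · exact fun k s v h => h
  · exact ⟨hX, by rw [h3]; rfl, by simp⟩
  · rintro k s hs hk hx - ⟨h1, h2, h4⟩
    refine Cmd.Safe.ends ?_ hs ?_
    · simp only [linkBody, Cmd.Safe, Expr.Mild, Expr.eval, Cmd.run, State.setArr_reg, hx]
      refine ⟨⟨trivial, trivial⟩, trivial, trivial, ?_, ?_⟩ <;> omega
    · simp only [linkBody, Cmd.run, Expr.eval, State.setArr_reg, State.setArr_arr, hx, h1, h2]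
      refine ⟨?_, ?_, ?_⟩
      · simp
      · funext x
        by_cases h : x = X k
        · subst h
          simp [lastIndex]
        · simp [lastIndex, h, Ne.symm h]
      · intro j hj
        by_cases h : j = k
        · subst h
          simp
        · simp [h, h4 j (by omega)]

theorem visit_run {b : ℕ} (s : State) :
    (visit b).run s = if s.arr (b + 5) (s.reg 19) = 0 then
      ((s.setArr (b + 5) (s.reg 19) (s.reg 18)).setArr (b + 6) (s.reg 15) (s.reg 19)).setReg 15
        (s.reg 15 + 1) else s := rfl

/-- The search invariant for the contents of the memory. -/
def MemInv (b c N : ℕ) (X Y : ℕ → ℕ) (s : State) : Prop :=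
  SearchInv N X Y (s.arr (b + 5)) (s.arr (b + 6)) (s.reg 13) (s.reg 14) (s.reg 15) (s.reg 16)
      (s.reg 17) (s.reg 18) ∧
    s.arr b = X ∧ s.arr (b + 1) = Y ∧ s.arr (b + 3) = (fun x => lastIndex X x N) ∧
    (∀ j < N, s.arr (b + 4) j = lastIndex X (X j) j) ∧ s.reg c = N

def memMeasure (b N : ℕ) (X : ℕ → ℕ) (s : State) : ℕ :=
  searchMeasure N X (s.arr (b + 6)) (s.reg 13) (s.reg 14) (s.reg 16) (s.reg 17)

theorem visit_safe {B b N : ℕ} {s : State} (hN : N + 1 ≤ B) (hq : s.reg 15 ≤ N) :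
    (visit b).Safe B s := by
  simp only [visit, Cmd.Safe, Expr.Mild, Expr.eval, Cmd.run, State.setArr_reg, true_and, and_true,
    implies_true]
  intro _
  omega

theorem visit_spec {b c N : ℕ} {X Y : ℕ → ℕ} (hc : c ≠ 15) {s : State} (h : MemInv b c N X Y s)
    (hcur : s.reg 18 ≠ 0) (hsrc : ∃ j < N, X j = s.reg 19)
    (hsound : Relation.EqvGen (ArcRel N X Y) (s.reg 18 - 1) (s.reg 19)) :
    MemInv b c N X Y ((visit b).run s) ∧
      memMeasure b N X ((visit b).run s) = memMeasure b N X s ∧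
      ((visit b).run s).arr (b + 5) (s.reg 19) ≠ 0 ∧
      ∀ x, x ≠ 15 → ((visit b).run s).reg x = s.reg x := by
  rw [visit_run]
  split_ifs with h0
  · obtain ⟨h1, h2⟩ := h
    refine ⟨⟨?_, ?_⟩, ?_, ?_, ?_⟩
    · have := h1.visit h0 hcur hsrc hsound
      simpa [State.setReg_reg, State.setArr_reg, State.setReg_arr, State.setArr_arr] using this
    · simpa [State.setReg_reg, State.setArr_reg, State.setReg_arr, State.setArr_arr, hc] using h2
    · have := searchMeasure_update (N := N) (X := X) (Q := s.arr (b + 6)) (p := s.reg 13)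
        (e := s.reg 16) (x := s.reg 17) (y := s.reg 19) h1.qh_le
      simpa [memMeasure, State.setReg_reg, State.setArr_reg, State.setReg_arr,
        State.setArr_arr] using this
    · simpa [State.setReg_arr, State.setArr_arr] using hcur
    · intro x hx
      simp [State.setReg_reg, State.setArr_reg, hx]
  · exact ⟨h, rfl, h0, fun _ _ => rfl⟩

theorem ends_searchBody {B b c N : ℕ} {X Y : ℕ → ℕ} (hc : c < 13 ∧ c ≠ 3) (hB : 3 * N + 3 ≤ B)
    (hXB : ∀ j < N, X j + 1 ≤ B) (hsymm : ∀ j < N, ∃ i < N, X i = Y j ∧ Y i = X j) {s : State}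
    (hs : s.Bdd B) (h : MemInv b c N X Y s) (ht : (searchTest c).eval s ≠ 0) :
    Ends B (searchBody b) s (searchBody b).maxCost fun s' =>
      MemInv b c N X Y s' ∧ memMeasure b N X s' < memMeasure b N X s := by
  have hq := h.1.qt_le
  have hqh := h.1.qh_le
  have heN := h.1.e_le
  have hpN := h.1.p_le
  by_cases he : s.reg 16 = 0
  · by_cases hqq : s.reg 15 - s.reg 14 = 0
    · -- a new component
      have hp : s.reg 13 < N := by
        simp only [searchTest, Expr.eval, h.2.2.2.2.2] at ht
        omega
      have hX : s.arr b = X := h.2.1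
      set s1 : State := (s.setReg 19 (X (s.reg 13))).setReg 18 (X (s.reg 13) + 1) with hs1
      have h1 : MemInv b c N X Y s1 := by
        have hI := h.1
        rw [he] at hI
        have := hI.set_cur (by omega) (cur' := X (s.reg 13) + 1)
        refine ⟨?_, h.2.1, h.2.2.1, h.2.2.2.1, h.2.2.2.2.1, ?_⟩
        · simpa [hs1, State.setReg_reg, State.setReg_arr, he] using this
        · have := h.2.2.2.2.2
          simpa [hs1, State.setReg_reg, show c ≠ 18 by omega, show c ≠ 19 by omega] using this
      have hreg : ∀ x, x < 18 → s1.reg x = s.reg x := by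
        intro x hx
        simp [hs1, State.setReg_reg, show x ≠ 18 by omega, show x ≠ 19 by omega]
      have h19 : s1.reg 19 = X (s.reg 13) := by simp [hs1, State.setReg_reg]
      have h18 : s1.reg 18 = X (s.reg 13) + 1 := by simp [hs1, State.setReg_reg]
      obtain ⟨h2, h3, h4, h5⟩ := visit_spec (b := b) (by omega) h1 (by omega)
        ⟨_, hp, h19.symm⟩ (by rw [h18, h19]; exact .refl _)
      have h13 : ((visit b).run s1).reg 13 = s.reg 13 := by rw [h5 13 (by omega), hreg 13 (by omega)]
      obtain ⟨h6, h7⟩ := h2.1.advance_start (by omega) (by rw [h13, ← h19]; exact h4)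
      have hrun : (searchBody b).run s =
          ((visit b).run s1).setReg 13 (((visit b).run s1).reg 13 + 1) := by
        simp [searchBody, Cmd.run, Expr.eval, he, hqq, hs1, hX, State.setReg_reg]
      have hm : memMeasure b N X s1 = memMeasure b N X s := by
        simp [memMeasure, hs1, State.setReg_arr, State.setReg_reg]
      refine Cmd.Safe.ends ?_ hs ?_
      · have hv := visit_safe (b := b) (s := s1) (N := N) (B := B) (by omega)
          (by rw [hreg 15 (by omega)]; exact hq)
        have := hXB _ hp
        simp only [searchBody, Cmd.Safe, Expr.Mild, Expr.eval, he, hqq, Cmd.run, hX]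
        simp only [State.setReg_reg]
        simp only [↓reduceIte, true_and, and_true, ne_eq, not_true_eq_false, IsEmpty.forall_iff,
          forall_true_left, ← hs1, hv, h13]
        omega
      · rw [hrun]
        refine ⟨⟨?_, h2.2.1, h2.2.2.1, h2.2.2.2.1, h2.2.2.2.2.1, ?_⟩, ?_⟩
        · simpa [State.setReg_reg, State.setReg_arr] using h6
        · have := h2.2.2.2.2.2
          simpa [State.setReg_reg, show c ≠ 13 by omega] using this
        · rw [← hm, ← h3]
          simpa [memMeasure, State.setReg_reg, State.setReg_arr] using h7
    · -- dequeue
      have hI := h.1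
      rw [he] at hI
      obtain ⟨h6, h7⟩ := hI.dequeue (by omega)
      have h3 := h.2.2.2.1
      refine Cmd.Safe.ends ?_ hs ?_
      · simp only [searchBody, Cmd.Safe, Expr.Mild, Expr.eval, he, hqq, Cmd.run]
        simp only [State.setReg_reg]
        simp
        omega
      · simp only [searchBody, Cmd.run, Expr.eval, he, hqq, if_true, if_false]
        refine ⟨⟨?_, h.2.1, h.2.2.1, h.2.2.2.1, h.2.2.2.2.1, ?_⟩, ?_⟩
        · simpa [State.setReg_reg, State.setReg_arr, h3] using h6
        · have := h.2.2.2.2.2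
          simpa [State.setReg_reg, show c ≠ 14 by omega, show c ≠ 16 by omega,
            show c ≠ 17 by omega] using this
        · simpa [memMeasure, State.setReg_reg, State.setReg_arr, h3, he] using h7
  · -- scan an arc
    have hY : s.arr (b + 1) = Y := h.2.2.1
    obtain ⟨hx, ⟨i, hi, hix⟩, hcur⟩ := h.1.scan he
    have hLx : s.arr (b + 5) (s.reg 17) ≠ 0 := (h.1.label_iff _).2 ⟨i, by omega, hix⟩
    set s1 : State := s.setReg 19 (Y (s.reg 16 - 1)) with hs1
    have h1 : MemInv b c N X Y s1 := by
      refine ⟨?_, h.2.1, h.2.2.1, h.2.2.2.1, h.2.2.2.2.1, ?_⟩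
      · simpa [hs1, State.setReg_reg, State.setReg_arr] using h.1
      · have := h.2.2.2.2.2
        simpa [hs1, State.setReg_reg, show c ≠ 19 by omega] using this
    have hreg : ∀ x, x < 19 → s1.reg x = s.reg x := by
      intro x hx
      simp [hs1, State.setReg_reg, show x ≠ 19 by omega]
    have h19 : s1.reg 19 = Y (s.reg 16 - 1) := by simp [hs1, State.setReg_reg]
    have h18 : s1.reg 18 = s.reg 18 := hreg 18 (by omega)
    obtain ⟨h2, h3, h4, h5⟩ := visit_spec (b := b) (by omega) h1 (by rw [h18, ← hcur]; exact hLx)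
      (by
        obtain ⟨j, hj, hj1, -⟩ := hsymm (s.reg 16 - 1) (by omega)
        exact ⟨j, hj, hj1.trans h19.symm⟩)
      (by
        have := h.1.sound _ hLx
        rw [h18, h19, ← hcur]
        exact .trans _ _ _ this (.rel _ _ ⟨s.reg 16 - 1, by omega, hx, rfl⟩))
    have h16 : ((visit b).run s1).reg 16 = s.reg 16 := by rw [h5 16 (by omega), hreg 16 (by omega)]
    have h17 : ((visit b).run s1).reg 17 = s.reg 17 := by rw [h5 17 (by omega), hreg 17 (by omega)]
    have hnext : ((visit b).run s1).arr (b + 4) (s.reg 16 - 1) =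
        lastIndex X (X (s.reg 16 - 1)) (s.reg 16 - 1) := h2.2.2.2.2.1 _ (by omega)
    obtain ⟨h6, h7⟩ := h2.1.advance_arc hsymm (by omega) (by rw [h16, ← h19]; exact h4)
    have hrun : (searchBody b).run s =
        ((visit b).run s1).setReg 16 (((visit b).run s1).arr (b + 4) (s.reg 16 - 1)) := by
      simp only [searchBody, Cmd.run, Expr.eval, he, if_false, hY, ← hs1, h16]
    have hm : memMeasure b N X s1 = memMeasure b N X s := by
      simp [memMeasure, hs1, State.setReg_arr, State.setReg_reg]
    refine Cmd.Safe.ends ?_ hs ?_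
    · have hv := visit_safe (b := b) (s := s1) (N := N) (B := B) (by omega)
        (by rw [hreg 15 (by omega)]; exact hq)
      simp only [searchBody, Cmd.Safe, Expr.Mild, Expr.eval, he, Cmd.run, hY, ← hs1, hv]
      simp
      omega
    · rw [hrun, hnext]
      rw [h16] at h6 h7
      refine ⟨⟨?_, h2.2.1, h2.2.2.1, h2.2.2.2.1, h2.2.2.2.2.1, ?_⟩, ?_⟩
      · simpa [State.setReg_reg, State.setReg_arr] using h6
      · have := h2.2.2.2.2.2
        simpa [State.setReg_reg, show c ≠ 16 by omega] using this
      · rw [← hm, ← h3]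
        simpa [memMeasure, State.setReg_reg, State.setReg_arr, h16] using h7

/-- A bound for the number of steps of `components` per arc. -/
def componentsCost (b c : ℕ) : ℕ :=
  (linkBody b).maxCost + 8 + 6 + searchInit.maxCost +
    3 * ((searchBody b).maxCost + (searchTest c).cost + 1) + ((searchTest c).cost + 1)

/-- The cost is linear in the number of arcs alone: the arrays of list heads and labels are indexed
by codes but need no initialization, being zero beforehand. The potential is at most `3 * N`, and so
is the value of the loop test, whence the word bound. -/
theorem ends_components {B b c N : ℕ} {X Y : ℕ → ℕ} (hc : c < 13 ∧ c ≠ 3) (hB : 3 * N + 3 ≤ B)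
    (hXB : ∀ j < N, X j + 1 ≤ B) (hsymm : ∀ j < N, ∃ i < N, X i = Y j ∧ Y i = X j) {s : State}
    (hs : s.Bdd B) (hN : s.reg c = N) (hX : s.arr b = X) (hY : s.arr (b + 1) = Y)
    (h3 : s.arr (b + 3) = fun _ => 0) (h5 : s.arr (b + 5) = fun _ => 0) :
    Ends B (components b c) s (componentsCost b c * (N + 1)) fun s' =>
      IsComponentLabelling N X Y (s'.arr (b + 5)) := by
  have hlink := (ends_link (b := b) (by omega) hs hN (by omega) hX h3).frame
  refine Ends.mono (hlink.seq (K' := searchInit.maxCost +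
    (3 * N * ((searchBody b).maxCost + (searchTest c).cost + 1) + ((searchTest c).cost + 1)))
    ?_) ?_ fun _ _ h => h
  · rintro s1 hs1 ⟨⟨h6, h7⟩, h8, h9⟩
    have hN1 : s1.reg c = N := by
      rw [h8 c, hN]
      simp [Cmd.for, linkBody, Cmd.SetsReg]
      omega
    have harr : ∀ a, a ≠ b + 3 → a ≠ b + 4 → s1.arr a = s.arr a := by
      intro a h1 h2
      refine h9 a ?_
      simp [Cmd.for, linkBody, Cmd.SetsArr, h1, h2]
    refine Ends.seq (R := fun s' => MemInv b c N X Y s') (Cmd.Safe.ends ?_ hs1 ?_) ?_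
    · simp [searchInit, Cmd.Safe, Expr.Mild]
    · refine ⟨?_, ?_, ?_, h6, h7, ?_⟩
      · have : s1.arr (b + 5) = fun _ => 0 := by rw [harr _ (by omega) (by omega), h5]
        simpa [searchInit, Cmd.run, Expr.eval, State.setReg_reg, State.setReg_arr, this] using
          searchInv_init
      · exact (harr b (by omega) (by omega)).trans hX
      · exact (harr (b + 1) (by omega) (by omega)).trans hY
      · simpa [searchInit, Cmd.run, Expr.eval, State.setReg_reg, show c ≠ 13 by omega,
          show c ≠ 14 by omega, show c ≠ 15 by omega, show c ≠ 16 by omega] using hN1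
    · intro s2 hs2 hI
      refine (Ends.while (K := (searchBody b).maxCost) (MemInv b c N X Y) (memMeasure b N X) ?_ ?_
        hs2 hI).mono ?_ ?_
      · intro s hs h
        have h1 := h.1.qt_le
        have h2 := h.1.e_le
        have h3 := h.2.2.2.2.2
        simp only [searchTest, Expr.Mild, Expr.eval, true_and]
        omega
      · exact fun s hs h ht => ends_searchBody hc hB hXB hsymm hs h ht
      · exact Nat.add_le_add_right (Nat.mul_le_mul_right _ searchMeasure_le) _
      · rintro s' - ⟨h, ht⟩
        have h3 := h.2.2.2.2.2
        have h4 := h.1.p_le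
        simp only [searchTest, Expr.eval] at ht
        have hI := h.1
        rw [show s'.reg 16 = 0 by omega, show s'.reg 13 = N by omega] at hI
        exact hI.isComponentLabelling (by omega)
  · unfold componentsCost
    ring_nf
    nlinarith [Nat.zero_le (N * searchInit.maxCost), Nat.zero_le (N * (searchTest c).cost)]

/-! ### Building blocks of the recognition program

Register `0` holds the number of vertices, register `1` the number of edges, and register `2` twice
that number. The pair `(x, y)` of vertices is coded by `x * n + y`. Array `4` is the adjacency
matrix, with ones on the diagonal for the vertices that are not isolated, and arrays `5` and `6` list
the darts. Arrays `7` and `8` are indexed by the codes of the darts `(v, w)` and tell whether there is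
a neighbour of `w` below, respectively above, `v` in the orientation of the complement.

The forcing relations between pairs are stored as lists of arcs, in arrays `b` (tails), `b + 1`
(heads), and `b + 2` (the reverses of the tails), with `b = 10` for the nonadjacent and `b = 20` for
the adjacent pairs. -/

/-- The code of a pair of vertices held by two registers. -/
def code (x y : ℕ) : Expr :=
  .add (.mul (.reg x) (.reg 0)) (.reg y)

theorem code_eval (s : State) (x y : ℕ) : (code x y).eval s = s.reg x * s.reg 0 + s.reg y := rfl

theorem pair_code_inj {n x y x' y' : ℕ} (hy : y < n) (hy' : y' < n) :
    x * n + y = x' * n + y' ↔ x = x' ∧ y = y' := by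
  constructor
  · intro h
    have h1 := congrArg (· / n) h
    have h2 := congrArg (· % n) h
    have hn : 0 < n := by omega
    simp only [mul_comm _ n, Nat.mul_add_div hn, Nat.mul_add_mod, Nat.div_eq_of_lt hy,
      Nat.div_eq_of_lt hy', Nat.mod_eq_of_lt hy, Nat.mod_eq_of_lt hy', Nat.add_zero] at h1 h2
    exact ⟨h1, h2⟩
  · rintro ⟨rfl, rfl⟩
    rfl

theorem pair_code_lt {n x y : ℕ} (hx : x < n) (hy : y < n) : x * n + y < n * n := by
  calc x * n + y < x * n + n := by omega
    _ = (x + 1) * n := by ring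
    _ ≤ n * n := Nat.mul_le_mul_right _ hx

theorem code_mild {B n : ℕ} {s : State} {x y : ℕ} (hB : n * n ≤ B) (h0 : s.reg 0 = n)
    (hx : s.reg x < n) (hy : s.reg y < n) : (code x y).Mild B s := by
  have := pair_code_lt hx hy
  simp only [code, Expr.Mild, Expr.eval, true_and, h0]
  omega

/-- Append the arc whose tail, head and reversed tail are in registers `p`, `q`, `r`. -/
def push (b c p q r : ℕ) : Cmd :=
  .seq (.store b (.reg c) (.reg p)) (.seq (.store (b + 1) (.reg c) (.reg q))
    (.seq (.store (b + 2) (.reg c) (.reg r)) (.assign c (.add (.reg c) (.lit 1)))))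

/-- The list of arcs contains the given arc. -/
def HasArc (b c : ℕ) (s : State) (P Q R : ℕ) : Prop :=
  ∃ j < s.reg c, s.arr b j = P ∧ s.arr (b + 1) j = Q ∧ s.arr (b + 2) j = R

theorem push_run (b c p q r : ℕ) (s : State) : (push b c p q r).run s =
    (((s.setArr b (s.reg c) (s.reg p)).setArr (b + 1) (s.reg c) (s.reg q)).setArr (b + 2) (s.reg c)
      (s.reg r)).setReg c (s.reg c + 1) := rfl

theorem push_reg (b c p q r : ℕ) (s : State) (x : ℕ) :
    ((push b c p q r).run s).reg x = if x = c then s.reg c + 1 else s.reg x := by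
  rw [push_run, State.setReg_reg]
  rfl

theorem push_safe {B b c p q r : ℕ} {s : State} (h : s.reg c + 1 ≤ B) :
    (push b c p q r).Safe B s := by
  simp only [push, Cmd.Safe, Expr.Mild, Expr.eval, Cmd.run, State.setArr_reg, true_and]
  omega

theorem hasArc_push {b c p q r : ℕ} {s : State} {P Q R : ℕ} :
    HasArc b c ((push b c p q r).run s) P Q R ↔
      HasArc b c s P Q R ∨ (P = s.reg p ∧ Q = s.reg q ∧ R = s.reg r) := by
  simp only [HasArc, push_reg, if_true, Nat.exists_lt_succ_right]
  refine or_congr (exists_congr fun j => and_congr_right fun hj => ?_) ?_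
  · simp [push_run, State.setReg_arr, State.setArr_arr, hj.ne]
  · simp [push_run, State.setReg_arr, State.setArr_arr, eq_comm]

theorem hasArc_setReg {b c x v : ℕ} (hx : c ≠ x) {s : State} {P Q R : ℕ} :
    HasArc b c (s.setReg x v) P Q R ↔ HasArc b c s P Q R := by
  simp [HasArc, State.setReg_reg, State.setReg_arr, hx]

/-- Record that the pair `(x, y)` forces `(x', y')` and `(y, x)` forces `(y', x')`. -/
def force (b c x y x' y' : ℕ) : Cmd :=
  .seq (.assign 7 (code x y)) (.seq (.assign 8 (code x' y')) (.seq (.assign 9 (code y x))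
    -- Registers `7` and `9` hold the codes of the pair and of its reverse, so exchanging them
    -- yields the arc between the reversed pairs. The reverse of each tail is stored because the
    -- machine has no division with which to decode a code.
    (.seq (push b c 7 8 9) (.seq (.assign 8 (code y' x')) (push b c 9 8 7)))))

/-- The arcs that are added by `force`. -/
def IsForcedArc (n x y x' y' P Q R : ℕ) : Prop :=
  (P = x * n + y ∧ Q = x' * n + y' ∧ R = y * n + x) ∨
    (P = y * n + x ∧ Q = y' * n + x' ∧ R = x * n + y)

theorem force_spec {B n b c x y x' y' : ℕ} {s : State} (hc : 9 < c)
    (hreg : (0 < x ∧ x < 7) ∧ (0 < y ∧ y < 7) ∧ (0 < x' ∧ x' < 7) ∧ (0 < y' ∧ y' < 7))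
    (hB : n * n ≤ B) (h0 : s.reg 0 = n)
    (hx : s.reg x < n) (hy : s.reg y < n) (hx' : s.reg x' < n) (hy' : s.reg y' < n)
    (hcB : s.reg c + 2 ≤ B) :
    (force b c x y x' y').Safe B s ∧
      ((force b c x y x' y').run s).reg c = s.reg c + 2 ∧
      ∀ P Q R, HasArc b c ((force b c x y x' y').run s) P Q R ↔ HasArc b c s P Q R ∨
        IsForcedArc n (s.reg x) (s.reg y) (s.reg x') (s.reg y') P Q R := by
  have hc' : ∀ z, z ≤ 9 → c ≠ z := fun z hz => by omega
  have hc'' : ∀ z, z ≤ 9 → z ≠ c := fun z hz => by omega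
  have hr : ∀ z, z < 7 → z ≠ 7 ∧ z ≠ 8 ∧ z ≠ 9 := fun z hz => by omega
  obtain ⟨⟨hx0, hx7⟩, ⟨hy0, hy7⟩, ⟨hx0', hx7'⟩, ⟨hy0', hy7'⟩⟩ := hreg
  have e1 := hr x hx7
  have e2 := hr y hy7
  have e3 := hr x' hx7'
  have e4 := hr y' hy7'
  refine ⟨?_, ?_, ?_⟩
  · simp only [force, Cmd.Safe]
    refine ⟨code_mild hB h0 hx hy, code_mild (n := n) hB ?_ ?_ ?_, code_mild (n := n) hB ?_ ?_ ?_,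
      push_safe ?_, code_mild (n := n) hB ?_ ?_ ?_, push_safe ?_⟩
    all_goals simp [Cmd.run, State.setReg_reg, push_reg, *]
    all_goals try split_ifs
    all_goals omega
  · simp [force, Cmd.run, State.setReg_reg, push_reg, hc']
  · intro P Q R
    simp only [force, Cmd.run, hasArc_push, hasArc_setReg (hc' 7 (by omega)),
      hasArc_setReg (hc' 8 (by omega)), hasArc_setReg (hc' 9 (by omega)), State.setReg_reg,
      push_reg, code_eval, IsForcedArc, or_assoc]
    have e0 : (0 : ℕ) ≠ c := hc'' 0 (by omega)
    have e7 : (7 : ℕ) ≠ c := hc'' 7 (by omega)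
    have e9 : (9 : ℕ) ≠ c := hc'' 9 (by omega)
    have ex : x ≠ c := hc'' x (by omega)
    have ey : y ≠ c := hc'' y (by omega)
    have ex' : x' ≠ c := hc'' x' (by omega)
    have ey' : y' ≠ c := hc'' y' (by omega)
    simp [e1, e2, e3, e4, e0, e7, e9, ex', ey', h0]

/-- The orientation of pairs that is given by a labelling of their codes. -/
def LabelLT (L : ℕ → ℕ) (n x y : ℕ) : Prop :=
  L (x * n + y) < L (y * n + x) ∨ (L (x * n + y) = L (y * n + x) ∧ x < y)

/-- Set register `20` according to the orientation of a pair by the labels in array `a`. -/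
def orient (a x y : ℕ) : Cmd :=
  .ite (.sub (.arr a (code y x)) (.arr a (code x y))) (.assign 20 (.lit 1))
    (.ite (.sub (.arr a (code x y)) (.arr a (code y x))) (.assign 20 (.lit 0))
      (.assign 20 (.sub (.reg y) (.reg x))))

theorem orient_spec {B n a x y : ℕ} {s : State} (hB : n * n ≤ B) (hB1 : 1 ≤ B) (h0 : s.reg 0 = n)
    (hx : s.reg x < n) (hy : s.reg y < n) :
    (orient a x y).Safe B s ∧ ∃ v, (orient a x y).run s = s.setReg 20 v ∧
      (v ≠ 0 ↔ LabelLT (s.arr a) n (s.reg x) (s.reg y)) := by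
  have m1 := code_mild hB h0 hx hy
  have m2 := code_mild hB h0 hy hx
  constructor
  · simp [orient, Cmd.Safe, Expr.Mild, m1, m2, hB1]
  · simp only [orient, Cmd.run, Expr.eval, code_eval, h0, LabelLT]
    split_ifs with h1 h2
    · exact ⟨_, rfl, by omega⟩
    · exact ⟨_, rfl, by omega⟩
    · exact ⟨_, rfl, by omega⟩

/-! Forcing between nonadjacent pairs. -/

def complBody : Cmd :=
  .seq (.assign 5 (.arr 5 (.reg 3))) (.seq (.assign 6 (.arr 6 (.reg 3)))
    (.ite (.arr 4 (code 4 5)) .skip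
      (.ite (.arr 4 (code 4 6)) .skip (force 10 10 4 5 4 6))))

/-- The arcs that `complBody` generates for a dart and a vertex. -/
def ComplArc (n : ℕ) (A D₀ D₁ : ℕ → ℕ) (d a P Q R : ℕ) : Prop :=
  A (a * n + D₀ d) = 0 ∧ A (a * n + D₁ d) = 0 ∧ IsForcedArc n a (D₀ d) a (D₁ d) P Q R

theorem complBody_spec {B n : ℕ} {s : State} (hB : n * n ≤ B) (h0 : s.reg 0 = n)
    (h4 : s.reg 4 < n) (h5 : s.arr 5 (s.reg 3) < n) (h6 : s.arr 6 (s.reg 3) < n)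
    (hcB : s.reg 10 + 2 ≤ B) :
    complBody.Safe B s ∧ (complBody.run s).reg 10 ≤ s.reg 10 + 2 ∧
      ∀ P Q R, HasArc 10 10 (complBody.run s) P Q R ↔ HasArc 10 10 s P Q R ∨
        ComplArc n (s.arr 4) (s.arr 5) (s.arr 6) (s.reg 3) (s.reg 4) P Q R := by
  set s1 : State := (s.setReg 5 (s.arr 5 (s.reg 3))).setReg 6 (s.arr 6 (s.reg 3)) with hs1
  have r0 : s1.reg 0 = n := by simp [hs1, State.setReg_reg, h0]
  have r4 : s1.reg 4 = s.reg 4 := by simp [hs1, State.setReg_reg]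
  have r5 : s1.reg 5 = s.arr 5 (s.reg 3) := by simp [hs1, State.setReg_reg]
  have r6 : s1.reg 6 = s.arr 6 (s.reg 3) := by simp [hs1, State.setReg_reg]
  have r10 : s1.reg 10 = s.reg 10 := by simp [hs1, State.setReg_reg]
  have harc : ∀ P Q R, HasArc 10 10 s1 P Q R ↔ HasArc 10 10 s P Q R := by
    intro P Q R
    rw [hs1, hasArc_setReg (by omega), hasArc_setReg (by omega)]
  have hrun : complBody.run s = if s.arr 4 (s.reg 4 * n + s.arr 5 (s.reg 3)) = 0 then
      (if s.arr 4 (s.reg 4 * n + s.arr 6 (s.reg 3)) = 0 then (force 10 10 4 5 4 6).run s1 else s1)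
      else s1 := by
    rw [← h0]
    rfl
  obtain ⟨f1, f2, f3⟩ := force_spec (B := B) (n := n) (b := 10) (c := 10) (x := 4) (y := 5)
    (x' := 4) (y' := 6) (s := s1) (by omega) (by omega) hB r0 (by omega) (by omega) (by omega)
    (by omega) (by omega)
  refine ⟨?_, ?_, fun P Q R => ?_⟩
  · refine ⟨trivial, trivial, ?_, fun _ => trivial, fun _ => ⟨?_, fun _ => trivial, fun _ => f1⟩⟩
    · exact code_mild (s := s1) hB r0 (by omega) (by omega)
    · exact code_mild (s := s1) hB r0 (by omega) (by omega)
  · rw [hrun]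
    split_ifs <;> omega
  · rw [hrun, ComplArc]
    split_ifs with h1 h2
    · rw [f3, harc, r4, r5, r6]
      simp [h1, h2]
    · simp [harc, h2]
    · simp [harc, h1]

/-! The flags for the darts. -/

/-- Registers `5` and `6` hold a dart `(v, w)` and register `4` a vertex `x`. If `x` is a
nonneighbour of `v` and a neighbour of `w`, it is recorded as lying below or above `v`. -/
def flagBody : Cmd :=
  .seq (.assign 5 (.arr 5 (.reg 3))) (.seq (.assign 6 (.arr 6 (.reg 3)))
    (.ite (.arr 4 (code 4 5)) .skip
      (.ite (.arr 4 (code 4 6))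
        (.seq (orient 15 4 5)
          (.ite (.reg 20) (.store 7 (code 5 6) (.lit 1)) (.store 8 (code 5 6) (.lit 1))))
        .skip)))

theorem flagBody_spec {B n : ℕ} {s : State} (hB : n * n ≤ B) (hB1 : 1 ≤ B) (h0 : s.reg 0 = n)
    (h4 : s.reg 4 < n) (h5 : s.arr 5 (s.reg 3) < n) (h6 : s.arr 6 (s.reg 3) < n) :
    flagBody.Safe B s ∧
      (∀ i, (flagBody.run s).arr 7 i ≠ 0 ↔ s.arr 7 i ≠ 0 ∨
        (s.arr 4 (s.reg 4 * n + s.arr 5 (s.reg 3)) = 0 ∧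
          s.arr 4 (s.reg 4 * n + s.arr 6 (s.reg 3)) ≠ 0 ∧
          LabelLT (s.arr 15) n (s.reg 4) (s.arr 5 (s.reg 3)) ∧
          i = s.arr 5 (s.reg 3) * n + s.arr 6 (s.reg 3))) ∧
      (∀ i, (flagBody.run s).arr 8 i ≠ 0 ↔ s.arr 8 i ≠ 0 ∨
        (s.arr 4 (s.reg 4 * n + s.arr 5 (s.reg 3)) = 0 ∧
          s.arr 4 (s.reg 4 * n + s.arr 6 (s.reg 3)) ≠ 0 ∧
          ¬ LabelLT (s.arr 15) n (s.reg 4) (s.arr 5 (s.reg 3)) ∧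
          i = s.arr 5 (s.reg 3) * n + s.arr 6 (s.reg 3))) := by
  set s1 : State := (s.setReg 5 (s.arr 5 (s.reg 3))).setReg 6 (s.arr 6 (s.reg 3)) with hs1
  have r0 : s1.reg 0 = n := by simp [hs1, State.setReg_reg, h0]
  have r4 : s1.reg 4 = s.reg 4 := by simp [hs1, State.setReg_reg]
  have r5 : s1.reg 5 = s.arr 5 (s.reg 3) := by simp [hs1, State.setReg_reg]
  have r6 : s1.reg 6 = s.arr 6 (s.reg 3) := by simp [hs1, State.setReg_reg]
  have harr : s1.arr = s.arr := rfl
  obtain ⟨o1, v, o2, o3⟩ := orient_spec (B := B) (n := n) (a := 15) (x := 4) (y := 5)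
    (s := s1) hB hB1 r0 (by omega) (by omega)
  have hrun : flagBody.run s = if s.arr 4 (s.reg 4 * n + s.arr 5 (s.reg 3)) = 0 then
      (if s.arr 4 (s.reg 4 * n + s.arr 6 (s.reg 3)) = 0 then s1 else
        (if ((orient 15 4 5).run s1).reg 20 = 0 then
          ((orient 15 4 5).run s1).setArr 8 ((code 5 6).eval ((orient 15 4 5).run s1)) 1 else
          ((orient 15 4 5).run s1).setArr 7 ((code 5 6).eval ((orient 15 4 5).run s1)) 1))
      else s1 := by
    rw [← h0]
    rfl
  have hcode : (code 5 6).eval (s1.setReg 20 v) =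
      s.arr 5 (s.reg 3) * n + s.arr 6 (s.reg 3) := by
    simp [code_eval, State.setReg_reg, r0, r5, r6]
  rw [r4, r5, harr] at o3
  rw [o2, hcode] at hrun
  have h20 : (s1.setReg 20 v).reg 20 = v := by simp [State.setReg_reg]
  rw [h20] at hrun
  refine ⟨?_, fun i => ?_, fun i => ?_⟩
  · refine ⟨trivial, trivial, ?_, fun _ => trivial, fun _ => ⟨?_, fun _ => ⟨o1, ?_⟩, fun _ => trivial⟩⟩
    · exact code_mild (s := s1) hB r0 (by omega) (by omega)
    · exact code_mild (s := s1) hB r0 (by omega) (by omega)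
    · have : (code 5 6).Mild B ((orient 15 4 5).run s1) := by
        rw [o2]
        refine code_mild hB ?_ ?_ ?_ <;> simp [State.setReg_reg] <;> omega
      exact ⟨trivial, fun _ => ⟨this, hB1⟩, fun _ => ⟨this, hB1⟩⟩
  all_goals
    rw [hrun, ← o3]
    split_ifs with h1 h2 h3
    · simp [harr, h2]
    · by_cases hi : i = s.arr 5 (s.reg 3) * n + s.arr 6 (s.reg 3) <;>
        simp [State.setArr_arr, State.setReg_arr, harr, h1, h2, h3, hi]
    · by_cases hi : i = s.arr 5 (s.reg 3) * n + s.arr 6 (s.reg 3) <;>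
        simp [State.setArr_arr, State.setReg_arr, harr, h1, h2, h3, hi]
    · simp [harr, h1]

/-! Forcing between adjacent pairs. -/

/-- Registers `5`, `6`, `4` hold a path `u, v, w`. The criterion for a fourth vertex is stated for
the direction `u` below `w`; in the other case the ends exchange roles. Register `21` holds the
resulting disjunction of two flags. -/
def squareBody : Cmd :=
  .seq (.assign 5 (.arr 5 (.reg 3))) (.seq (.assign 6 (.arr 6 (.reg 3)))
    (.ite (.arr 4 (code 4 5)) .skip
      (.ite (.arr 4 (code 4 6))
        (.seq (orient 15 5 4)
          (.seq
            (.ite (.reg 20)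
              (.ite (.arr 7 (code 6 4)) (.assign 21 (.lit 1)) (.assign 21 (.arr 8 (code 6 5))))
              (.ite (.arr 7 (code 6 5)) (.assign 21 (.lit 1)) (.assign 21 (.arr 8 (code 6 4)))))
            (.ite (.reg 21) (force 20 11 5 6 4 6) .skip)))
        .skip)))

/-- The test of `squareBody` for the path `u, v, w`. -/
def SquareTest (n : ℕ) (L DN UP : ℕ → ℕ) (u v w : ℕ) : Prop :=
  (LabelLT L n u w ∧ (DN (v * n + w) ≠ 0 ∨ UP (v * n + u) ≠ 0)) ∨
    (¬ LabelLT L n u w ∧ (DN (v * n + u) ≠ 0 ∨ UP (v * n + w) ≠ 0))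

/-- The arcs that `squareBody` generates for a dart and a vertex. -/
def SquareArc (n : ℕ) (A D₀ D₁ L DN UP : ℕ → ℕ) (d w P Q R : ℕ) : Prop :=
  A (w * n + D₀ d) = 0 ∧ A (w * n + D₁ d) ≠ 0 ∧ SquareTest n L DN UP (D₀ d) (D₁ d) w ∧
    IsForcedArc n (D₀ d) (D₁ d) w (D₁ d) P Q R

theorem squareBody_spec {B n : ℕ} {s : State} (hB : n * n ≤ B) (hB1 : 1 ≤ B) (h0 : s.reg 0 = n)
    (h4 : s.reg 4 < n) (h5 : s.arr 5 (s.reg 3) < n) (h6 : s.arr 6 (s.reg 3) < n)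
    (hcB : s.reg 11 + 2 ≤ B) :
    squareBody.Safe B s ∧ (squareBody.run s).reg 11 ≤ s.reg 11 + 2 ∧
      ∀ P Q R, HasArc 20 11 (squareBody.run s) P Q R ↔ HasArc 20 11 s P Q R ∨
        SquareArc n (s.arr 4) (s.arr 5) (s.arr 6) (s.arr 15) (s.arr 7) (s.arr 8) (s.reg 3)
          (s.reg 4) P Q R := by
  set u := s.arr 5 (s.reg 3) with hu
  set v := s.arr 6 (s.reg 3) with hv
  set w := s.reg 4 with hw
  set s1 : State := (s.setReg 5 u).setReg 6 v with hs1
  have r0 : s1.reg 0 = n := by simp [hs1, State.setReg_reg, h0]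
  have r4 : s1.reg 4 = w := by simp [hs1, State.setReg_reg, hw]
  have r5 : s1.reg 5 = u := by simp [hs1, State.setReg_reg]
  have r6 : s1.reg 6 = v := by simp [hs1, State.setReg_reg]
  have r11 : s1.reg 11 = s.reg 11 := by simp [hs1, State.setReg_reg]
  have harr : s1.arr = s.arr := rfl
  obtain ⟨o1, x, o2, o3⟩ := orient_spec (B := B) (n := n) (a := 15) (x := 5) (y := 4)
    (s := s1) hB hB1 r0 (by omega) (by omega)
  rw [r4, r5, harr] at o3
  set s2 : State := s1.setReg 20 x with hs2
  set tst : Cmd := .ite (.reg 20)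
    (.ite (.arr 7 (code 6 4)) (.assign 21 (.lit 1)) (.assign 21 (.arr 8 (code 6 5))))
    (.ite (.arr 7 (code 6 5)) (.assign 21 (.lit 1)) (.assign 21 (.arr 8 (code 6 4)))) with htst
  have q0 : s2.reg 0 = n := by simp [hs2, State.setReg_reg, r0]
  have q4 : s2.reg 4 = w := by simp [hs2, State.setReg_reg, r4]
  have q5 : s2.reg 5 = u := by simp [hs2, State.setReg_reg, r5]
  have q6 : s2.reg 6 = v := by simp [hs2, State.setReg_reg, r6]
  have q20 : s2.reg 20 = x := by simp [hs2, State.setReg_reg]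
  have qarr : s2.arr = s.arr := rfl
  have ht : tst.Safe B s2 ∧ ∃ z, tst.run s2 = s2.setReg 21 z ∧
      (z ≠ 0 ↔ SquareTest n (s.arr 15) (s.arr 7) (s.arr 8) u v w) := by
    have m1 : (code 6 4).Mild B s2 := code_mild hB q0 (by omega) (by omega)
    have m2 : (code 6 5).Mild B s2 := code_mild hB q0 (by omega) (by omega)
    refine ⟨?_, ?_⟩
    · simp [htst, Cmd.Safe, Expr.Mild, m1, m2, hB1]
    · simp only [htst, Cmd.run, Expr.eval, code_eval, q0, q4, q5, q6, q20, qarr, SquareTest, ← o3]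
      split_ifs with h1 h2 h2
      all_goals exact ⟨_, rfl, by simp [h1, h2]⟩
  obtain ⟨t1, z, t2, t3⟩ := ht
  set s3 : State := s2.setReg 21 z with hs3
  have p0 : s3.reg 0 = n := by simp [hs3, State.setReg_reg, q0]
  have p4 : s3.reg 4 = w := by simp [hs3, State.setReg_reg, q4]
  have p5 : s3.reg 5 = u := by simp [hs3, State.setReg_reg, q5]
  have p6 : s3.reg 6 = v := by simp [hs3, State.setReg_reg, q6]
  have p11 : s3.reg 11 = s.reg 11 := by simp [hs3, hs2, State.setReg_reg, r11]
  have p21 : s3.reg 21 = z := by simp [hs3, State.setReg_reg]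
  have harc : ∀ P Q R, HasArc 20 11 s1 P Q R ↔ HasArc 20 11 s P Q R := by
    intro P Q R
    rw [hs1, hasArc_setReg (by omega), hasArc_setReg (by omega)]
  have harc' : ∀ P Q R, HasArc 20 11 s3 P Q R ↔ HasArc 20 11 s P Q R := by
    intro P Q R
    rw [hs3, hs2, hasArc_setReg (by omega), hasArc_setReg (by omega), harc]
  obtain ⟨f1, f2, f3⟩ := force_spec (B := B) (n := n) (b := 20) (c := 11) (x := 5) (y := 6)
    (x' := 4) (y' := 6) (s := s3) (by omega) (by omega) hB p0 (by omega) (by omega) (by omega)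
    (by omega) (by omega)
  have hrun : squareBody.run s = if s.arr 4 (w * n + u) = 0 then
      (if s.arr 4 (w * n + v) = 0 then s1 else
        (if (tst.run ((orient 15 5 4).run s1)).reg 21 = 0 then tst.run ((orient 15 5 4).run s1) else
          (force 20 11 5 6 4 6).run (tst.run ((orient 15 5 4).run s1))))
      else s1 := by
    rw [← h0]
    rfl
  rw [o2, t2, p21] at hrun
  refine ⟨?_, ?_, fun P Q R => ?_⟩
  · refine ⟨trivial, trivial, ?_, fun _ => trivial, fun _ => ⟨?_, fun _ => ⟨o1, ?_, ?_⟩,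
      fun _ => trivial⟩⟩
    · exact code_mild (s := s1) hB r0 (by omega) (by omega)
    · exact code_mild (s := s1) hB r0 (by omega) (by omega)
    · change tst.Safe B ((orient 15 5 4).run s1)
      rw [o2]
      exact t1
    · refine ⟨trivial, fun _ => ?_, fun _ => trivial⟩
      change (force 20 11 5 6 4 6).Safe B (tst.run ((orient 15 5 4).run s1))
      rw [o2, t2]
      exact f1
  · rw [hrun]
    split_ifs <;> omega
  · rw [hrun, SquareArc, ← hu, ← hv, ← t3]
    split_ifs with h1 h2 h3
    · simp [harc, h2]
    · simp [harc', h3]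
    · rw [f3, harc', p4, p5, p6]
      simp [h1, h2, h3]
    · simp [harc, h1]

/-! The loops of the program. -/

theorem Cmd.run_seq (p q : Cmd) (s : State) : (Cmd.seq p q).run s = q.run (p.run s) := rfl

theorem exists_mem_cons_iff_or {α : Type*} {a : α} {l : List α} {p : α → Prop} :
    (∃ t ∈ a :: l, p t) ↔ (∃ t ∈ l, p t) ∨ p a := by
  simp [or_comm]

theorem exists_mem_iff_of_mem_iff {l : List (ℕ × ℕ)} {M n : ℕ}
    (h : ∀ i j, (i, j) ∈ l ↔ i < M ∧ j < n) (p : ℕ → ℕ → Prop) :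
    (∃ t ∈ l, p t.1 t.2) ↔ ∃ d < M, ∃ a < n, p d a := by
  constructor
  · rintro ⟨⟨d, a⟩, ht, hp⟩
    obtain ⟨hd, ha⟩ := (h d a).1 ht
    exact ⟨d, hd, a, ha, hp⟩
  · rintro ⟨d, hd, a, ha, hp⟩
    exact ⟨(d, a), (h d a).2 ⟨hd, ha⟩, hp⟩

def complLoop : Cmd :=
  .for 3 2 (.for 4 0 complBody)

/-- Each treated pair of a dart and a vertex appends at most two arcs. Bounding the counter by twice
the length of the list of treated pairs gives O(nm) arcs and keeps the counter within a word. -/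
theorem ends_complLoop {B n M : ℕ} {s₀ : State} (hs : s₀.Bdd B) (hB : n * n ≤ B)
    (hMB : 2 * (M * n) + 2 ≤ B) (h0 : s₀.reg 0 = n) (h2 : s₀.reg 2 = M) (h10 : s₀.reg 10 = 0)
    (hD : ∀ d < M, s₀.arr 5 d < n ∧ s₀.arr 6 d < n) :
    Ends B complLoop s₀ (M * (n * (complBody.maxCost + 8) + 14) + 6) fun s =>
      s.reg 10 ≤ 2 * (M * n) ∧ ∀ P Q R, HasArc 10 10 s P Q R ↔
        ∃ d < M, ∃ a < n, ComplArc n (s₀.arr 4) (s₀.arr 5) (s₀.arr 6) d a P Q R := by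
  refine (Ends.for₂ (K := complBody.maxCost) (fun l s => (s.reg 0 = n ∧ s.arr 4 = s₀.arr 4 ∧
    s.arr 5 = s₀.arr 5 ∧ s.arr 6 = s₀.arr 6) ∧ s.reg 10 ≤ 2 * l.length ∧
    ∀ P Q R, HasArc 10 10 s P Q R ↔
      ∃ t ∈ l, ComplArc n (s₀.arr 4) (s₀.arr 5) (s₀.arr 6) t.1 t.2 P Q R)
    (by omega) ?_ (by omega) ?_ ?_ hs h2 h0 ?_ ?_).mono le_rfl ?_
  · simp [complBody, force, push, Cmd.SetsReg]
  · intro l s v h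
    simpa [State.setReg_reg, State.setReg_arr, hasArc_setReg] using h
  · intro l s v h
    simpa [State.setReg_reg, State.setReg_arr, hasArc_setReg] using h
  · simp [h0, h10, HasArc]
  · rintro l s hs hl h3 h4 - h0' ⟨⟨e0, e4, e5, e6⟩, hc, harc⟩
    have hd := hD _ h3
    obtain ⟨c1, c2, c3⟩ := complBody_spec (B := B) (n := n) (s := s) hB e0 h4 (by rw [e5]; exact hd.1)
      (by rw [e6]; exact hd.2) (by omega)
    refine ((c1.ends hs (Q := fun s' => s' = complBody.run s) rfl).frame).mono le_rfl ?_
    rintro s' - ⟨rfl, hreg, harr⟩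
    have hset : ∀ a, a = 4 ∨ a = 5 ∨ a = 6 → ¬ complBody.SetsArr a := by
      rintro a (rfl | rfl | rfl) <;> simp [complBody, force, push, Cmd.SetsArr]
    refine ⟨⟨?_, ?_, ?_, ?_⟩, ?_, fun P Q R => ?_⟩
    · rw [hreg 0 (by simp [complBody, force, push, Cmd.SetsReg]), e0]
    · rw [harr 4 (hset 4 (by omega)), e4]
    · rw [harr 5 (hset 5 (by omega)), e5]
    · rw [harr 6 (hset 6 (by omega)), e6]
    · rw [List.length_cons]
      omega
    · rw [c3, harc, e4, e5, e6, exists_mem_cons_iff_or]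
  · rintro s' - ⟨l, hl, hmem, -, hc, harc⟩
    exact ⟨hl ▸ hc, fun P Q R => (harc P Q R).trans (exists_mem_iff_of_mem_iff hmem fun d a =>
      ComplArc n (s₀.arr 4) (s₀.arr 5) (s₀.arr 6) d a P Q R)⟩

def squareLoop : Cmd :=
  .for 3 2 (.for 4 0 squareBody)

theorem ends_squareLoop {B n M : ℕ} {s₀ : State} (hs : s₀.Bdd B) (hB : n * n ≤ B)
    (hMB : 2 * (M * n) + 2 ≤ B) (h0 : s₀.reg 0 = n) (h2 : s₀.reg 2 = M) (h11 : s₀.reg 11 = 0)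
    (hD : ∀ d < M, s₀.arr 5 d < n ∧ s₀.arr 6 d < n) :
    Ends B squareLoop s₀ (M * (n * (squareBody.maxCost + 8) + 14) + 6) fun s =>
      s.reg 11 ≤ 2 * (M * n) ∧ ∀ P Q R, HasArc 20 11 s P Q R ↔
        ∃ d < M, ∃ a < n, SquareArc n (s₀.arr 4) (s₀.arr 5) (s₀.arr 6) (s₀.arr 15) (s₀.arr 7)
          (s₀.arr 8) d a P Q R := by
  have hset : ∀ a, a = 4 ∨ a = 5 ∨ a = 6 ∨ a = 15 ∨ a = 7 ∨ a = 8 → ¬ squareBody.SetsArr a := by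
    rintro a (rfl | rfl | rfl | rfl | rfl | rfl) <;>
      simp [squareBody, orient, force, push, Cmd.SetsArr]
  refine (Ends.for₂ (K := squareBody.maxCost) (fun l s => (s.reg 0 = n ∧
    ∀ a, a = 4 ∨ a = 5 ∨ a = 6 ∨ a = 15 ∨ a = 7 ∨ a = 8 → s.arr a = s₀.arr a) ∧
    s.reg 11 ≤ 2 * l.length ∧
    ∀ P Q R, HasArc 20 11 s P Q R ↔
      ∃ t ∈ l, SquareArc n (s₀.arr 4) (s₀.arr 5) (s₀.arr 6) (s₀.arr 15) (s₀.arr 7)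
          (s₀.arr 8) t.1 t.2 P Q R)
    (by omega) ?_ (by omega) ?_ ?_ hs h2 h0 ?_ ?_).mono le_rfl ?_
  · simp [squareBody, orient, force, push, Cmd.SetsReg]
  · intro l s v h
    simpa [State.setReg_reg, State.setReg_arr, hasArc_setReg] using h
  · intro l s v h
    simpa [State.setReg_reg, State.setReg_arr, hasArc_setReg] using h
  · simp [h0, h11, HasArc]
  · rintro l s hs hl h3 h4 - h0' ⟨⟨e0, earr⟩, hc, harc⟩
    have hd := hD _ h3
    obtain ⟨c1, c2, c3⟩ := squareBody_spec (B := B) (n := n) (s := s) hB (by omega) e0 h4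
      (by rw [earr 5 (by omega)]; exact hd.1) (by rw [earr 6 (by omega)]; exact hd.2) (by omega)
    refine ((c1.ends hs (Q := fun s' => s' = squareBody.run s) rfl).frame).mono le_rfl ?_
    rintro s' - ⟨rfl, hreg, harr⟩
    refine ⟨⟨?_, fun a ha => ?_⟩, ?_, fun P Q R => ?_⟩
    · rw [hreg 0 (by simp [squareBody, orient, force, push, Cmd.SetsReg]), e0]
    · rw [harr a (hset a ha), earr a ha]
    · rw [List.length_cons]
      omega
    · rw [c3, harc, earr 4 (by omega), earr 5 (by omega), earr 6 (by omega), earr 15 (by omega),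
        earr 7 (by omega), earr 8 (by omega), exists_mem_cons_iff_or]
  · rintro s' - ⟨l, hl, hmem, -, hc, harc⟩
    exact ⟨hl ▸ hc, fun P Q R => (harc P Q R).trans (exists_mem_iff_of_mem_iff hmem fun d a =>
      SquareArc n (s₀.arr 4) (s₀.arr 5) (s₀.arr 6) (s₀.arr 15) (s₀.arr 7)
      (s₀.arr 8) d a P Q R)⟩

def flagLoop : Cmd :=
  .for 3 2 (.for 4 0 flagBody)

theorem ends_flagLoop {B n M : ℕ} {s₀ : State} (hs : s₀.Bdd B) (hB : n * n ≤ B) (hB1 : 1 ≤ B)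
    (h0 : s₀.reg 0 = n) (h2 : s₀.reg 2 = M) (h7 : s₀.arr 7 = fun _ => 0)
    (h8 : s₀.arr 8 = fun _ => 0) (hD : ∀ d < M, s₀.arr 5 d < n ∧ s₀.arr 6 d < n) :
    Ends B flagLoop s₀ (M * (n * (flagBody.maxCost + 8) + 14) + 6) fun s =>
      (∀ i, s.arr 7 i ≠ 0 ↔ ∃ d < M, ∃ x < n, s₀.arr 4 (x * n + s₀.arr 5 d) = 0 ∧
        s₀.arr 4 (x * n + s₀.arr 6 d) ≠ 0 ∧ LabelLT (s₀.arr 15) n x (s₀.arr 5 d) ∧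
        i = s₀.arr 5 d * n + s₀.arr 6 d) ∧
      (∀ i, s.arr 8 i ≠ 0 ↔ ∃ d < M, ∃ x < n, s₀.arr 4 (x * n + s₀.arr 5 d) = 0 ∧
        s₀.arr 4 (x * n + s₀.arr 6 d) ≠ 0 ∧ ¬ LabelLT (s₀.arr 15) n x (s₀.arr 5 d) ∧
        i = s₀.arr 5 d * n + s₀.arr 6 d) := by
  have hset : ∀ a, a = 4 ∨ a = 5 ∨ a = 6 ∨ a = 15 → ¬ flagBody.SetsArr a := by
    rintro a (rfl | rfl | rfl | rfl) <;> simp [flagBody, orient, Cmd.SetsArr]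
  refine (Ends.for₂ (K := flagBody.maxCost) (fun l s => (s.reg 0 = n ∧
    ∀ a, a = 4 ∨ a = 5 ∨ a = 6 ∨ a = 15 → s.arr a = s₀.arr a) ∧
      (∀ i, s.arr 7 i ≠ 0 ↔ ∃ t ∈ l, s₀.arr 4 (t.2 * n + s₀.arr 5 t.1) = 0 ∧
        s₀.arr 4 (t.2 * n + s₀.arr 6 t.1) ≠ 0 ∧ LabelLT (s₀.arr 15) n t.2 (s₀.arr 5 t.1) ∧
        i = s₀.arr 5 t.1 * n + s₀.arr 6 t.1) ∧
      (∀ i, s.arr 8 i ≠ 0 ↔ ∃ t ∈ l, s₀.arr 4 (t.2 * n + s₀.arr 5 t.1) = 0 ∧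
        s₀.arr 4 (t.2 * n + s₀.arr 6 t.1) ≠ 0 ∧ ¬ LabelLT (s₀.arr 15) n t.2 (s₀.arr 5 t.1) ∧
        i = s₀.arr 5 t.1 * n + s₀.arr 6 t.1))
    (by omega) ?_ (by omega) ?_ ?_ hs h2 h0 ?_ ?_).mono le_rfl ?_
  · simp [flagBody, orient, Cmd.SetsReg]
  · intro l s v h
    simpa [State.setReg_reg, State.setReg_arr] using h
  · intro l s v h
    simpa [State.setReg_reg, State.setReg_arr] using h
  · simp [h0, h7, h8]
  · rintro l s hs hl h3 h4 - h0' ⟨⟨e0, earr⟩, i7, i8⟩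
    have hd := hD _ h3
    obtain ⟨c1, c2, c3⟩ := flagBody_spec (B := B) (n := n) (s := s) hB hB1 e0 h4
      (by rw [earr 5 (by omega)]; exact hd.1) (by rw [earr 6 (by omega)]; exact hd.2)
    refine ((c1.ends hs (Q := fun s' => s' = flagBody.run s) rfl).frame).mono le_rfl ?_
    rintro s' - ⟨rfl, hreg, harr⟩
    refine ⟨⟨?_, fun a ha => ?_⟩, fun i => ?_, fun i => ?_⟩
    · rw [hreg 0 (by simp [flagBody, orient, Cmd.SetsReg]), e0]
    · rw [harr a (hset a ha), earr a ha]
    · rw [c2, i7, earr 4 (by omega), earr 5 (by omega), earr 6 (by omega), earr 15 (by omega),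
        exists_mem_cons_iff_or]
    · rw [c3, i8, earr 4 (by omega), earr 5 (by omega), earr 6 (by omega), earr 15 (by omega),
        exists_mem_cons_iff_or]
  · rintro s' - ⟨l, hl, hmem, -, i7, i8⟩
    exact ⟨fun i => (i7 i).trans (exists_mem_iff_of_mem_iff hmem fun d x =>
        s₀.arr 4 (x * n + s₀.arr 5 d) = 0 ∧ s₀.arr 4 (x * n + s₀.arr 6 d) ≠ 0 ∧
        LabelLT (s₀.arr 15) n x (s₀.arr 5 d) ∧ i = s₀.arr 5 d * n + s₀.arr 6 d),
      fun i => (i8 i).trans (exists_mem_iff_of_mem_iff hmem fun d x =>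
        s₀.arr 4 (x * n + s₀.arr 5 d) = 0 ∧ s₀.arr 4 (x * n + s₀.arr 6 d) ≠ 0 ∧
        ¬ LabelLT (s₀.arr 15) n x (s₀.arr 5 d) ∧ i = s₀.arr 5 d * n + s₀.arr 6 d)⟩

/-- Set register `12` if an arc has a tail with the same label as its reverse. -/
def checkBody (b : ℕ) : Cmd :=
  .ite (.sub (.arr (b + 5) (.arr b (.reg 3))) (.arr (b + 5) (.arr (b + 2) (.reg 3)))) .skip
    (.ite (.sub (.arr (b + 5) (.arr (b + 2) (.reg 3))) (.arr (b + 5) (.arr b (.reg 3)))) .skip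
      (.assign 12 (.lit 1)))

def checkLoop (b c : ℕ) : Cmd :=
  .for 3 c (checkBody b)

/-- Register `12` is never reset, so a failure found in the first stage survives the second. -/
theorem ends_checkLoop {B b c N : ℕ} {s₀ : State} (hs : s₀.Bdd B) (hc : c < 12 ∧ c ≠ 3)
    (hB : 1 ≤ B) (hN : s₀.reg c = N) :
    Ends B (checkLoop b c) s₀ (N * ((checkBody b).maxCost + 8) + 6) fun s =>
      s.reg 12 = 0 ↔ s₀.reg 12 = 0 ∧
        ∀ j < N, s₀.arr (b + 5) (s₀.arr b j) ≠ s₀.arr (b + 5) (s₀.arr (b + 2) j) := by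
  refine (Ends.for (fun k s => s.arr = s₀.arr ∧ (s.reg 12 = 0 ↔ s₀.reg 12 = 0 ∧
    ∀ j < k, s₀.arr (b + 5) (s₀.arr b j) ≠ s₀.arr (b + 5) (s₀.arr (b + 2) j))) (by omega) ?_ ?_ hB
    ?_ hs hN ?_ ?_).mono le_rfl fun _ _ h => h.2
  · simp [checkBody, Cmd.SetsReg]
  · simp [checkBody, Cmd.SetsReg]
    omega
  · intro k s v h
    simpa [State.setReg_reg, State.setReg_arr] using h
  · simp
  · rintro k s hs hk hx - ⟨h1, h2⟩
    refine Cmd.Safe.ends ?_ hs ?_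
    · simp [checkBody, Cmd.Safe, Expr.Mild, hB]
    · simp only [checkBody, Cmd.run, Expr.eval, h1, hx, Nat.forall_lt_succ_right, ← and_assoc, ← h2]
      split_ifs with h3 h4
      · have : s₀.arr (b + 5) (s₀.arr b k) = s₀.arr (b + 5) (s₀.arr (b + 2) k) := by omega
        simp [State.setReg_reg, State.setReg_arr, h1, this]
      · have : s₀.arr (b + 5) (s₀.arr b k) ≠ s₀.arr (b + 5) (s₀.arr (b + 2) k) := by omega
        simp [h1, this]
      · have : s₀.arr (b + 5) (s₀.arr b k) ≠ s₀.arr (b + 5) (s₀.arr (b + 2) k) := by omega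
        simp [h1, this]

/-- Write one arc of the orientation. -/
def outputBody : Cmd :=
  .seq (.assign 5 (.arr 0 (.reg 3))) (.seq (.assign 6 (.arr 1 (.reg 3))) (.seq (orient 25 5 6)
    (.ite (.reg 20)
      (.seq (.store 2 (.reg 3) (.reg 5)) (.store 3 (.reg 3) (.reg 6)))
      (.seq (.store 2 (.reg 3) (.reg 6)) (.store 3 (.reg 3) (.reg 5))))))

def outputLoop : Cmd :=
  .for 3 1 outputBody

theorem ends_outputLoop {B n m : ℕ} {s₀ : State} (hs : s₀.Bdd B) (hB : n * n ≤ B) (hB1 : 1 ≤ B)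
    (h0 : s₀.reg 0 = n) (hm : s₀.reg 1 = m) (hE : ∀ i < m, s₀.arr 0 i < n ∧ s₀.arr 1 i < n) :
    Ends B outputLoop s₀ (m * (outputBody.maxCost + 8) + 6) fun s => ∀ i < m,
      (LabelLT (s₀.arr 25) n (s₀.arr 0 i) (s₀.arr 1 i) ∧ s.arr 2 i = s₀.arr 0 i ∧
        s.arr 3 i = s₀.arr 1 i) ∨
      (¬ LabelLT (s₀.arr 25) n (s₀.arr 0 i) (s₀.arr 1 i) ∧ s.arr 2 i = s₀.arr 1 i ∧
        s.arr 3 i = s₀.arr 0 i) := by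
  refine (Ends.for (fun k s => (s.reg 0 = n ∧ s.arr 0 = s₀.arr 0 ∧ s.arr 1 = s₀.arr 1 ∧
    s.arr 25 = s₀.arr 25) ∧ ∀ i < k,
      (LabelLT (s₀.arr 25) n (s₀.arr 0 i) (s₀.arr 1 i) ∧ s.arr 2 i = s₀.arr 0 i ∧
        s.arr 3 i = s₀.arr 1 i) ∨
      (¬ LabelLT (s₀.arr 25) n (s₀.arr 0 i) (s₀.arr 1 i) ∧ s.arr 2 i = s₀.arr 1 i ∧
        s.arr 3 i = s₀.arr 0 i)) (by omega) ?_ ?_ hB1 ?_ hs hm ?_ ?_).mono le_rfl fun _ _ h => h.2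
  · simp [outputBody, orient, Cmd.SetsReg]
  · simp [outputBody, orient, Cmd.SetsReg]
  · intro k s v h
    simpa [State.setReg_reg, State.setReg_arr] using h
  · simp [h0]
  · rintro k s hs hk hx - ⟨⟨e0, a0, a1, a25⟩, h⟩
    obtain ⟨hk0, hk1⟩ := hE k hk
    set s1 : State := (s.setReg 5 (s₀.arr 0 k)).setReg 6 (s₀.arr 1 k) with hs1
    have r0 : s1.reg 0 = n := by simp [hs1, State.setReg_reg, e0]
    have r3 : s1.reg 3 = k := by simp [hs1, State.setReg_reg, hx]
    have r5 : s1.reg 5 = s₀.arr 0 k := by simp [hs1, State.setReg_reg]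
    have r6 : s1.reg 6 = s₀.arr 1 k := by simp [hs1, State.setReg_reg]
    have harr : s1.arr = s.arr := rfl
    obtain ⟨o1, v, o2, o3⟩ := orient_spec (B := B) (n := n) (a := 25) (x := 5) (y := 6)
      (s := s1) hB hB1 r0 (by omega) (by omega)
    rw [r5, r6, harr, a25] at o3
    have e1 : ((Cmd.assign 6 (.arr 1 (.reg 3))).run ((Cmd.assign 5 (.arr 0 (.reg 3))).run s)) =
        s1 := by
      simp [Cmd.run, Expr.eval, hs1, State.setReg_reg, State.setReg_arr, hx, a0, a1]
    refine Cmd.Safe.ends ?_ hs ?_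
    · simp only [outputBody, Cmd.Safe, Expr.Mild, e1, and_true, o1, implies_true]
    · have hrun : outputBody.run s = if v = 0 then
          ((s1.setReg 20 v).setArr 2 k (s₀.arr 1 k)).setArr 3 k (s₀.arr 0 k) else
          ((s1.setReg 20 v).setArr 2 k (s₀.arr 0 k)).setArr 3 k (s₀.arr 1 k) := by
        rw [outputBody, Cmd.run_seq, Cmd.run_seq, Cmd.run_seq, e1, o2]
        simp [Cmd.run, Expr.eval, State.setReg_reg, State.setArr_reg, r3, r5, r6]
      rw [hrun]
      refine ⟨?_, fun i hi => ?_⟩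
      · split_ifs <;>
          simp [State.setArr_arr, State.setReg_arr, State.setArr_reg, State.setReg_reg, harr, r0, a0,
            a1, a25]
      · by_cases hik : i = k
        · subst hik
          rw [← o3]
          split_ifs with hv <;> simp [State.setArr_arr, hv]
        · have := h i (by omega)
          split_ifs <;> simpa [State.setArr_arr, State.setReg_arr, harr, hik] using this

/-- Enter one edge into the adjacency matrix and the list of darts. -/
def setupBody : Cmd :=
  .seq (.assign 5 (.arr 0 (.reg 3))) (.seq (.assign 6 (.arr 1 (.reg 3)))
    (.seq (.store 4 (code 5 6) (.lit 1)) (.seq (.store 4 (code 6 5) (.lit 1))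
      (.seq (.store 4 (code 5 5) (.lit 1)) (.seq (.store 4 (code 6 6) (.lit 1))
        (.seq (.store 5 (.reg 3) (.reg 5)) (.seq (.store 6 (.reg 3) (.reg 6))
          (.seq (.store 5 (.add (.reg 1) (.reg 3)) (.reg 6))
            (.store 6 (.add (.reg 1) (.reg 3)) (.reg 5))))))))))

def setup : Cmd :=
  .seq (.assign 2 (.add (.reg 1) (.reg 1))) (.for 3 1 setupBody)

theorem update_code_ne_zero {n u v x y : ℕ} {A : ℕ → ℕ} (hv : v < n) (hy : y < n) :
    Function.update A (u * n + v) 1 (x * n + y) ≠ 0 ↔ A (x * n + y) ≠ 0 ∨ (x = u ∧ y = v) := by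
  rw [Function.update_apply]
  split_ifs with h
  · rw [pair_code_inj hy hv] at h
    simp [h]
  · rw [pair_code_inj hy hv] at h
    simp [h]

theorem ends_setup {B n m : ℕ} {s₀ : State} (hs : s₀.Bdd B) (hB : n * n ≤ B) (hB1 : 1 ≤ B)
    (hmB : 2 * m ≤ B) (h0 : s₀.reg 0 = n) (hm : s₀.reg 1 = m)
    (hE : ∀ i < m, s₀.arr 0 i < n ∧ s₀.arr 1 i < n) (h4 : s₀.arr 4 = fun _ => 0) :
    Ends B setup s₀ (4 + (m * (setupBody.maxCost + 8) + 6)) fun s => s.reg 2 = 2 * m ∧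
      (∀ x < n, ∀ y < n, s.arr 4 (x * n + y) ≠ 0 ↔ ∃ i < m,
        (x = s₀.arr 0 i ∧ y = s₀.arr 1 i) ∨ (x = s₀.arr 1 i ∧ y = s₀.arr 0 i) ∨
        (x = s₀.arr 0 i ∧ y = s₀.arr 0 i) ∨ (x = s₀.arr 1 i ∧ y = s₀.arr 1 i)) ∧
      ∀ i < m, s.arr 5 i = s₀.arr 0 i ∧ s.arr 6 i = s₀.arr 1 i ∧ s.arr 5 (m + i) = s₀.arr 1 i ∧
        s.arr 6 (m + i) = s₀.arr 0 i := by
  refine Ends.seq (R := fun s => s = s₀.setReg 2 (2 * m)) ((Cmd.Safe.ends ?_ hs ?_).mono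
    (by simp [Cmd.maxCost, Expr.cost]) fun _ _ h => h) ?_
  · simp only [Cmd.Safe, Expr.Mild, Expr.eval, hm, true_and]
    omega
  · simp [Cmd.run, Expr.eval, hm, two_mul]
  rintro s1 hs1 rfl
  refine (Ends.for (fun k s => (s.reg 0 = n ∧ s.reg 1 = m ∧ s.reg 2 = 2 * m ∧
      s.arr 0 = s₀.arr 0 ∧ s.arr 1 = s₀.arr 1) ∧
      (∀ x < n, ∀ y < n, s.arr 4 (x * n + y) ≠ 0 ↔ ∃ i < k,
        (x = s₀.arr 0 i ∧ y = s₀.arr 1 i) ∨ (x = s₀.arr 1 i ∧ y = s₀.arr 0 i) ∨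
        (x = s₀.arr 0 i ∧ y = s₀.arr 0 i) ∨ (x = s₀.arr 1 i ∧ y = s₀.arr 1 i)) ∧
      ∀ i < k, s.arr 5 i = s₀.arr 0 i ∧ s.arr 6 i = s₀.arr 1 i ∧ s.arr 5 (m + i) = s₀.arr 1 i ∧
        s.arr 6 (m + i) = s₀.arr 0 i) (by omega) ?_ ?_ hB1 ?_ hs1 (N := m) ?_ ?_ ?_).mono le_rfl
    fun _ _ h => ⟨h.1.2.2.1, h.2⟩
  · simp [setupBody, Cmd.SetsReg]
  · simp [setupBody, Cmd.SetsReg]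
  · intro k s v h
    simpa [State.setReg_reg, State.setReg_arr] using h
  · simp [State.setReg_reg, hm]
  · simp [State.setReg_reg, State.setReg_arr, h0, hm, h4]
  · rintro k s hs hk hx hm' ⟨⟨e0, e1, e2, a0, a1⟩, hA, hD⟩
    obtain ⟨hk0, hk1⟩ := hE k hk
    set s1 : State := (s.setReg 5 (s₀.arr 0 k)).setReg 6 (s₀.arr 1 k) with hs1
    have r0 : s1.reg 0 = n := by simp [hs1, State.setReg_reg, e0]
    have r1 : s1.reg 1 = m := by simp [hs1, State.setReg_reg, e1]
    have r2 : s1.reg 2 = 2 * m := by simp [hs1, State.setReg_reg, e2]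
    have r3 : s1.reg 3 = k := by simp [hs1, State.setReg_reg, hx]
    have r5 : s1.reg 5 = s₀.arr 0 k := by simp [hs1, State.setReg_reg]
    have r6 : s1.reg 6 = s₀.arr 1 k := by simp [hs1, State.setReg_reg]
    have harr : s1.arr = s.arr := rfl
    have e1 : ((Cmd.assign 6 (.arr 1 (.reg 3))).run ((Cmd.assign 5 (.arr 0 (.reg 3))).run s)) =
        s1 := by
      simp [Cmd.run, Expr.eval, hs1, State.setReg_reg, State.setReg_arr, hx, a0, a1]
    have hrun : setupBody.run s = (((((((s1.setArr 4 (s₀.arr 0 k * n + s₀.arr 1 k) 1).setArr 4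
        (s₀.arr 1 k * n + s₀.arr 0 k) 1).setArr 4 (s₀.arr 0 k * n + s₀.arr 0 k) 1).setArr 4
        (s₀.arr 1 k * n + s₀.arr 1 k) 1).setArr 5 k (s₀.arr 0 k)).setArr 6 k
        (s₀.arr 1 k)).setArr 5 (m + k) (s₀.arr 1 k)).setArr 6 (m + k) (s₀.arr 0 k) := by
      rw [setupBody, Cmd.run_seq, Cmd.run_seq, e1]
      simp [Cmd.run, Expr.eval, code_eval, State.setArr_reg, r0, r1, r3, r5, r6]
    refine Cmd.Safe.ends ?_ hs ?_
    · have c1 := pair_code_lt hk0 hk1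
      have c2 := pair_code_lt hk1 hk0
      have c3 := pair_code_lt hk0 hk0
      have c4 := pair_code_lt hk1 hk1
      simp only [setupBody, Cmd.Safe, Expr.Mild, e1, code]
      simp only [Cmd.run, Expr.eval, State.setArr_reg, r0, r1, r3, r5, r6, true_and, and_true]
      omega
    · rw [hrun]
      refine ⟨?_, fun x hx y hy => ?_, fun i hi => ?_⟩
      · simp [State.setArr_arr, State.setArr_reg, harr, r0, r1, r2, a0, a1]
      · simp only [State.setArr_arr]
        simp only [if_true, show (4 : ℕ) ≠ 5 by omega, show (4 : ℕ) ≠ 6 by omega, if_false]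
        rw [update_code_ne_zero hk1 hy, update_code_ne_zero hk0 hy, update_code_ne_zero hk0 hy,
          update_code_ne_zero hk1 hy, harr, hA x hx y hy]
        simp only [Nat.exists_lt_succ_right, or_assoc]
      · simp only [State.setArr_arr]
        simp only [if_true, show (5 : ℕ) ≠ 6 by omega, show (6 : ℕ) ≠ 5 by omega,
          show (5 : ℕ) ≠ 4 by omega, show (6 : ℕ) ≠ 4 by omega, if_false, harr,
          Function.update_apply]
        by_cases hik : i = k
        · subst hik
          simp
          omega
        · have := hD i (by omega)
          simpa [hik, show ¬ i = m + k by omega, show ¬ m + i = k by omega] using this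

/-! ### Correctness of the forcing relations -/

section Labels

variable {n : ℕ}

/-- The code of a pair of vertices. -/
def pairCode (p : Fin n × Fin n) : ℕ :=
  p.1 * n + p.2

theorem pairCode_injective : Function.Injective (pairCode (n := n)) := by
  rintro ⟨x, y⟩ ⟨x', y'⟩ h
  obtain ⟨h1, h2⟩ := (pair_code_inj y.2 y'.2).1 h
  exact Prod.ext (Fin.ext h1) (Fin.ext h2)

/-- The arcs `(X j, Y j)`, with the reversed tails `R j`, represent the relation `K` between
pairs. -/
def RepresentsRel (N : ℕ) (X Y R : ℕ → ℕ) (K : Fin n × Fin n → Fin n × Fin n → Prop) : Prop :=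
  ∀ P Q S, (∃ j < N, X j = P ∧ Y j = Q ∧ R j = S) ↔
    ∃ p q, K p q ∧ P = pairCode p ∧ Q = pairCode q ∧ S = pairCode p.swap

variable {N : ℕ} {X Y R L : ℕ → ℕ} {K : Fin n × Fin n → Fin n × Fin n → Prop}

theorem RepresentsRel.symm_arcs (h : RepresentsRel N X Y R K) (hK : ∀ p q, K p q → K q p) :
    ∀ j < N, ∃ i < N, X i = Y j ∧ Y i = X j := by
  intro j hj
  obtain ⟨p, q, hpq, h1, h2, -⟩ := (h _ _ _).1 ⟨j, hj, rfl, rfl, rfl⟩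
  obtain ⟨i, hi, h3, h4, -⟩ := (h _ _ _).2 ⟨q, p, hK p q hpq, rfl, rfl, rfl⟩
  exact ⟨i, hi, h3.trans h2.symm, h4.trans h1.symm⟩

theorem RepresentsRel.lt (h : RepresentsRel N X Y R K) : ∀ j < N, X j < n * n := by
  intro j hj
  obtain ⟨p, q, -, h1, -⟩ := (h _ _ _).1 ⟨j, hj, rfl, rfl, rfl⟩
  rw [h1]
  exact pair_code_lt p.1.2 p.2.2

theorem RepresentsRel.label_eq (h : RepresentsRel N X Y R K) (hL : IsComponentLabelling N X Y L)
    {p q : Fin n × Fin n} (hpq : K p q) : L (pairCode q) = L (pairCode p) := by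
  obtain ⟨j, hj, h1, h2, -⟩ := (h _ _ _).2 ⟨p, q, hpq, rfl, rfl, rfl⟩
  rw [← h1, ← h2]
  exact hL.eq j hj

theorem RepresentsRel.label_ne (h : RepresentsRel N X Y R K)
    (hne : ∀ j < N, L (X j) ≠ L (R j)) {p q : Fin n × Fin n} (hpq : K p q) :
    L (pairCode p) ≠ L (pairCode p.swap) := by
  obtain ⟨j, hj, h1, -, h2⟩ := (h _ _ _).2 ⟨p, q, hpq, rfl, rfl, rfl⟩
  rw [← h1, ← h2]
  exact hne j hj

/-- Related pairs have equal labels, and so do their reverses; the labels of a pair and of its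
reverse differ. The comparison therefore carries over, and ties never decide it. -/
theorem RepresentsRel.labelLT (h : RepresentsRel N X Y R K) (hL : IsComponentLabelling N X Y L)
    (hne : ∀ j < N, L (X j) ≠ L (R j)) (hswap : ∀ p q, K p q → K p.swap q.swap)
    {p q : Fin n × Fin n} (hpq : K p q) (hp : LabelLT L n p.1 p.2) : LabelLT L n q.1 q.2 := by
  have h1 := h.label_eq hL hpq
  have h2 := h.label_eq hL (hswap _ _ hpq)
  have h3 := h.label_ne hne hpq
  simp only [pairCode, Prod.fst_swap, Prod.snd_swap] at h1 h2 h3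
  simp only [LabelLT] at hp ⊢
  omega

/-- If some orientation respects the relation, then no class contains a pair and its reverse. -/
theorem RepresentsRel.ne_of_invariant (h : RepresentsRel N X Y R K)
    (hL : IsComponentLabelling N X Y L) {F : Fin n → Fin n → Prop}
    (hF : ∀ p q, K p q → (F p.1 p.2 ↔ F q.1 q.2))
    (hF' : ∀ p q, K p q → (F p.1 p.2 ↔ ¬ F p.2 p.1)) :
    ∀ j < N, L (X j) ≠ L (R j) := by
  intro j hj hjR
  obtain ⟨p, q, hpq, h1, -, h3⟩ := (h _ _ _).1 ⟨j, hj, rfl, rfl, rfl⟩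
  -- The orientation is transported to codes, where it is invariant along arcs and hence on
  -- components. A common label would then give a pair and its reverse the same direction.
  let F' : ℕ → Prop := fun P => ∃ p : Fin n × Fin n, P = pairCode p ∧ F p.1 p.2
  have hF'' : ∀ p : Fin n × Fin n, F' (pairCode p) ↔ F p.1 p.2 := by
    intro p
    constructor
    · rintro ⟨q, hq, h⟩
      rwa [pairCode_injective hq]
    · exact fun h => ⟨p, rfl, h⟩
  have hinv : ∀ P Q, Relation.EqvGen (ArcRel N X Y) P Q → (F' P ↔ F' Q) := by
    intro P Q hPQ
    induction hPQ with
    | rel P Q hPQ =>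
      obtain ⟨i, hi, h1, h2⟩ := hPQ
      obtain ⟨p, q, hpq, h3, h4, -⟩ := (h _ _ _).1 ⟨i, hi, h1, h2, rfl⟩
      rw [h3, h4, hF'', hF'']
      exact hF p q hpq
    | refl P => exact Iff.rfl
    | symm P Q _ ih => exact ih.symm
    | trans P Q S _ _ ih1 ih2 => exact ih1.trans ih2
  have h4 := hinv _ _ (hL.sound _ _ (hL.ne_zero j hj) hjR)
  rw [h1, h3, hF'', hF''] at h4
  have h5 := hF' p q hpq
  simp only [Prod.fst_swap, Prod.snd_swap] at h4
  tauto

/-- The orientation of `H` that is given by a labelling of the pairs. -/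
def labelOrientation (H : SimpleGraph (Fin n)) (L : ℕ → ℕ) (x y : Fin n) : Prop :=
  H.Adj x y ∧ LabelLT L n x y

/-- The tie-break by vertex numbers makes this hold for any labelling, including pairs with equal
labels in both directions. -/
theorem isOrientation_labelOrientation (H : SimpleGraph (Fin n)) (L : ℕ → ℕ) :
    IsOrientation H (labelOrientation H L) := by
  refine ⟨fun u v h => h.1, fun u v h => ?_⟩
  have hne : (u : ℕ) ≠ v := fun h' => h.ne (Fin.ext h')
  simp only [labelOrientation, h, h.symm, true_and, LabelLT]
  omega

end Labels

section Graph

variable {n : ℕ} {G : SimpleGraph (Fin n)}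

/-- The arrays hold the adjacency matrix and the `M` darts of the graph. -/
structure RepresentsGraph (G : SimpleGraph (Fin n)) (M : ℕ) (A D₀ D₁ : ℕ → ℕ) : Prop where
  adj : ∀ x y : Fin n, A (x * n + y) ≠ 0 ↔ G.Adj x y ∨ (x = y ∧ ∃ z, G.Adj x z)
  dart : ∀ d < M, ∃ u v : Fin n, G.Adj u v ∧ D₀ d = u ∧ D₁ d = v
  exists_dart : ∀ u v, G.Adj u v → ∃ d < M, D₀ d = u ∧ D₁ d = v

variable {M : ℕ} {A D₀ D₁ : ℕ → ℕ}

/-- The ones on the diagonal make a single zero test express both distinctness and nonadjacency,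
provided that `u` is not isolated; the ends of darts never are. -/
theorem RepresentsGraph.eq_zero_iff (h : RepresentsGraph G M A D₀ D₁) {x u v : Fin n}
    (huv : G.Adj u v) : A (x * n + u) = 0 ↔ Gᶜ.Adj x u := by
  rw [← not_iff_not, ← Ne.eq_def, h.adj, SimpleGraph.compl_adj]
  constructor
  · rintro (h1 | ⟨rfl, -⟩) ⟨h2, h3⟩
    exacts [h3 h1, h2 rfl]
  · intro h1
    by_cases h2 : x = u
    · exact Or.inr ⟨h2, v, h2 ▸ huv⟩
    · exact Or.inl (by by_contra h3; exact h1 ⟨h2, h3⟩)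

/-- The diagonal does no harm here: `x = v` is impossible, as `v` is adjacent to `u` and `x` is not.
-/
theorem RepresentsGraph.ne_zero_iff (h : RepresentsGraph G M A D₀ D₁) {x u v : Fin n}
    (huv : G.Adj u v) (hx : Gᶜ.Adj x u) : A (x * n + v) ≠ 0 ↔ G.Adj x v := by
  rw [h.adj]
  refine ⟨?_, Or.inl⟩
  rintro (h1 | ⟨rfl, -⟩)
  · exact h1
  · exact absurd huv.symm ((SimpleGraph.compl_adj _ _ _).1 hx).2

/-- Forcing in the complement, without trivial pairs. -/
def ComplForces (G : SimpleGraph (Fin n)) (p q : Fin n × Fin n) : Prop :=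
  Forces Gᶜ p q ∧ p ≠ q

theorem complForces_symm (p q : Fin n × Fin n) (h : ComplForces G p q) : ComplForces G q p :=
  ⟨h.1.symm, h.2.symm⟩

theorem complForces_swap (p q : Fin n × Fin n) (h : ComplForces G p q) :
    ComplForces G p.swap q.swap :=
  ⟨h.1.swap, fun h' => h.2 (Prod.swap_injective h')⟩

theorem adj_of_not_compl_adj {b c : Fin n} (hne : b ≠ c) (h : ¬ Gᶜ.Adj b c) : G.Adj b c := by
  rw [SimpleGraph.compl_adj] at h
  tauto

/-- A nontrivial forcing in the complement is an edge of `G` between the two free ends, together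
with a vertex adjacent to neither. Running over darts yields both orders of the free ends. -/
theorem RepresentsGraph.exists_complArc_iff (h : RepresentsGraph G M A D₀ D₁) (P Q R : ℕ) :
    (∃ d < M, ∃ a < n, ComplArc n A D₀ D₁ d a P Q R) ↔
      ∃ p q, ComplForces G p q ∧ P = pairCode p ∧ Q = pairCode q ∧ R = pairCode p.swap := by
  constructor
  · rintro ⟨d, hd, a, ha, h1, h2, h3⟩
    obtain ⟨u, v, huv, hu, hv⟩ := h.dart d hd
    rw [hu, hv] at h3
    rw [hu] at h1
    rw [hv] at h2
    have hau : Gᶜ.Adj (⟨a, ha⟩ : Fin n) u := (h.eq_zero_iff huv).1 h1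
    have hav : Gᶜ.Adj (⟨a, ha⟩ : Fin n) v := (h.eq_zero_iff huv.symm).1 h2
    have hn : ¬ Gᶜ.Adj u v := fun h' => ((SimpleGraph.compl_adj _ _ _).1 h').2 huv
    rcases h3 with ⟨rfl, rfl, rfl⟩ | ⟨rfl, rfl, rfl⟩
    · exact ⟨_, _, ⟨.right hau hav hn, by simp [huv.ne]⟩, rfl, rfl, rfl⟩
    · exact ⟨_, _, ⟨.left hau.symm hav.symm hn, by simp [huv.ne]⟩, rfl, rfl, rfl⟩
  · rintro ⟨p, q, ⟨hf, hne⟩, rfl, rfl, rfl⟩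
    cases hf with
    | @right a b c hb hc hn =>
      have hbc : G.Adj b c := adj_of_not_compl_adj (by rintro rfl; exact hne rfl) hn
      obtain ⟨d, hd, h1, h2⟩ := h.exists_dart b c hbc
      refine ⟨d, hd, a, a.2, ?_, ?_, ?_⟩
      · rw [h1]
        exact (h.eq_zero_iff hbc).2 hb
      · rw [h2]
        exact (h.eq_zero_iff hbc.symm).2 hc
      · rw [h1, h2]
        exact Or.inl ⟨rfl, rfl, rfl⟩
    | @left a b c hb hc hn =>
      have hbc : G.Adj b c := adj_of_not_compl_adj (by rintro rfl; exact hne rfl) hn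
      obtain ⟨d, hd, h1, h2⟩ := h.exists_dart b c hbc
      refine ⟨d, hd, a, a.2, ?_, ?_, ?_⟩
      · rw [h1]
        exact (h.eq_zero_iff hbc).2 hb.symm
      · rw [h2]
        exact (h.eq_zero_iff hbc.symm).2 hc.symm
      · rw [h1, h2]
        exact Or.inr ⟨rfl, rfl, rfl⟩

theorem isQuasiTransitiveOrientation_labelOrientation {N : ℕ} {X Y R L : ℕ → ℕ}
    (h : RepresentsRel N X Y R (ComplForces G)) (hL : IsComponentLabelling N X Y L)
    (hne : ∀ j < N, L (X j) ≠ L (R j)) :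
    IsQuasiTransitiveOrientation Gᶜ (labelOrientation Gᶜ L) := by
  refine ⟨isOrientation_labelOrientation _ _, fun a b c hb hc hn hab => ?_⟩
  by_cases hbc : b = c
  · exact hbc ▸ hab
  · exact ⟨hc, h.labelLT hL hne complForces_swap (p := (a, b)) (q := (a, c))
      ⟨.right hb hc hn, by simp [hbc]⟩ hab.2⟩

theorem IsCocomparabilityGraph.label_ne {N : ℕ} {X Y R L : ℕ → ℕ}
    (hG : IsCocomparabilityGraph G) (h : RepresentsRel N X Y R (ComplForces G))
    (hL : IsComponentLabelling N X Y L) : ∀ j < N, L (X j) ≠ L (R j) := by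
  obtain ⟨F, hF⟩ := hG
  have hQ := hF.isQuasiTransitiveOrientation
  refine h.ne_of_invariant hL (F := F) (fun p q hpq => ?_) fun p q hpq => ?_
  · exact ⟨hQ.forces hpq.1, hQ.forces hpq.1.symm⟩
  · exact hF.1.2 _ _ hpq.1.symm.adj

/-- If the check succeeds, the labels give a quasi-transitive orientation of the complement, and
Ghouila-Houri's theorem applies. Conversely, a transitive orientation is invariant under forcing and
separates each pair from its reverse. -/
theorem label_ne_iff_isCocomparabilityGraph {N : ℕ} {X Y R L : ℕ → ℕ}
    (h : RepresentsRel N X Y R (ComplForces G)) (hL : IsComponentLabelling N X Y L) :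
    (∀ j < N, L (X j) ≠ L (R j)) ↔ IsCocomparabilityGraph G :=
  ⟨fun hne => (isQuasiTransitiveOrientation_labelOrientation h hL hne).isComparabilityGraph,
    fun hG => IsCocomparabilityGraph.label_ne hG h hL⟩

/-! Forcing by squares. -/

/-- The test for the path `u, v, w` to be part of a square. -/
def PathTest (G : SimpleGraph (Fin n)) (O : Fin n → Fin n → Prop) (u v w : Fin n) : Prop :=
  G.Adj u v ∧ G.Adj v w ∧ Gᶜ.Adj u w ∧
    ((O u w ∧ (HasBelow G O v w ∨ HasAbove G O v u)) ∨
      (¬ O u w ∧ (HasBelow G O v u ∨ HasAbove G O v w)))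

/-- Only the orientation property is used. The second stage runs even if the first has failed, and
its search needs a symmetric relation in that case too. -/
theorem PathTest.symm {O : Fin n → Fin n → Prop} (hO : IsOrientation Gᶜ O) {u v w : Fin n}
    (h : PathTest G O u v w) : PathTest G O w v u := by
  obtain ⟨h1, h2, h3, h4⟩ := h
  have h5 := hO.2 u w h3
  refine ⟨h2.symm, h1.symm, h3.symm, ?_⟩
  tauto

/-- Exactly one of `O u w` and `O w u` holds, so one of the path and its reversal meets the
hypothesis of the criterion for a fourth vertex. -/
theorem pathTest_iff {O : Fin n → Fin n → Prop} (hO : IsQuasiTransitiveOrientation Gᶜ O)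
    {u v w : Fin n} : PathTest G O u v w ↔ ∃ x, IsFourCycle G u v w x := by
  constructor
  · rintro ⟨h1, h2, h3, ⟨h4, h5⟩ | ⟨h4, h5⟩⟩
    · exact (exists_isFourCycle_iff hO h1 h2 h4).2 h5
    · have h6 : O w u := hO.1.of_not h3.symm h4
      obtain ⟨x, hx⟩ := (exists_isFourCycle_iff hO h2.symm h1.symm h6).2 h5
      exact ⟨x, hx.reverse⟩
  · rintro ⟨x, hx⟩
    have h3 : Gᶜ.Adj u w := (SimpleGraph.compl_adj _ _ _).2 ⟨hx.uw_ne, hx.uw⟩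
    refine ⟨hx.uv, hx.vw, h3, ?_⟩
    by_cases h4 : O u w
    · exact Or.inl ⟨h4, (exists_isFourCycle_iff hO hx.uv hx.vw h4).1 ⟨x, hx⟩⟩
    · have h6 : O w u := hO.1.of_not h3.symm h4
      exact Or.inr ⟨h4, (exists_isFourCycle_iff hO hx.vw.symm hx.uv.symm h6).1 ⟨x, hx.reverse⟩⟩

/-- Forcing between the directions of the edges of the graph. -/
def SquareForces (G : SimpleGraph (Fin n)) (O : Fin n → Fin n → Prop) (p q : Fin n × Fin n) :
    Prop :=
  ∃ u v w, PathTest G O u v w ∧ ((p = (u, v) ∧ q = (w, v)) ∨ (p = (v, u) ∧ q = (v, w)))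

theorem squareForces_symm {O : Fin n → Fin n → Prop} (hO : IsOrientation Gᶜ O)
    (p q : Fin n × Fin n) (h : SquareForces G O p q) : SquareForces G O q p := by
  obtain ⟨u, v, w, h, h'⟩ := h
  exact ⟨w, v, u, h.symm hO, by tauto⟩

theorem squareForces_swap {O : Fin n → Fin n → Prop} (p q : Fin n × Fin n)
    (h : SquareForces G O p q) : SquareForces G O p.swap q.swap := by
  obtain ⟨u, v, w, h, ⟨rfl, rfl⟩ | ⟨rfl, rfl⟩⟩ := h
  · exact ⟨u, v, w, h, Or.inr ⟨rfl, rfl⟩⟩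
  · exact ⟨u, v, w, h, Or.inl ⟨rfl, rfl⟩⟩

/-- The condition `p` is left open so that the same statement serves for both flags, with the
orientation and with its negation. -/
theorem RepresentsGraph.exists_flag_iff (h : RepresentsGraph G M A D₀ D₁) {v w : Fin n}
    (hvw : G.Adj v w) (p : Fin n → Fin n → Prop) (p' : ℕ → ℕ → Prop)
    (hp : ∀ x, Gᶜ.Adj x v → (p' x v ↔ p x v)) :
    (∃ d < M, ∃ x < n, A (x * n + D₀ d) = 0 ∧ A (x * n + D₁ d) ≠ 0 ∧ p' x (D₀ d) ∧
      (v * n + w : ℕ) = D₀ d * n + D₁ d) ↔ ∃ x, x ≠ v ∧ ¬ G.Adj x v ∧ G.Adj x w ∧ p x v := by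
  constructor
  · rintro ⟨d, hd, x, hx, h1, h2, h3, h4⟩
    obtain ⟨v', w', hvw', hv', hw'⟩ := h.dart d hd
    rw [hv', hw', pair_code_inj w.2 w'.2] at h4
    obtain rfl : v = v' := Fin.ext h4.1
    obtain rfl : w = w' := Fin.ext h4.2
    rw [hv'] at h1 h3
    rw [hw'] at h2
    have hxv : Gᶜ.Adj (⟨x, hx⟩ : Fin n) v := (h.eq_zero_iff hvw).1 h1
    have hxw := (h.ne_zero_iff hvw hxv).1 h2
    obtain ⟨h5, h6⟩ := (SimpleGraph.compl_adj _ _ _).1 hxv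
    exact ⟨⟨x, hx⟩, h5, h6, hxw, (hp _ hxv).1 h3⟩
  · rintro ⟨x, h5, h6, hxw, h3⟩
    obtain ⟨d, hd, hv', hw'⟩ := h.exists_dart v w hvw
    have hxv : Gᶜ.Adj x v := (SimpleGraph.compl_adj _ _ _).2 ⟨h5, h6⟩
    refine ⟨d, hd, x, x.2, ?_, ?_, ?_, by rw [hv', hw']⟩
    · rw [hv']
      exact (h.eq_zero_iff hvw).2 hxv
    · rw [hw']
      exact (h.ne_zero_iff hvw hxv).2 hxw
    · rw [hv']
      exact (hp _ hxv).2 h3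

theorem RepresentsGraph.exists_squareArc_iff (h : RepresentsGraph G M A D₀ D₁)
    {L DN UP : ℕ → ℕ}
    (hDN : ∀ v w : Fin n, G.Adj v w →
      (DN (v * n + w) ≠ 0 ↔ HasBelow G (labelOrientation Gᶜ L) v w))
    (hUP : ∀ v w : Fin n, G.Adj v w →
      (UP (v * n + w) ≠ 0 ↔ HasAbove G (labelOrientation Gᶜ L) v w)) (P Q R : ℕ) :
    (∃ d < M, ∃ a < n, SquareArc n A D₀ D₁ L DN UP d a P Q R) ↔
      ∃ p q, SquareForces G (labelOrientation Gᶜ L) p q ∧ P = pairCode p ∧ Q = pairCode q ∧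
        R = pairCode p.swap := by
  have key : ∀ u v w : Fin n, G.Adj u v → G.Adj v w → Gᶜ.Adj u w →
      (SquareTest n L DN UP u v w ↔ PathTest G (labelOrientation Gᶜ L) u v w) := by
    intro u v w huv hvw huw
    have hl : labelOrientation Gᶜ L u w ↔ LabelLT L n u w := by simp [labelOrientation, huw]
    rw [SquareTest, hDN v w hvw, hUP v u huv.symm, hDN v u huv.symm, hUP v w hvw, PathTest, hl]
    simp [huv, hvw, huw]
  constructor
  · rintro ⟨d, hd, w, hw, h1, h2, h3, h4⟩
    obtain ⟨u, v, huv, hu, hv⟩ := h.dart d hd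
    rw [hu, hv] at h3 h4
    rw [hu] at h1
    rw [hv] at h2
    have hwu : Gᶜ.Adj (⟨w, hw⟩ : Fin n) u := (h.eq_zero_iff huv).1 h1
    have hwv := (h.ne_zero_iff huv hwu).1 h2
    have ht := (key u v ⟨w, hw⟩ huv hwv.symm hwu.symm).1 h3
    rcases h4 with ⟨rfl, rfl, rfl⟩ | ⟨rfl, rfl, rfl⟩
    · exact ⟨_, _, ⟨u, v, ⟨w, hw⟩, ht, Or.inl ⟨rfl, rfl⟩⟩, rfl, rfl, rfl⟩
    · exact ⟨_, _, ⟨u, v, ⟨w, hw⟩, ht, Or.inr ⟨rfl, rfl⟩⟩, rfl, rfl, rfl⟩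
  · rintro ⟨p, q, ⟨u, v, w, ht, hpq⟩, rfl, rfl, rfl⟩
    obtain ⟨d, hd, hu, hv⟩ := h.exists_dart u v ht.1
    have hwu := ht.2.2.1.symm
    refine ⟨d, hd, w, w.2, ?_, ?_, ?_, ?_⟩
    · rw [hu]
      exact (h.eq_zero_iff ht.1).2 hwu
    · rw [hv]
      exact (h.ne_zero_iff ht.1 hwu).2 ht.2.1.symm
    · rw [hu, hv]
      exact (key u v w ht.1 ht.2.1 ht.2.2.1).2 ht
    · rw [hu, hv]
      rcases hpq with ⟨rfl, rfl⟩ | ⟨rfl, rfl⟩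
      · exact Or.inl ⟨rfl, rfl, rfl⟩
      · exact Or.inr ⟨rfl, rfl, rfl⟩

/-- The orientation `O` is used twice: it makes the path test exact, and its existence shows that
`G` is a cocomparability graph, so that only chordless 4-cycles matter. -/
theorem isAlternatingOrientation_labelOrientation {N : ℕ} {X Y R L : ℕ → ℕ}
    {O : Fin n → Fin n → Prop} (hO : IsQuasiTransitiveOrientation Gᶜ O)
    (h : RepresentsRel N X Y R (SquareForces G O)) (hL : IsComponentLabelling N X Y L)
    (hne : ∀ j < N, L (X j) ≠ L (R j)) :
    IsAlternatingOrientation G (labelOrientation G L) := by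
  refine isAlternatingOrientation_of_isFourCycle hO.isComparabilityGraph
    (isOrientation_labelOrientation _ _) fun u v w x hx huv => ⟨hx.vw.symm, ?_⟩
  exact h.labelLT hL hne squareForces_swap (p := (u, v)) (q := (w, v))
    ⟨u, v, w, (pathTest_iff hO).2 ⟨x, hx⟩, Or.inl ⟨rfl, rfl⟩⟩ huv.2

theorem IsAlternatelyOrientable.label_ne {N : ℕ} {X Y R L : ℕ → ℕ} {O : Fin n → Fin n → Prop}
    (hO : IsQuasiTransitiveOrientation Gᶜ O) (hG : IsAlternatelyOrientable G)
    (h : RepresentsRel N X Y R (SquareForces G O)) (hL : IsComponentLabelling N X Y L) :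
    ∀ j < N, L (X j) ≠ L (R j) := by
  obtain ⟨F, hF⟩ := hG
  have key : ∀ u v w, PathTest G O u v w → (F u v ↔ F w v) := by
    intro u v w ht
    obtain ⟨x, hx⟩ := (pathTest_iff hO).1 ht
    exact ⟨hF.of_isFourCycle hx, hF.of_isFourCycle hx.reverse⟩
  refine h.ne_of_invariant hL (F := F) ?_ ?_
  · rintro _ _ ⟨u, v, w, ht, ⟨rfl, rfl⟩ | ⟨rfl, rfl⟩⟩
    · exact key u v w ht
    · have h1 := hF.1.2 _ _ ht.1.symm
      have h2 := hF.1.2 _ _ ht.2.1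
      have h3 := key u v w ht
      simp only
      tauto
  · rintro _ _ ⟨u, v, w, ht, ⟨rfl, rfl⟩ | ⟨rfl, rfl⟩⟩
    · exact hF.1.2 _ _ ht.1
    · exact hF.1.2 _ _ ht.1.symm

end Graph

/-! ### The recognition program -/

section Input

variable {n m : ℕ} {G : SimpleGraph (Fin n)} {es : Fin m → Fin n × Fin n}

theorem _root_.IsEdgeList.adj_iff (h : IsEdgeList G es) {u v : Fin n} :
    G.Adj u v ↔ ∃ i, (u = (es i).1 ∧ v = (es i).2) ∨ (u = (es i).2 ∧ v = (es i).1) := by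
  rw [← SimpleGraph.mem_edgeSet, ← h.2]
  simp only [Set.mem_range, Sym2.eq_iff]
  refine exists_congr fun i => ?_
  simp only [eq_comm, and_comm]

theorem _root_.IsEdgeList.le_mul (h : IsEdgeList G es) : m ≤ n * n := by
  have hinj : Function.Injective es := fun i j hij => h.1 (by simp only [hij])
  simpa using Fintype.card_le_of_injective es hinj

theorem inputState_arr_zero (i : Fin m) : (inputState es).arr 0 i = (es i).1 := by
  simp [inputState]

theorem inputState_arr_one (i : Fin m) : (inputState es).arr 1 i = (es i).2 := by
  simp [inputState]

theorem inputState_arr_eq_zero {a : ℕ} (ha : 2 ≤ a) : (inputState es).arr a = fun _ => 0 := by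
  funext i
  simp [inputState, show a ≠ 0 by omega, show a ≠ 1 by omega]

theorem inputState_reg_eq_zero {x : ℕ} (hx : 2 ≤ x) : (inputState es).reg x = 0 := by
  simp [inputState, show x ≠ 0 by omega, show x ≠ 1 by omega]

theorem inputState_bdd {B : ℕ} (hn : n ≤ B) (hm : m ≤ B) : (inputState es).Bdd B := by
  refine ⟨fun x => ?_, fun a i => ?_⟩
  · simp only [inputState]
    split_ifs <;> omega
  · simp only [inputState]
    split_ifs with h1 h2 h3
    · exact ((es ⟨i, h1⟩).1.2.le).trans hn
    · exact ((es ⟨i, h1⟩).2.2.le).trans hn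
    · exact Nat.zero_le _
    · exact Nat.zero_le _

theorem inputState_arr_lt {i : ℕ} (hi : i < m) :
    (inputState es).arr 0 i < n ∧ (inputState es).arr 1 i < n := by
  have h0 := inputState_arr_zero (es := es) ⟨i, hi⟩
  have h1 := inputState_arr_one (es := es) ⟨i, hi⟩
  rw [h0, h1]
  exact ⟨Fin.is_lt _, Fin.is_lt _⟩

/-- An edge requires a vertex, so loops over the edges fit into the time bound even when `n = 0`. -/
theorem _root_.IsEdgeList.le_mul_right (h : IsEdgeList G es) : m ≤ n * m := by
  rcases Nat.eq_zero_or_pos m with rfl | hm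
  · exact Nat.zero_le _
  · have : 0 < n := (Nat.zero_le _).trans_lt (es ⟨0, hm⟩).1.2
    exact Nat.le_mul_of_pos_left m this

theorem representsGraph_of_setup (h : IsEdgeList G es) {A D₀ D₁ : ℕ → ℕ}
    (hA : ∀ x < n, ∀ y < n, A (x * n + y) ≠ 0 ↔ ∃ i < m,
      (x = (inputState es).arr 0 i ∧ y = (inputState es).arr 1 i) ∨
      (x = (inputState es).arr 1 i ∧ y = (inputState es).arr 0 i) ∨
      (x = (inputState es).arr 0 i ∧ y = (inputState es).arr 0 i) ∨
      (x = (inputState es).arr 1 i ∧ y = (inputState es).arr 1 i))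
    (hD : ∀ i < m, D₀ i = (inputState es).arr 0 i ∧ D₁ i = (inputState es).arr 1 i ∧
      D₀ (m + i) = (inputState es).arr 1 i ∧ D₁ (m + i) = (inputState es).arr 0 i) :
    RepresentsGraph G (2 * m) A D₀ D₁ where
  adj := by
    intro x y
    rw [hA x x.2 y y.2, h.adj_iff]
    constructor
    · rintro ⟨i, hi, h1⟩
      have e0 := inputState_arr_zero (es := es) ⟨i, hi⟩
      have e1 := inputState_arr_one (es := es) ⟨i, hi⟩
      simp only at e0 e1
      simp only [e0, e1, Fin.val_inj] at h1
      rcases h1 with h1 | h1 | ⟨h1, h2⟩ | ⟨h1, h2⟩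
      · exact Or.inl ⟨_, Or.inl h1⟩
      · exact Or.inl ⟨_, Or.inr h1⟩
      · exact Or.inr ⟨h1.trans h2.symm, _, h.adj_iff.2 ⟨⟨i, hi⟩, Or.inl ⟨h1, rfl⟩⟩⟩
      · exact Or.inr ⟨h1.trans h2.symm, _, h.adj_iff.2 ⟨⟨i, hi⟩, Or.inr ⟨h1, rfl⟩⟩⟩
    · have key : ∀ i : Fin m, ((x = (es i).1 ∧ y = (es i).2) ∨ (x = (es i).2 ∧ y = (es i).1) ∨
          (x = (es i).1 ∧ y = (es i).1) ∨ (x = (es i).2 ∧ y = (es i).2)) → ∃ i < m,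
          ((x : ℕ) = (inputState es).arr 0 i ∧ (y : ℕ) = (inputState es).arr 1 i) ∨
          ((x : ℕ) = (inputState es).arr 1 i ∧ (y : ℕ) = (inputState es).arr 0 i) ∨
          ((x : ℕ) = (inputState es).arr 0 i ∧ (y : ℕ) = (inputState es).arr 0 i) ∨
          ((x : ℕ) = (inputState es).arr 1 i ∧ (y : ℕ) = (inputState es).arr 1 i) := by
        intro i hi
        refine ⟨i, i.2, ?_⟩
        rw [inputState_arr_zero, inputState_arr_one]
        simpa only [Fin.val_inj] using hi
      rintro (⟨i, hi⟩ | ⟨rfl, z, hz⟩)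
      · exact key i (by tauto)
      · obtain ⟨i, hi⟩ := h.adj_iff.1 hz
        exact key i (by tauto)
  dart := by
    intro d hd
    by_cases hdm : d < m
    · obtain ⟨h1, h2, -⟩ := hD d hdm
      refine ⟨_, _, h.adj_iff.2 ⟨⟨d, hdm⟩, Or.inl ⟨rfl, rfl⟩⟩, ?_, ?_⟩
      · rw [h1, ← inputState_arr_zero]
      · rw [h2, ← inputState_arr_one]
    · obtain ⟨i, rfl⟩ := Nat.exists_eq_add_of_le (not_lt.1 hdm)
      have him : i < m := by omega
      obtain ⟨-, -, h1, h2⟩ := hD i him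
      refine ⟨_, _, h.adj_iff.2 ⟨⟨i, him⟩, Or.inr ⟨rfl, rfl⟩⟩, ?_, ?_⟩
      · rw [h1, ← inputState_arr_one]
      · rw [h2, ← inputState_arr_zero]
  exists_dart := by
    intro u v huv
    obtain ⟨i, ⟨rfl, rfl⟩ | ⟨rfl, rfl⟩⟩ := h.adj_iff.1 huv
    · obtain ⟨h1, h2, -⟩ := hD i i.2
      exact ⟨i, by omega, by rw [h1, inputState_arr_zero], by rw [h2, inputState_arr_one]⟩
    · obtain ⟨-, -, h1, h2⟩ := hD i i.2
      exact ⟨m + i, by omega, by rw [h1, inputState_arr_one], by rw [h2, inputState_arr_zero]⟩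

end Input

/-! The program consists of two stages and the output. -/

def complStage : Cmd :=
  .seq setup (.seq complLoop (.seq (components 10 10) (checkLoop 10 10)))

def squareStage : Cmd :=
  .seq flagLoop (.seq squareLoop (.seq (components 20 11) (checkLoop 20 11)))

def recognize : Cmd :=
  .seq complStage (.seq squareStage (.seq outputLoop (.assign 0 (.sub (.lit 1) (.reg 12)))))

section Cost

variable {n m : ℕ}

theorem loop_cost_le (h : m ≤ n * m) (K : ℕ) : m * K + 6 ≤ (K + 6) * (n * m + 1) := by
  nlinarith [Nat.mul_le_mul_right K h, Nat.zero_le (n * m)]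

/-- The constant is `28 + 6`: the overhead `14` for each of `2 * m` darts, absorbed by `m ≤ n * m`,
and the fixed cost of the outer loop. -/
theorem nested_loop_cost_le (h : m ≤ n * m) (K : ℕ) :
    2 * m * (n * K + 14) + 6 ≤ (2 * K + 34) * (n * m + 1) := by
  nlinarith [Nat.zero_le K]

/-- The hypothesis on `N` reflects two arcs for each of the `2 * m * n` pairs of a dart and a
vertex. -/
theorem arcs_cost_le {N : ℕ} (h : N ≤ 2 * (2 * m * n)) (K : ℕ) :
    K * (N + 1) ≤ 4 * K * (n * m + 1) := by
  nlinarith [Nat.mul_le_mul_left K h, Nat.zero_le K]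

theorem arcs_loop_cost_le {N : ℕ} (h : N ≤ 2 * (2 * m * n)) (K : ℕ) :
    N * K + 6 ≤ (4 * K + 6) * (n * m + 1) := by
  nlinarith [Nat.mul_le_mul_left K h, Nat.zero_le (n * m)]

end Cost

def complStageCost : ℕ :=
  4 + (setupBody.maxCost + 8 + 6) + (2 * (complBody.maxCost + 8) + 34) +
    4 * componentsCost 10 10 + (4 * ((checkBody 10).maxCost + 8) + 6)

def squareStageCost : ℕ :=
  (2 * (flagBody.maxCost + 8) + 34) + (2 * (squareBody.maxCost + 8) + 34) +
    4 * componentsCost 20 11 + (4 * ((checkBody 20).maxCost + 8) + 6)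

section Stages

variable {n m : ℕ} {G : SimpleGraph (Fin n)} {es : Fin m → Fin n × Fin n}

/-- The memory after the first stage, which has decided whether the graph is a cocomparability
graph. -/
structure ComplStagePost (G : SimpleGraph (Fin n)) (es : Fin m → Fin n × Fin n) (s : State) :
    Prop where
  reg_zero : s.reg 0 = n
  reg_one : s.reg 1 = m
  reg_two : s.reg 2 = 2 * m
  reg_eleven : s.reg 11 = 0
  arr_zero : s.arr 0 = (inputState es).arr 0
  arr_one : s.arr 1 = (inputState es).arr 1
  -- These are the arrays that the second stage expects to be zero: the flags (`7`, `8`), and the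
  -- list heads and labels of its search (`23`, `25`). Register `11` will count its arcs.
  arr_eq : ∀ a, a = 7 ∨ a = 8 ∨ a = 23 ∨ a = 25 → s.arr a = fun _ => 0
  graph : RepresentsGraph G (2 * m) (s.arr 4) (s.arr 5) (s.arr 6)
  accept_iff : s.reg 12 = 0 ↔ IsCocomparabilityGraph G
  orientation : s.reg 12 = 0 →
    IsQuasiTransitiveOrientation Gᶜ (labelOrientation Gᶜ (s.arr 15))

/-- There are at most `4 * (n * m)` arcs, and the search asks for words up to three times their
number plus 3. The other bound accommodates the codes of pairs and the number of vertices. -/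
theorem ends_complStage {B : ℕ} (h : IsEdgeList G es) (hB : n * n + n ≤ B)
    (hB' : 12 * (n * m) + 3 ≤ B) :
    Ends B complStage (inputState es) (complStageCost * (n * m + 1)) (ComplStagePost G es) := by
  have hmn := h.le_mul_right
  have hs₀ : (inputState es).Bdd B := inputState_bdd (by omega) (by omega)
  have hmul : 2 * (2 * m * n) = 4 * (n * m) := by ring
  have hsetup := ((ends_setup hs₀ (n := n) (m := m) (by omega) (by omega) (by omega) rfl rfl
    (fun i hi => inputState_arr_lt hi) (inputState_arr_eq_zero (by omega))).frame).mono
    (K' := (4 + (setupBody.maxCost + 8 + 6)) * (n * m + 1))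
    (by have := loop_cost_le hmn (setupBody.maxCost + 8); nlinarith [Nat.zero_le (n * m)])
    fun _ _ h => h
  refine (hsetup.seq (K' := (2 * (complBody.maxCost + 8) + 34) * (n * m + 1) +
    (4 * componentsCost 10 10 * (n * m + 1) +
      (4 * ((checkBody 10).maxCost + 8) + 6) * (n * m + 1))) ?_).mono
    (by unfold complStageCost; ring_nf; omega) fun _ _ h => h
  rintro s1 hs1 ⟨⟨r2, hA, hD⟩, hreg1, harr1⟩
  have hG := representsGraph_of_setup h hA hD
  have g0 : s1.reg 0 = n := hreg1 0 (by simp [setup, setupBody, Cmd.for, Cmd.SetsReg])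
  have g1 : s1.reg 1 = m := hreg1 1 (by simp [setup, setupBody, Cmd.for, Cmd.SetsReg])
  have g : ∀ x, x = 10 ∨ x = 11 ∨ x = 12 → s1.reg x = 0 := by
    intro x hx
    rw [hreg1 x, inputState_reg_eq_zero (by omega)]
    rcases hx with rfl | rfl | rfl <;> simp [setup, setupBody, Cmd.for, Cmd.SetsReg]
  have k : ∀ a, a ≠ 4 ∧ a ≠ 5 ∧ a ≠ 6 → s1.arr a = (inputState es).arr a := by
    rintro a ⟨h1, h2, h3⟩
    exact harr1 a (by simp [setup, setupBody, Cmd.for, Cmd.SetsArr, h1, h2, h3])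
  have hDlt : ∀ d < 2 * m, s1.arr 5 d < n ∧ s1.arr 6 d < n := by
    intro d hd
    obtain ⟨u, v, -, h1, h2⟩ := hG.dart d hd
    exact ⟨h1 ▸ u.2, h2 ▸ v.2⟩
  refine Ends.seq (((ends_complLoop hs1 (n := n) (M := 2 * m) (by omega) (by omega) g0 r2
    (g 10 (by omega)) hDlt).frame).mono (nested_loop_cost_le hmn _) fun _ _ h => h) ?_
  rintro s2 hs2 ⟨⟨hN, harc⟩, hreg2, harr2⟩
  have hrel : RepresentsRel (s2.reg 10) (s2.arr 10) (s2.arr 11) (s2.arr 12) (ComplForces G) :=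
    fun P Q R => (harc P Q R).trans (hG.exists_complArc_iff P Q R)
  have k2 : ∀ a, a ≠ 10 ∧ a ≠ 11 ∧ a ≠ 12 → s2.arr a = s1.arr a := by
    rintro a ⟨h1, h2, h3⟩
    exact harr2 a (by simp [complLoop, complBody, force, push, Cmd.for, Cmd.SetsArr, h1, h2, h3])
  have g2 : ∀ x, x = 0 ∨ x = 1 ∨ x = 2 ∨ x = 11 ∨ x = 12 → s2.reg x = s1.reg x := by
    intro x hx
    refine hreg2 x ?_
    rcases hx with rfl | rfl | rfl | rfl | rfl <;>
      simp [complLoop, complBody, force, push, Cmd.for, Cmd.SetsReg]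
  refine Ends.seq (((ends_components (b := 10) (c := 10) (by omega) (by omega)
    (fun j hj => (hrel.lt j hj).trans_le (by omega)) (hrel.symm_arcs complForces_symm) hs2 rfl rfl
    rfl ?_ ?_).frame).mono (arcs_cost_le hN _) fun _ _ h => h) ?_
  · rw [k2 _ (by omega), k _ (by omega), inputState_arr_eq_zero (by omega)]
  · rw [k2 _ (by omega), k _ (by omega), inputState_arr_eq_zero (by omega)]
  rintro s3 hs3 ⟨hL, hreg3, harr3⟩
  have k3 : ∀ a, a < 13 ∨ 17 ≤ a → s3.arr a = s2.arr a := by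
    intro a ha
    refine harr3 a ?_
    simp [components, linkBody, searchInit, searchBody, visit, Cmd.for, Cmd.SetsArr]
    omega
  have g3 : ∀ x, x < 13 ∧ x ≠ 3 → s3.reg x = s2.reg x := by
    intro x hx
    refine hreg3 x ?_
    simp [components, linkBody, searchInit, searchBody, visit, Cmd.for, Cmd.SetsReg]
    omega
  refine (((ends_checkLoop (b := 10) (c := 10) (N := s2.reg 10) hs3 (by omega) (by omega)
    (g3 10 (by omega))).frame).mono (arcs_loop_cost_le hN _) ?_)
  rintro s4 - ⟨hcheck, hreg4, harr4⟩
  have k4 : s4.arr = s3.arr := by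
    funext a
    exact harr4 a (by simp [checkLoop, checkBody, Cmd.for, Cmd.SetsArr])
  have g4 : ∀ x, x < 12 ∧ x ≠ 3 → s4.reg x = s3.reg x := by
    intro x hx
    refine hreg4 x ?_
    simp [checkLoop, checkBody, Cmd.for, Cmd.SetsReg]
    omega
  have hfail : s4.reg 12 = 0 ↔
      ∀ j < s2.reg 10, s3.arr 15 (s2.arr 10 j) ≠ s3.arr 15 (s2.arr 12 j) := by
    rw [hcheck, g3 12 (by omega), g2 12 (by omega), g 12 (by omega), k3 (10 + 2) (by omega),
      k3 10 (by omega)]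
    simp
  have hk : ∀ a, a < 10 ∨ 17 ≤ a → s4.arr a = s1.arr a := by
    intro a ha
    rw [k4, k3 a (by omega), k2 a (by omega)]
  have hg : ∀ x, x = 0 ∨ x = 1 ∨ x = 2 ∨ x = 11 → s4.reg x = s1.reg x := by
    intro x hx
    rw [g4 x (by omega), g3 x (by omega), g2 x (by omega)]
  exact
    { reg_zero := by rw [hg 0 (by omega), g0]
      reg_one := by rw [hg 1 (by omega), g1]
      reg_two := by rw [hg 2 (by omega), r2]
      reg_eleven := by rw [hg 11 (by omega), g 11 (by omega)]
      arr_zero := by rw [hk 0 (by omega), k 0 (by omega)]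
      arr_one := by rw [hk 1 (by omega), k 1 (by omega)]
      arr_eq := fun a ha => by
        rw [hk a (by omega), k a (by omega), inputState_arr_eq_zero (by omega)]
      graph := by rw [hk 4 (by omega), hk 5 (by omega), hk 6 (by omega)]; exact hG
      accept_iff := hfail.trans (label_ne_iff_isCocomparabilityGraph hrel hL)
      orientation := fun h0 => by
        rw [k4]
        exact isQuasiTransitiveOrientation_labelOrientation hrel hL (hfail.1 h0) }

/-- The memory after the second stage, which has decided whether the graph has an alternating
orientation. -/
structure SquareStagePost (G : SimpleGraph (Fin n)) (es : Fin m → Fin n × Fin n) (s : State) :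
    Prop where
  reg_zero : s.reg 0 = n
  reg_one : s.reg 1 = m
  arr_zero : s.arr 0 = (inputState es).arr 0
  arr_one : s.arr 1 = (inputState es).arr 1
  accept_iff : s.reg 12 = 0 ↔ IsCocomparabilityGraph G ∧ IsAlternatelyOrientable G
  orientation : s.reg 12 = 0 → IsAlternatingOrientation G (labelOrientation G (s.arr 25))

/-- The stage is run unconditionally, and its time bound needs only that the labels define some
orientation of the complement. Quasi-transitivity is invoked only when register `12` was zero
beforehand. -/
theorem ends_squareStage {B : ℕ} (h : IsEdgeList G es) (hB : n * n + n ≤ B)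
    (hB' : 12 * (n * m) + 3 ≤ B) {s : State} (hs : s.Bdd B) (hpost : ComplStagePost G es s) :
    Ends B squareStage s (squareStageCost * (n * m + 1)) (SquareStagePost G es) := by
  have hmn := h.le_mul_right
  have hmul : 2 * (2 * m * n) = 4 * (n * m) := by ring
  have hG := hpost.graph
  have hDlt : ∀ d < 2 * m, s.arr 5 d < n ∧ s.arr 6 d < n := by
    intro d hd
    obtain ⟨u, v, -, h1, h2⟩ := hG.dart d hd
    exact ⟨h1 ▸ u.2, h2 ▸ v.2⟩
  refine ((((ends_flagLoop hs (n := n) (M := 2 * m) (by omega) (by omega) hpost.reg_zero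
    hpost.reg_two (hpost.arr_eq 7 (by omega)) (hpost.arr_eq 8 (by omega)) hDlt).frame).mono
    (nested_loop_cost_le hmn _) fun _ _ h => h).seq
    (K' := (2 * (squareBody.maxCost + 8) + 34) * (n * m + 1) +
    (4 * componentsCost 20 11 * (n * m + 1) +
      (4 * ((checkBody 20).maxCost + 8) + 6) * (n * m + 1))) ?_).mono
    (by unfold squareStageCost; ring_nf; omega) fun _ _ h => h
  rintro s1 hs1 ⟨⟨hDN, hUP⟩, hreg1, harr1⟩
  have k1 : ∀ a, a ≠ 7 ∧ a ≠ 8 → s1.arr a = s.arr a := by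
    rintro a ⟨h1, h2⟩
    exact harr1 a (by simp [flagLoop, flagBody, orient, Cmd.for, Cmd.SetsArr, h1, h2])
  have g1 : ∀ x, x = 0 ∨ x = 1 ∨ x = 2 ∨ x = 11 ∨ x = 12 → s1.reg x = s.reg x := by
    intro x hx
    refine hreg1 x ?_
    rcases hx with rfl | rfl | rfl | rfl | rfl <;>
      simp [flagLoop, flagBody, orient, Cmd.for, Cmd.SetsReg]
  have hDN' : ∀ v w : Fin n, G.Adj v w →
      (s1.arr 7 (v * n + w) ≠ 0 ↔ HasBelow G (labelOrientation Gᶜ (s.arr 15)) v w) := by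
    intro v w hvw
    rw [hDN]
    exact hG.exists_flag_iff hvw _ (fun x y => LabelLT (s.arr 15) n x y) fun x hx => by
      simp [labelOrientation, hx]
  have hUP' : ∀ v w : Fin n, G.Adj v w →
      (s1.arr 8 (v * n + w) ≠ 0 ↔ HasAbove G (labelOrientation Gᶜ (s.arr 15)) v w) := by
    intro v w hvw
    rw [hUP]
    exact hG.exists_flag_iff hvw (fun x y => ¬ labelOrientation Gᶜ (s.arr 15) x y)
      (fun x y => ¬ LabelLT (s.arr 15) n x y) fun x hx => by
      simp [labelOrientation, hx]
  refine Ends.seq (((ends_squareLoop hs1 (n := n) (M := 2 * m) (by omega) (by omega)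
    (by rw [g1 0 (by omega), hpost.reg_zero]) (by rw [g1 2 (by omega), hpost.reg_two])
    (by rw [g1 11 (by omega), hpost.reg_eleven]) ?_).frame).mono (nested_loop_cost_le hmn _)
    fun _ _ h => h) ?_
  · rw [k1 5 (by omega), k1 6 (by omega)]
    exact hDlt
  rintro s2 hs2 ⟨⟨hN, harc⟩, hreg2, harr2⟩
  set O := labelOrientation Gᶜ (s.arr 15) with hO
  have hOr : IsOrientation Gᶜ O := isOrientation_labelOrientation _ _
  have hrel : RepresentsRel (s2.reg 11) (s2.arr 20) (s2.arr 21) (s2.arr 22)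
      (SquareForces G O) := by
    intro P Q R
    refine (harc P Q R).trans ?_
    rw [k1 4 (by omega), k1 5 (by omega), k1 6 (by omega), k1 15 (by omega)]
    exact hG.exists_squareArc_iff hDN' hUP' P Q R
  have k2 : ∀ a, a ≠ 20 ∧ a ≠ 21 ∧ a ≠ 22 → s2.arr a = s1.arr a := by
    rintro a ⟨h1, h2, h3⟩
    exact harr2 a (by
      simp [squareLoop, squareBody, orient, force, push, Cmd.for, Cmd.SetsArr, h1, h2, h3])
  have g2 : ∀ x, x = 0 ∨ x = 1 ∨ x = 12 → s2.reg x = s1.reg x := by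
    intro x hx
    refine hreg2 x ?_
    rcases hx with rfl | rfl | rfl <;>
      simp [squareLoop, squareBody, orient, force, push, Cmd.for, Cmd.SetsReg]
  refine Ends.seq (((ends_components (b := 20) (c := 11) (by omega) (by omega)
    (fun j hj => (hrel.lt j hj).trans_le (by omega)) (hrel.symm_arcs (squareForces_symm hOr)) hs2
    rfl rfl rfl ?_ ?_).frame).mono (arcs_cost_le hN _) fun _ _ h => h) ?_
  · rw [k2 _ (by omega), k1 _ (by omega), hpost.arr_eq _ (by omega)]
  · rw [k2 _ (by omega), k1 _ (by omega), hpost.arr_eq _ (by omega)]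
  rintro s3 hs3 ⟨hL, hreg3, harr3⟩
  have k3 : ∀ a, a < 23 → s3.arr a = s2.arr a := by
    intro a ha
    refine harr3 a ?_
    simp [components, linkBody, searchInit, searchBody, visit, Cmd.for, Cmd.SetsArr]
    omega
  have g3 : ∀ x, x < 13 ∧ x ≠ 3 → s3.reg x = s2.reg x := by
    intro x hx
    refine hreg3 x ?_
    simp [components, linkBody, searchInit, searchBody, visit, Cmd.for, Cmd.SetsReg]
    omega
  refine (((ends_checkLoop (b := 20) (c := 11) (N := s2.reg 11) hs3 (by omega) (by omega)
    (g3 11 (by omega))).frame).mono (arcs_loop_cost_le hN _) ?_)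
  rintro s4 - ⟨hcheck, hreg4, harr4⟩
  have k4 : s4.arr = s3.arr := by
    funext a
    exact harr4 a (by simp [checkLoop, checkBody, Cmd.for, Cmd.SetsArr])
  have g4 : ∀ x, x < 12 ∧ x ≠ 3 → s4.reg x = s3.reg x := by
    intro x hx
    refine hreg4 x ?_
    simp [checkLoop, checkBody, Cmd.for, Cmd.SetsReg]
    omega
  have hfail : s4.reg 12 = 0 ↔ s.reg 12 = 0 ∧
      ∀ j < s2.reg 11, s3.arr 25 (s2.arr 20 j) ≠ s3.arr 25 (s2.arr 22 j) := by
    rw [hcheck, g3 12 (by omega), g2 12 (by omega), g1 12 (by omega), k3 (20 + 2) (by omega),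
      k3 20 (by omega)]
  have hk : ∀ a, a < 7 → s4.arr a = s.arr a := by
    intro a ha
    rw [k4, k3 a (by omega), k2 a (by omega), k1 a (by omega)]
  have hg : ∀ x, x = 0 ∨ x = 1 → s4.reg x = s.reg x := by
    intro x hx
    rw [g4 x (by omega), g3 x (by omega), g2 x (by omega), g1 x (by omega)]
  have halt : s4.reg 12 = 0 → IsAlternatingOrientation G (labelOrientation G (s3.arr 25)) :=
    fun h0 => isAlternatingOrientation_labelOrientation (hpost.orientation (hfail.1 h0).1) hrel hL
      (hfail.1 h0).2
  exact
    { reg_zero := by rw [hg 0 (by omega), hpost.reg_zero]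
      reg_one := by rw [hg 1 (by omega), hpost.reg_one]
      arr_zero := by rw [hk 0 (by omega), hpost.arr_zero]
      arr_one := by rw [hk 1 (by omega), hpost.arr_one]
      accept_iff := by
        constructor
        · exact fun h0 => ⟨hpost.accept_iff.1 (hfail.1 h0).1, _, halt h0⟩
        · rintro ⟨h1, h2⟩
          have h0 := hpost.accept_iff.2 h1
          exact hfail.2 ⟨h0, IsAlternatelyOrientable.label_ne (hpost.orientation h0) h2 hrel hL⟩
      orientation := by
        rw [k4]
        exact halt }

def recognizeCost : ℕ :=
  complStageCost + squareStageCost + (outputBody.maxCost + 8 + 6) + 4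

theorem ends_recognize {B : ℕ} (h : IsEdgeList G es) (hB : n * n + n ≤ B)
    (hB' : 12 * (n * m) + 3 ≤ B) :
    Ends B recognize (inputState es) (recognizeCost * (n * m + 1)) fun s =>
      (IsCocomparabilityGraph G ∧ IsAlternatelyOrientable G →
        s.reg 0 = 1 ∧ ∃ F, IsAlternatingOrientation G F ∧ OutputsArcs m s F) ∧
      (¬ (IsCocomparabilityGraph G ∧ IsAlternatelyOrientable G) → s.reg 0 = 0) := by
  have hmn := h.le_mul_right
  refine ((ends_complStage h hB hB').seq (K' := squareStageCost * (n * m + 1) +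
    ((outputBody.maxCost + 8 + 6) * (n * m + 1) + 4)) ?_).mono
    (by unfold recognizeCost; ring_nf; omega) fun _ _ h => h
  intro s1 hs1 h1
  refine (ends_squareStage h hB hB' hs1 h1).seq ?_
  intro s2 hs2 h2
  refine Ends.seq (((ends_outputLoop hs2 (n := n) (m := m) (by omega) (by omega) h2.reg_zero
    h2.reg_one ?_).frame).mono (loop_cost_le hmn _) fun _ _ h => h) ?_
  · rw [h2.arr_zero, h2.arr_one]
    exact fun i hi => inputState_arr_lt hi
  rintro s3 hs3 ⟨hout, hreg3, -⟩
  have g12 : s3.reg 12 = s2.reg 12 :=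
    hreg3 12 (by simp [outputLoop, outputBody, orient, Cmd.for, Cmd.SetsReg])
  -- Truncated subtraction turns the failure flag into the answer: `1` if it is zero, and `0`
  -- otherwise.
  refine (Cmd.Safe.ends (c := .assign 0 (.sub (.lit 1) (.reg 12))) ?_ hs3 ⟨?_, ?_⟩).mono le_rfl
    fun _ _ h => h
  · exact ⟨show 1 ≤ B by omega, trivial⟩
  · intro hG
    have h0 := h2.accept_iff.2 hG
    refine ⟨by simp [Cmd.run, Expr.eval, State.setReg_reg, g12, h0], _, h2.orientation h0, ?_⟩
    rw [h2.arr_zero, h2.arr_one] at hout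
    have hor := isOrientation_labelOrientation G (s2.arr 25)
    refine ⟨fun i hi => ?_, fun u v huv => ?_⟩
    · have hi' := hout i hi
      have e0 := inputState_arr_zero (es := es) ⟨i, hi⟩
      have e1 := inputState_arr_one (es := es) ⟨i, hi⟩
      simp only at e0 e1
      rw [e0, e1] at hi'
      have hadj : G.Adj (es ⟨i, hi⟩).1 (es ⟨i, hi⟩).2 := h.adj_iff.2 ⟨_, Or.inl ⟨rfl, rfl⟩⟩
      rcases hi' with ⟨h3, h4, h5⟩ | ⟨h3, h4, h5⟩
      · exact ⟨_, _, ⟨hadj, h3⟩, h4, h5⟩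
      · exact ⟨_, _, hor.of_not hadj.symm fun h' => h3 h'.2, h4, h5⟩
    · obtain ⟨i, hi⟩ := h.adj_iff.1 huv.1
      have hi' := hout i i.2
      rw [inputState_arr_zero, inputState_arr_one] at hi'
      refine ⟨i, i.2, ?_⟩
      rcases hi with ⟨rfl, rfl⟩ | ⟨rfl, rfl⟩
      · rcases hi' with ⟨h3, h4, h5⟩ | ⟨h3, h4, h5⟩
        · exact ⟨h4, h5⟩
        · exact absurd huv.2 h3
      · rcases hi' with ⟨h3, h4, h5⟩ | ⟨h3, h4, h5⟩
        · exact absurd ⟨huv.1.symm, h3⟩ (hor.asymm huv)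
        · exact ⟨h4, h5⟩
  · intro hG
    have h0 : s2.reg 12 ≠ 0 := fun h0 => hG (h2.accept_iff.1 h0)
    simp only [Cmd.run, Expr.eval, State.setReg_reg, g12, if_true]
    omega

end Stages

end RAM

theorem mainTheorem3 :
    -- One program recognizes the alternately orientable cocomparability graphs in `O(nm)` steps,
    -- with words of `O(log n)` bits, and outputs an alternating orientation when there is one.
    (∃ (P : RAM.Cmd) (k C : ℕ), ∀ (n m : ℕ) (G : SimpleGraph (Fin n))
      (es : Fin m → Fin n × Fin n), IsEdgeList G es →
        ∃ (t : ℕ) (s : RAM.State),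
          RAM.Runs ((n + 2) ^ k) P (inputState es) t s ∧
          t ≤ C * (n * m + 1) ∧
          (IsCocomparabilityGraph G ∧ IsAlternatelyOrientable G →
            s.reg 0 = 1 ∧ ∃ F, IsAlternatingOrientation G F ∧ OutputsArcs m s F) ∧
          (¬ (IsCocomparabilityGraph G ∧ IsAlternatelyOrientable G) → s.reg 0 = 0)) ∧
    -- The auxiliary graph is bipartite exactly if the cocomparability graph is alternately
    -- orientable, and each colour class of a 2-colouring is an alternating orientation.
    (∀ (V : Type*) [Finite V] (G : SimpleGraph V), IsCocomparabilityGraph G →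
      ((auxGraph G).IsBipartite ↔ IsAlternatelyOrientable G) ∧
      ∀ (c : (auxGraph G).Coloring (Fin 2)) (b : Fin 2),
        IsAlternatingOrientation G (fun u v => ∃ h : G.Adj u v, c ⟨(u, v), h⟩ = b)) := by
  refine ⟨⟨RAM.recognize, 7, RAM.recognizeCost, fun n m G es h => ?_⟩, fun V _ G hG =>
    ⟨isBipartite_auxGraph_iff hG, isAlternatingOrientation_of_coloring hG⟩⟩
  -- The exponent 7 is 3 for the cubic bound on `n * m`, plus 4 to absorb the constant 16, since `2
  -- ^ 4 ≤ (n + 2) ^ 4`.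
  have h16 : 16 * (n + 2) ^ 3 ≤ (n + 2) ^ 7 := by
    calc 16 * (n + 2) ^ 3 = 2 ^ 4 * (n + 2) ^ 3 := by norm_num
      _ ≤ (n + 2) ^ 4 * (n + 2) ^ 3 := by gcongr; omega
      _ = (n + 2) ^ 7 := by ring
  have hnm : n * m ≤ n * (n * n) := Nat.mul_le_mul_left n h.le_mul
  have h3 : 12 * (n * (n * n)) + 3 ≤ 16 * (n + 2) ^ 3 := by
    nlinarith [Nat.zero_le (n * n), Nat.zero_le (n * (n * n))]
  have h2 : n * n + n ≤ 16 * (n + 2) ^ 3 := by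
    nlinarith [Nat.zero_le (n * n), Nat.zero_le (n * (n * n))]
  obtain ⟨t, s, hrun, ht, -, hacc, hrej⟩ := RAM.ends_recognize (B := (n + 2) ^ 7) h
    (h2.trans h16) (by omega)
  exact ⟨t, s, hrun, ht, hacc, hrej⟩
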